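/- **Theorem 3.2.** *Notation.* All logarithms are natural, words are finite words over $\{0,1\}$, and $0\log 0=0$. Let $S$ be a binary finite type constraint, i.e. the set of all words containing no word of some finite set $F$ as a contiguous subword. Assume that $S$ is irreducible (for all $u,v\in S$ there is $w\in S$ with $uwv\in S$) and contains a nonempty word. Its topological order $\hat m=\hat m(S)$ is the least $m\ge 0$ for which there is a set $F'$ of words of length $m+1$ such that a word of length at least $m+1$ lies in $S$ if and only if it has no contiguous subword in $F'$. For a binary process $X$, let $\mathcal A(X)$ be the set of words that $X$ takes with positive probability, with $\mathcal A(X_{-n}^0)$ restricted to words of length $n+1$. For stationary $X$, write $p_X(w)$ for the probability that a block of $X$ of the length of $w$ equals $w$. Let $Z_\varepsilon=X\oplus E$ be the output of the binary symmetric channel with crossover probability $\varepsilon$ on input $X$, where $E$ is i.i.d. Bernoulli$(\varepsilon)$ noise independent of $X$; write $p_{Z_\varepsilon}$ for its word probabilities. Let $H(X)=\lim_n \frac1{n+1}H(X_{-n}^0)$ be the entropy rate. Put $$\mathcal H_n(S,\varepsilon)=\sup H(Z_0(\varepsilon)\mid Z_{-n}^{-1}(\varepsilon)),\qquad h_m(S,\varepsilon)=\sup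 H(Z_\varepsilon),$$ the first supremum over all stationary processes $X_{-n}^0$ of length $n+1$ with $\mathcal A(X_{-n}^0)\subseteq S$, the second over all stationary irreducible $m$-th order Markov chains $X$ with $\mathcal A(X)\subseteq S$. Let $C(S)$ be the noiseless capacity, i.e. the value at $\varepsilon=0$ of $$C(S,\varepsilon)=\lim_{n\to\infty}\ \sup_{\mathcal A(X_{-n}^0)\subseteq S}\frac{H(Z_{-n}^0(\varepsilon))-H(Z_{-n}^0(\varepsilon)\mid X_{-n}^0)}{n+1},$$ where $X_{-n}^0$ need not be stationary. For stationary $X$ and a word $u$ of length $k$ let $h(u)=\sum_{u'}p_X(u')-k\,p_X(u)$, where $u'$ runs over the $k$ words obtained from $u$ by flipping exactly one letter. With $w$ ranging over words of length $n$, $v$ over single letters, and $p_X(v|w)=p_X(wv)/p_X(w)$, put $$f_n(X)=\sum_{w\in\mathcal A(X),\,wv\notin\mathcal A(X)}h(wv),$$ $$g_n(X)=-\sum_{wv\in\mathcal A(X)}\Big(h(wv)\log p_X(v|w)+\frac{h(wv)p_X(w)-h(w)p_X(wv)}{p_X(w)}\Big)-\sum_{w\in\mathcal A(X),\,wv\notin\mathcal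 A(X)}h(wv)\log\frac{h(wv)}{p_X(w)}-\sum_{p_{Z_\varepsilon}(w)=\Theta(\varepsilon),\,p_{Z_\varepsilon}(wv)=\Theta(\varepsilon)}h(wv)\log\frac{h(wv)}{h(w)},$$ where $\Theta(\varepsilon)$ refers to $\varepsilon\to0^+$ and the empty word counts as a word of probability $1$. *Claim.* There is a process $X_{\max}$ which, for every $m\ge\hat m$, is the unique maximizer (in law) of the entropy rate $H(X)$ among the stationary irreducible $m$-th order Markov chains $X$ with $\mathcal A(X)=S$ (so it is itself of order $\hat m$). With $f(X_{\max})=f_{2\hat m}(X_{\max})$ and $g(X_{\max})=g_{3\hat m}(X_{\max})$, the following hold as $\varepsilon\to0^+$. 1. For every $n\ge 3\hat m$, $$\mathcal H_n(S,\varepsilon)=C(S)+f(X_{\max})\,\varepsilon\log(1/\varepsilon)+g(X_{\max})\,\varepsilon+O(\varepsilon^2\log^2\varepsilon).$$ 2. For every $m\ge\hat m$, $$h_m(S,\varepsilon)=C(S)+f(X_{\max})\,\varepsilon\log(1/\varepsilon)+g(X_{\max})\,\varepsilon+O(\varepsilon^2\log^2\varepsilon).$$ The constants in the error terms may depend on $S$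 and on $n$, respectively $m$. -/

import Mathlib

open Filter Topology Asymptotics

namespace BSC

/-! ### Constraints.  A binary word is a `List Bool`, read from left to right,
`w_{-n} ⋯ w_{-1}`, and `u <:+: w` says that `u` is a contiguous subword of `w`. -/

/-- `S` is a binary finite type constraint: the set of all finite words that contain no word of
some finite set `F` of forbidden words. -/
def IsFiniteType (S : Set (List Bool)) : Prop :=
  ∃ F : Set (List Bool), F.Finite ∧ S = {w | ∀ u ∈ F, ¬ u <:+: w}

/-- `S` is irreducible: any two words of `S` can be joined by a word of `S` inside `S`. -/
def IsIrreducible (S : Set (List Bool)) : Prop :=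
  ∀ u ∈ S, ∀ v ∈ S, ∃ w ∈ S, u ++ w ++ v ∈ S

/-- The topological order `m̂(S)`: the least `m` such that `S` is defined by a set of forbidden
words that all have length `m + 1`.  Such a set says nothing about words of length at most `m`,
so it is required to define `S` among the words of length at least `m + 1`. -/
noncomputable def topOrder (S : Set (List Bool)) : ℕ :=
  sInf {m : ℕ | ∃ F : Set (List Bool), (∀ u ∈ F, u.length = m + 1) ∧
    ∀ w : List Bool, m + 1 ≤ w.length → (w ∈ S ↔ ∀ u ∈ F, ¬ u <:+: w)}

/-! ### Stationary processes, given by their finite dimensional distributions -/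

/-- `p` is the law of a stationary binary process of length `N`: for every word `w` with
`w.length ≤ N`, the number `p w` is the probability that a block of `w.length` consecutive
variables of the process equals `w`.  (Values of `p` at longer words carry no information.) -/
structure IsStationaryOfLength (N : ℕ) (p : List Bool → ℝ) : Prop where
  nil : p [] = 1
  nonneg : ∀ w : List Bool, w.length ≤ N → 0 ≤ p w
  append : ∀ w : List Bool, w.length < N → p (w ++ [false]) + p (w ++ [true]) = p w
  cons : ∀ w : List Bool, w.length < N → p (false :: w) + p (true :: w) = p w

/-- `p` is the law of a stationary left-infinite binary process: a consistent, shift invariant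
family of distributions of finite blocks. -/
def IsStationary (p : List Bool → ℝ) : Prop :=
  ∀ N : ℕ, IsStationaryOfLength N p

/-- The set of allowed words of a left-infinite process. -/
def allowed (p : List Bool → ℝ) : Set (List Bool) := {w | 0 < p w}

/-- The set of allowed words of a process of length `N`. -/
def allowedOfLength (N : ℕ) (p : List Bool → ℝ) : Set (List Bool) :=
  {w | w.length = N ∧ 0 < p w}

/-- `p` is the law of a stationary irreducible binary Markov chain of order `m`: given the last `m`
variables, the next one does not depend on the earlier ones, and the chain of `m`-blocks of positive
probability is irreducible (from `u` one reaches `v` along a word of positive probability that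
begins with `u` and ends with `v`). -/
structure IsMarkovChain (m : ℕ) (p : List Bool → ℝ) : Prop where
  stationary : IsStationary p
  markov : ∀ (u w : List Bool) (a : Bool), w.length = m →
    p (u ++ w ++ [a]) * p w = p (u ++ w) * p (w ++ [a])
  irreducible : ∀ u v : List Bool, u.length = m → v.length = m → 0 < p u → 0 < p v →
    ∃ w : List Bool, 0 < p w ∧ u <+: w ∧ v <:+ w

/-! ### Entropy (natural logarithm) -/

/-- The entropy of a block of length `n`. -/
noncomputable def blockEntropy (p : List Bool → ℝ) (n : ℕ) : ℝ :=
  ∑ w : Fin n → Bool, Real.negMulLog (p (List.ofFn w))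

/-- The conditional entropy `H(X_0 | X_{-n}^{-1})`. -/
noncomputable def condEntropy (p : List Bool → ℝ) (n : ℕ) : ℝ :=
  -∑ w : Fin n → Bool, ∑ v : Bool,
    p (List.ofFn w ++ [v]) * Real.log (p (List.ofFn w ++ [v]) / p (List.ofFn w))

/-- The entropy rate `H(X)`, the limit of `H(X_{-n}^0) / (n + 1)` (which exists for every
stationary process). -/
noncomputable def entropyRate (p : List Bool → ℝ) : ℝ :=
  limUnder atTop (fun n : ℕ => blockEntropy p (n + 1) / ((n : ℝ) + 1))

/-! ### The binary symmetric channel with crossover probability `ε` -/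

/-- The probability that the channel turns the block `x` into the block `z`. -/
def bscKernel (ε : ℝ) {N : ℕ} (x z : Fin N → Bool) : ℝ :=
  ∏ i, if x i = z i then 1 - ε else ε

/-- The law of the output process `Z_ε` when the input process has law `p`. -/
def output (ε : ℝ) (p : List Bool → ℝ) (z : List Bool) : ℝ :=
  ∑ x : Fin z.length → Bool, p (List.ofFn x) * bscKernel ε x z.get

/-- `𝓗_n(S, ε)`: the supremum of `H(Z_0(ε) | Z_{-n}^{-1}(ε))` over the stationary processes of
length `n + 1` supported in `S` (these conditional entropies lie between `0` and `log 2`). -/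
noncomputable def supCondEntropy (S : Set (List Bool)) (n : ℕ) (ε : ℝ) : ℝ :=
  sSup {H : ℝ | ∃ p : List Bool → ℝ, IsStationaryOfLength (n + 1) p ∧
    allowedOfLength (n + 1) p ⊆ S ∧ H = condEntropy (output ε p) n}

/-- `h_m(S, ε)`: the supremum of `H(Z_ε)` over the irreducible Markov chains of order `m` supported
in `S`. -/
noncomputable def supEntropyRate (S : Set (List Bool)) (m : ℕ) (ε : ℝ) : ℝ :=
  sSup {H : ℝ | ∃ p : List Bool → ℝ, IsMarkovChain m p ∧
    allowed p ⊆ S ∧ H = entropyRate (output ε p)}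

/-- `H(Z) - H(Z | X)` for an input block `X` with (not necessarily stationary) distribution `q`. -/
noncomputable def mutualInfo (ε : ℝ) {N : ℕ} (q : (Fin N → Bool) → ℝ) : ℝ :=
  (∑ z : Fin N → Bool, Real.negMulLog (∑ x : Fin N → Bool, q x * bscKernel ε x z))
    - ∑ x : Fin N → Bool, q x * ∑ z : Fin N → Bool, Real.negMulLog (bscKernel ε x z)

/-- The noisy constrained capacity `C(S, ε)`: the limit of the largest mutual information per letter
over all input blocks of length `n + 1` supported in `S`. -/
noncomputable def noisyCapacity (S : Set (List Bool)) (ε : ℝ) : ℝ :=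
  limUnder atTop (fun n : ℕ =>
    sSup {I : ℝ | ∃ q ∈ stdSimplex ℝ (Fin (n + 1) → Bool),
      (∀ x, 0 < q x → List.ofFn x ∈ S) ∧ I = mutualInfo ε q} / ((n : ℝ) + 1))

/-- The noiseless capacity `C(S) = C(S, 0)`. -/
noncomputable def capacity (S : Set (List Bool)) : ℝ := noisyCapacity S 0

/-! ### The coefficients `f` and `g` -/

/-- `h(u)`: the sum of the probabilities of the words obtained from `u` by flipping one letter,
minus `u.length` times the probability of `u`. -/
def flipSum (p : List Bool → ℝ) (u : List Bool) : ℝ :=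
  (∑ i ∈ Finset.range u.length, p (u.modify i not)) - (u.length : ℝ) * p u

/-- `f_n^0`, the coefficient of `ε log (1 / ε)`. -/
noncomputable def fCoeff (n : ℕ) (p : List Bool → ℝ) : ℝ :=
  open Classical in
  ∑ w : Fin n → Bool, ∑ v : Bool,
    if List.ofFn w ∈ allowed p ∧ List.ofFn w ++ [v] ∉ allowed p then
      flipSum p (List.ofFn w ++ [v]) else 0

/-- The probability of the output word `w` is of exact order `ε` as `ε → 0⁺`. -/
def OutputThetaEps (p : List Bool → ℝ) (w : List Bool) : Prop :=
  (fun ε : ℝ => output ε p w) =Θ[𝓝[>] 0] (fun ε : ℝ => ε)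

/-- `g_n^0`, the coefficient of `ε`. -/
noncomputable def gCoeff (n : ℕ) (p : List Bool → ℝ) : ℝ :=
  open Classical in
  -(∑ w : Fin n → Bool, ∑ v : Bool,
      if List.ofFn w ++ [v] ∈ allowed p then
        flipSum p (List.ofFn w ++ [v])
            * Real.log (p (List.ofFn w ++ [v]) / p (List.ofFn w))
          + (flipSum p (List.ofFn w ++ [v]) * p (List.ofFn w)
              - flipSum p (List.ofFn w) * p (List.ofFn w ++ [v])) / p (List.ofFn w)
      else 0)
  - (∑ w : Fin n → Bool, ∑ v : Bool,
      if List.ofFn w ∈ allowed p ∧ List.ofFn w ++ [v] ∉ allowed p then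
        flipSum p (List.ofFn w ++ [v])
          * Real.log (flipSum p (List.ofFn w ++ [v]) / p (List.ofFn w))
      else 0)
  - (∑ w : Fin n → Bool, ∑ v : Bool,
      if OutputThetaEps p (List.ofFn w) ∧ OutputThetaEps p (List.ofFn w ++ [v]) then
        flipSum p (List.ofFn w ++ [v])
          * Real.log (flipSum p (List.ofFn w ++ [v]) / flipSum p (List.ofFn w))
      else 0)

/-! ### The chain of maximal entropy -/

/-- `p` maximizes the entropy rate over all Markov chains of order `m` whose set of allowed words
is `S`. -/
structure IsMaxEntropyChain (S : Set (List Bool)) (m : ℕ) (p : List Bool → ℝ) : Prop where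
  markovChain : IsMarkovChain m p
  allowed_eq : allowed p = S
  entropyRate_le : ∀ q : List Bool → ℝ, IsMarkovChain m q → allowed q = S →
    entropyRate q ≤ entropyRate p

end BSC

/-!
The measure of maximal entropy `p` of `S` (the Parry measure, `IsLanguage.exists_isParry`, from a
Perron eigenvector, `exists_pos_eigenvector`) is the input to compare with. Its transition
probabilities are `p (v | w) = exp (ρ (w v) - ρ w) / t`, so that `- log p (v | w)` has the same mean
`log t = C(S)` under every stationary process supported in `S`
(`IsParry.sum_mul_log_ratio`, `IsParry.capacity_eq`). Gibbs' inequality with a quadratic remainder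
(`condEntropy_le`) and the uniqueness of the stationary distribution
(`IsParry.eq_zero_of_transition`) then make `p` the only stationary process on `S` of entropy rate
`C(S)`.

*Upper bound.* Apply the same inequality to the outputs, with the transition probabilities of the
output of `p`. An input at distance `x` from `p` changes the linear part by at most
`K ε log (1 / ε) x`, since this part does not change at all for `ε = 0`, and it loses at least
`d x²`, since the stationary distribution is unique and finite dimensional linear problems are
stable. Hence no input beats `p` by more than `(K ε log (1 / ε))² / (4 d)`, which is within the
error term (`IsParry.exists_condEntropy_output_le`). This covers the entropy rates of Markov chains
as well, because an entropy rate is at most any conditional entropy of the same process.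

*Expansion at `p`.* A block probability of the output is `p u + h(u) ε + O(ε²)`, where `h` is
`flipSum`, and expanding `- P log P` term by term gives conditional entropies of the form
`C(S) + F ε log (1 / ε) + G ε + O(ε² log² ε)` (`IsParry.partialCondEntropy_expansion`).
For a past of any length `n ≥ 3 m`, where `m` is the topological order, the conditional entropy lies
between the one with a past of length `3 m`, and the one where moreover the first `m` of these `3 m`
letters are transmitted without error: these clean letters separate the rest of the past from the
future (`IsParry.partialCondEntropy_le`). The two bounds have the same coefficients
(`IsParry.condF_eq_condF_zero`, `IsParry.condG_eq_condG_zero`), because an error that far in the past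
is either invisible and forgotten, or detected and known to be over; and these coefficients are
`fCoeff (2 m) p` and `gCoeff (3 m) p`. As the lower bound is uniform in `n`, it holds for the
entropy rate of the output too.
-/

namespace BSC

/-! ### Sums over the words of a given length -/

/-- The finite set of binary words of length `n`. -/
def words (n : ℕ) : Finset (List Bool) :=
  (Finset.univ : Finset (Fin n → Bool)).map ⟨List.ofFn, List.ofFn_injective⟩

@[simp] lemma mem_words {n : ℕ} {w : List Bool} : w ∈ words n ↔ w.length = n := by
  simp only [words, Finset.mem_map, Finset.mem_univ, true_and, Function.Embedding.coeFn_mk]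
  constructor
  · rintro ⟨a, rfl⟩
    simp
  · rintro rfl
    exact ⟨w.get, List.ofFn_get w⟩

lemma sum_ofFn (n : ℕ) (f : List Bool → ℝ) :
    ∑ w : Fin n → Bool, f (List.ofFn w) = ∑ w ∈ words n, f w := by
  simp [words]

lemma words_zero : words 0 = {[]} := by
  ext w
  simp

@[simp] lemma sum_words_zero (f : List Bool → ℝ) : ∑ w ∈ words 0, f w = f [] := by
  simp [words_zero]

lemma sum_words_add (m n : ℕ) (f : List Bool → ℝ) :
    ∑ w ∈ words (m + n), f w = ∑ u ∈ words m, ∑ v ∈ words n, f (u ++ v) := by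
  rw [← Finset.sum_product' (f := fun u v => f (u ++ v))]
  symm
  refine Finset.sum_nbij' (fun q => q.1 ++ q.2) (fun w => (w.take m, w.drop m)) ?_ ?_ ?_ ?_ ?_
  · rintro ⟨u, v⟩ h
    simp at h ⊢
    omega
  · intro w h
    simp at h ⊢
    omega
  · rintro ⟨u, v⟩ h
    simp at h
    simp [← h.1]
  · intro w h
    simp
  · rintro ⟨u, v⟩ h
    rfl

lemma sum_words_one (f : List Bool → ℝ) : ∑ w ∈ words 1, f w = ∑ b : Bool, f [b] := by
  symm
  refine Finset.sum_nbij' (fun b => [b]) (fun w => w.headI) ?_ ?_ ?_ ?_ ?_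
  · intro b _
    simp
  · intro w _
    simp
  · intro b _
    simp
  · intro w h
    obtain ⟨a, rfl⟩ := List.length_eq_one_iff.1 (mem_words.1 h)
    simp
  · intro b _
    rfl

lemma sum_words_cons (n : ℕ) (f : List Bool → ℝ) :
    ∑ w ∈ words (n + 1), f w = ∑ b : Bool, ∑ w ∈ words n, f (b :: w) := by
  rw [add_comm, sum_words_add, sum_words_one]
  rfl

lemma sum_words_snoc (n : ℕ) (f : List Bool → ℝ) :
    ∑ w ∈ words (n + 1), f w = ∑ w ∈ words n, ∑ b : Bool, f (w ++ [b]) := by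
  rw [sum_words_add]
  exact Finset.sum_congr rfl fun w _ => sum_words_one _

/-- Flipping the letter in position `i` permutes the words of length `n`. -/
lemma sum_words_flip (n i : ℕ) (f : List Bool → ℝ) :
    ∑ w ∈ words n, f (w.modify i not) = ∑ w ∈ words n, f w := by
  have key : ∀ w : List Bool, (w.modify i not).modify i not = w := by
    intro w
    rw [List.modify_modify_eq]
    have : (not ∘ not) = (id : Bool → Bool) := by
      funext b
      simp
    rw [this, List.modify_id]
  refine Finset.sum_nbij' (fun w => w.modify i not) (fun w => w.modify i not) ?_ ?_ ?_ ?_ ?_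
  · intro w h
    simpa using h
  · intro w h
    simpa using h
  · intro w _
    exact key w
  · intro w _
    exact key w
  · intro w _
    rfl

lemma blockEntropy_eq (p : List Bool → ℝ) (n : ℕ) :
    blockEntropy p n = ∑ w ∈ words n, Real.negMulLog (p w) :=
  sum_ofFn n fun w => Real.negMulLog (p w)

lemma condEntropy_eq (p : List Bool → ℝ) (n : ℕ) :
    condEntropy p n =
      -∑ w ∈ words n, ∑ v : Bool, p (w ++ [v]) * Real.log (p (w ++ [v]) / p w) := by
  rw [condEntropy, ← sum_ofFn n fun w => ∑ v : Bool, p (w ++ [v]) * Real.log (p (w ++ [v]) / p w)]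

/-! ### The output of the channel -/

/-- The probability that the channel turns the word `x` into the word `z`, by recursion on the
words; it is `0` if the lengths differ. -/
def chanProb (ε : ℝ) : List Bool → List Bool → ℝ
  | [], [] => 1
  | a :: x, b :: z => (if a = b then 1 - ε else ε) * chanProb ε x z
  | [], _ :: _ => 0
  | _ :: _, [] => 0

lemma chanProb_ofFn (ε : ℝ) : ∀ {n : ℕ} (x z : Fin n → Bool),
    bscKernel ε x z = chanProb ε (List.ofFn x) (List.ofFn z)
  | 0, x, z => by simp [bscKernel, chanProb]
  | n + 1, x, z => by
    rw [bscKernel, Fin.prod_univ_succ, List.ofFn_succ, List.ofFn_succ, chanProb,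
      ← chanProb_ofFn ε (fun i => x i.succ) (fun i => z i.succ)]
    rfl

lemma output_eq (ε : ℝ) (p : List Bool → ℝ) (z : List Bool) :
    output ε p z = ∑ x ∈ words z.length, p x * chanProb ε x z := by
  rw [output, ← sum_ofFn z.length fun x => p x * chanProb ε x z]
  refine Finset.sum_congr rfl fun x _ => ?_
  rw [chanProb_ofFn, List.ofFn_get]

lemma chanProb_append (ε : ℝ) : ∀ {x z : List Bool} (x' z' : List Bool), x.length = z.length →
    chanProb ε (x ++ x') (z ++ z') = chanProb ε x z * chanProb ε x' z'
  | [], [], x', z', _ => by simp [chanProb]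
  | a :: x, b :: z, x', z', h => by
    simp only [List.cons_append, chanProb]
    rw [chanProb_append ε x' z' (by simpa using h), mul_assoc]

lemma chanProb_nonneg {ε : ℝ} (h0 : 0 ≤ ε) (h1 : ε ≤ 1) : ∀ x z : List Bool, 0 ≤ chanProb ε x z
  | [], [] => by simp [chanProb]
  | a :: x, b :: z => by
    have := chanProb_nonneg h0 h1 x z
    rw [chanProb]
    split_ifs
    · exact mul_nonneg (by linarith) this
    · exact mul_nonneg h0 this
  | [], _ :: _ => le_rfl
  | _ :: _, [] => le_rfl

lemma pow_le_chanProb {ε : ℝ} (h0 : 0 ≤ ε) (h1 : ε ≤ 1 / 2) : ∀ {x z : List Bool},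
    x.length = z.length → ε ^ z.length ≤ chanProb ε x z
  | [], [], _ => by simp [chanProb]
  | a :: x, b :: z, h => by
    have ih := pow_le_chanProb h0 h1 (x := x) (z := z) (by simpa using h)
    have hp : 0 ≤ ε ^ z.length := pow_nonneg h0 _
    rw [chanProb, List.length_cons, pow_succ, mul_comm]
    split_ifs
    · exact mul_le_mul (by linarith) ih hp (by linarith)
    · exact mul_le_mul le_rfl ih hp h0

lemma output_nil (ε : ℝ) (p : List Bool → ℝ) : output ε p [] = p [] := by
  simp [output_eq, chanProb]

/-- The output at `b :: z`, in terms of the first input letter. -/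
lemma output_cons (ε : ℝ) (p : List Bool → ℝ) (b : Bool) (z : List Bool) :
    output ε p (b :: z) = (1 - ε) * output ε (fun x => p (b :: x)) z
      + ε * output ε (fun x => p ((!b) :: x)) z := by
  simp only [output_eq, List.length_cons, sum_words_cons, Fintype.sum_bool, chanProb]
  rw [Finset.mul_sum, Finset.mul_sum, ← Finset.sum_add_distrib, ← Finset.sum_add_distrib]
  refine Finset.sum_congr rfl fun x _ => ?_
  cases b <;> simp <;> ring

lemma output_append (ε : ℝ) (p : List Bool → ℝ) (y z : List Bool) :
    output ε p (y ++ z) =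
      ∑ x ∈ words y.length, chanProb ε x y * output ε (fun x' => p (x ++ x')) z := by
  rw [output_eq, List.length_append, sum_words_add]
  refine Finset.sum_congr rfl fun x hx => ?_
  rw [output_eq, Finset.mul_sum]
  refine Finset.sum_congr rfl fun x' _ => ?_
  rw [chanProb_append ε x' z (mem_words.1 hx)]
  ring

lemma output_congr {ε : ℝ} {p q : List Bool → ℝ} {z : List Bool}
    (h : ∀ x : List Bool, x.length = z.length → p x = q x) : output ε p z = output ε q z := by
  rw [output_eq, output_eq]
  exact Finset.sum_congr rfl fun x hx => by rw [h x (mem_words.1 hx)]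

lemma output_add (ε : ℝ) (p q : List Bool → ℝ) (z : List Bool) :
    output ε (fun x => p x + q x) z = output ε p z + output ε q z := by
  simp only [output_eq, add_mul, Finset.sum_add_distrib]

lemma output_sub (ε : ℝ) (p q : List Bool → ℝ) (z : List Bool) :
    output ε (fun x => p x - q x) z = output ε p z - output ε q z := by
  simp only [output_eq, sub_mul, Finset.sum_sub_distrib]

lemma output_mul_left (ε c : ℝ) (p : List Bool → ℝ) (z : List Bool) :
    output ε (fun x => c * p x) z = c * output ε p z := by
  simp only [output_eq, Finset.mul_sum, mul_assoc]

lemma output_nonneg {ε : ℝ} (h0 : 0 ≤ ε) (h1 : ε ≤ 1) {p : List Bool → ℝ} {z : List Bool}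
    (hp : ∀ x : List Bool, x.length = z.length → 0 ≤ p x) : 0 ≤ output ε p z := by
  rw [output_eq]
  exact Finset.sum_nonneg fun x hx =>
    mul_nonneg (hp x (mem_words.1 hx)) (chanProb_nonneg h0 h1 x z)

lemma pow_le_output {ε : ℝ} (h0 : 0 ≤ ε) (h1 : ε ≤ 1 / 2) {p : List Bool → ℝ} {z : List Bool}
    (hp : ∀ x : List Bool, x.length = z.length → 0 ≤ p x) :
    (∑ x ∈ words z.length, p x) * ε ^ z.length ≤ output ε p z := by
  rw [output_eq, Finset.sum_mul]
  exact Finset.sum_le_sum fun x hx => mul_le_mul_of_nonneg_left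
    (pow_le_chanProb h0 h1 (mem_words.1 hx)) (hp x (mem_words.1 hx))

/-- Summing out the last output letter amounts to summing out the last input letter. -/
lemma sum_output_snoc (ε : ℝ) : ∀ (p : List Bool → ℝ) (z : List Bool),
    ∑ b : Bool, output ε p (z ++ [b]) = output ε (fun x => ∑ b : Bool, p (x ++ [b])) z
  | p, [] => by
    simp only [List.nil_append, output_cons, output_nil, Fintype.sum_bool, Bool.not_true,
      Bool.not_false]
    ring
  | p, a :: z => by
    have h1 := sum_output_snoc ε (fun x => p (a :: x)) z
    have h2 := sum_output_snoc ε (fun x => p ((!a) :: x)) z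
    simp only [List.cons_append, output_cons, Finset.sum_add_distrib, ← Finset.mul_sum]
    rw [h1, h2]

lemma sum_output_cons (ε : ℝ) (p : List Bool → ℝ) (z : List Bool) :
    ∑ b : Bool, output ε p (b :: z) = output ε (fun x => ∑ b : Bool, p (b :: x)) z := by
  simp only [output_cons, Fintype.sum_bool, Bool.not_true, Bool.not_false, output_add]
  ring

lemma IsStationaryOfLength.sum_snoc {N : ℕ} {p : List Bool → ℝ} (hp : IsStationaryOfLength N p)
    {w : List Bool} (hw : w.length < N) : ∑ b : Bool, p (w ++ [b]) = p w := by
  rw [Fintype.sum_bool, add_comm]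
  exact hp.append w hw

lemma IsStationaryOfLength.sum_cons {N : ℕ} {p : List Bool → ℝ} (hp : IsStationaryOfLength N p)
    {w : List Bool} (hw : w.length < N) : ∑ b : Bool, p (b :: w) = p w := by
  rw [Fintype.sum_bool, add_comm]
  exact hp.cons w hw

lemma IsStationary.sum_snoc {p : List Bool → ℝ} (hp : IsStationary p) (w : List Bool) :
    ∑ b : Bool, p (w ++ [b]) = p w := (hp (w.length + 1)).sum_snoc (Nat.lt_succ_self _)

lemma IsStationary.sum_cons {p : List Bool → ℝ} (hp : IsStationary p) (w : List Bool) :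
    ∑ b : Bool, p (b :: w) = p w := (hp (w.length + 1)).sum_cons (Nat.lt_succ_self _)

lemma IsStationary.nonneg {p : List Bool → ℝ} (hp : IsStationary p) (w : List Bool) : 0 ≤ p w :=
  (hp w.length).nonneg w le_rfl

lemma IsStationaryOfLength.sum_words {N : ℕ} {p : List Bool → ℝ} (hp : IsStationaryOfLength N p) :
    ∀ {n : ℕ}, n ≤ N → ∑ w ∈ words n, p w = 1
  | 0, _ => by simpa using hp.nil
  | n + 1, h => by
    rw [sum_words_snoc, ← hp.sum_words (n := n) (by omega)]
    exact Finset.sum_congr rfl fun w hw => hp.sum_snoc (by rw [mem_words.1 hw]; omega)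

lemma IsStationaryOfLength.le_one {N : ℕ} {p : List Bool → ℝ} (hp : IsStationaryOfLength N p)
    {w : List Bool} (hw : w.length ≤ N) : p w ≤ 1 := by
  rw [← hp.sum_words hw]
  exact Finset.single_le_sum (f := p) (fun x hx => hp.nonneg x (by rw [mem_words.1 hx]; exact hw))
    (mem_words.2 rfl)

lemma IsStationaryOfLength.output {N : ℕ} {p : List Bool → ℝ} (hp : IsStationaryOfLength N p)
    {ε : ℝ} (h0 : 0 ≤ ε) (h1 : ε ≤ 1) : IsStationaryOfLength N (output ε p) where
  nil := by rw [output_nil, hp.nil]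
  nonneg w hw := output_nonneg h0 h1 fun x hx => hp.nonneg x (by omega)
  append w hw := by
    have := sum_output_snoc ε p w
    rw [Fintype.sum_bool, add_comm] at this
    rw [this]
    exact output_congr fun x hx => hp.sum_snoc (by omega)
  cons w hw := by
    have := sum_output_cons ε p w
    rw [Fintype.sum_bool, add_comm] at this
    rw [this]
    exact output_congr fun x hx => hp.sum_cons (by omega)

lemma IsStationary.output {p : List Bool → ℝ} (hp : IsStationary p)
    {ε : ℝ} (h0 : 0 ≤ ε) (h1 : ε ≤ 1) : IsStationary (output ε p) :=
  fun N => (hp N).output h0 h1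

lemma abs_output_le {ε : ℝ} (h0 : 0 ≤ ε) (h1 : ε ≤ 1) : ∀ (δ : List Bool → ℝ) (z : List Bool),
    |output ε δ z| ≤ ∑ x ∈ words z.length, |δ x|
  | δ, [] => by simp [output_nil]
  | δ, b :: z => by
    have i1 := abs_output_le h0 h1 (fun x => δ (b :: x)) z
    have i2 := abs_output_le h0 h1 (fun x => δ ((!b) :: x)) z
    rw [output_cons, List.length_cons, sum_words_cons]
    have hs : ∑ a : Bool, ∑ w ∈ words z.length, |δ (a :: w)| =
        ∑ w ∈ words z.length, |δ (b :: w)| + ∑ w ∈ words z.length, |δ ((!b) :: w)| := by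
      cases b <;> simp [add_comm]
    rw [hs]
    refine (abs_add_le _ _).trans (add_le_add ?_ ?_)
    · rw [abs_mul, abs_of_nonneg (by linarith : 0 ≤ 1 - ε)]
      exact (mul_le_of_le_one_left (abs_nonneg _) (by linarith)).trans i1
    · rw [abs_mul, abs_of_nonneg h0]
      exact (mul_le_of_le_one_left (abs_nonneg _) h1).trans i2

/-- The channel moves a (signed) distribution by at most the probability of an error. -/
lemma abs_output_sub_le {ε : ℝ} (h0 : 0 ≤ ε) (h1 : ε ≤ 1) : ∀ (δ : List Bool → ℝ) (z : List Bool),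
    |output ε δ z - δ z| ≤ z.length * ε * ∑ x ∈ words z.length, |δ x|
  | δ, [] => by simp [output_nil]
  | δ, b :: z => by
    have i1 := abs_output_sub_le h0 h1 (fun x => δ (b :: x)) z
    have i2 := abs_output_le h0 h1 (fun x => δ ((!b) :: x)) z
    have i3 : |δ (b :: z)| ≤ ∑ w ∈ words z.length, |δ (b :: w)| :=
      Finset.single_le_sum (f := fun w => |δ (b :: w)|) (fun _ _ => abs_nonneg _)
        (mem_words.2 rfl)
    rw [output_cons, List.length_cons, sum_words_cons]
    have hs : ∑ a : Bool, ∑ w ∈ words z.length, |δ (a :: w)| =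
        ∑ w ∈ words z.length, |δ (b :: w)| + ∑ w ∈ words z.length, |δ ((!b) :: w)| := by
      cases b <;> simp [add_comm]
    rw [hs]
    set A := ∑ w ∈ words z.length, |δ (b :: w)|
    set B := ∑ w ∈ words z.length, |δ ((!b) :: w)|
    have hB : 0 ≤ B := Finset.sum_nonneg fun _ _ => abs_nonneg _
    have hA : 0 ≤ A := Finset.sum_nonneg fun _ _ => abs_nonneg _
    have hn : (0 : ℝ) ≤ z.length := Nat.cast_nonneg _
    have e : (1 - ε) * output ε (fun x => δ (b :: x)) z
        + ε * output ε (fun x => δ ((!b) :: x)) z - δ (b :: z)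
        = (1 - ε) * (output ε (fun x => δ (b :: x)) z - δ (b :: z))
        + ε * output ε (fun x => δ ((!b) :: x)) z - ε * δ (b :: z) := by ring
    rw [e]
    have t1 : |(1 - ε) * (output ε (fun x => δ (b :: x)) z - δ (b :: z))|
        ≤ z.length * ε * A := by
      rw [abs_mul, abs_of_nonneg (by linarith : 0 ≤ 1 - ε)]
      exact (mul_le_of_le_one_left (abs_nonneg _) (by linarith)).trans i1
    have t2 : |ε * output ε (fun x => δ ((!b) :: x)) z| ≤ ε * B := by
      rw [abs_mul, abs_of_nonneg h0]
      exact mul_le_mul_of_nonneg_left i2 h0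
    have t3 : |ε * δ (b :: z)| ≤ ε * A := by
      rw [abs_mul, abs_of_nonneg h0]
      exact mul_le_mul_of_nonneg_left i3 h0
    have t4 := abs_sub ((1 - ε) * (output ε (fun x => δ (b :: x)) z - δ (b :: z))
        + ε * output ε (fun x => δ ((!b) :: x)) z) (ε * δ (b :: z))
    have t5 := abs_add_le ((1 - ε) * (output ε (fun x => δ (b :: x)) z - δ (b :: z)))
        (ε * output ε (fun x => δ ((!b) :: x)) z)
    have t6 : 0 ≤ (z.length : ℝ) * ε * B := by positivity
    push_cast
    linarith

lemma flipSum_cons (p : List Bool → ℝ) (b : Bool) (z : List Bool) :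
    flipSum p (b :: z) = flipSum (fun x => p (b :: x)) z + p ((!b) :: z) - p (b :: z) := by
  simp only [flipSum, List.length_cons, Finset.sum_range_succ', List.modify_succ_cons,
    List.modify_zero_cons]
  push_cast
  ring

/-- To first order in `ε`, only single flips matter. -/
lemma output_expansion (p : List Bool → ℝ) (z : List Bool) :
    (fun ε : ℝ => output ε p z - (p z + flipSum p z * ε)) =O[𝓝[>] 0] fun ε : ℝ => ε ^ 2 := by
  induction z generalizing p with
  | nil => simp [output_nil, flipSum, Asymptotics.isBigO_zero]
  | cons b z ih =>
    have hid : (fun ε : ℝ => (1 - ε)) =O[𝓝[>] 0] fun _ : ℝ => (1 : ℝ) :=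
      ((continuous_const.sub continuous_id).continuousAt.tendsto.mono_left
        nhdsWithin_le_nhds).isBigO_one ℝ
    have h1 := hid.mul (ih fun x => p (b :: x))
    have h2 : (fun ε : ℝ => ε * (output ε (fun x => p ((!b) :: x)) z - p ((!b) :: z)))
        =O[𝓝[>] 0] fun ε : ℝ => ε ^ 2 := by
      refine IsBigO.of_bound (z.length * ∑ x ∈ words z.length, |p ((!b) :: x)|) ?_
      filter_upwards [Ioo_mem_nhdsGT (show (0 : ℝ) < 1 by norm_num)] with ε hε
      have := abs_output_sub_le hε.1.le hε.2.le (fun x => p ((!b) :: x)) z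
      rw [norm_mul, Real.norm_eq_abs, Real.norm_eq_abs, norm_pow, Real.norm_eq_abs,
        abs_of_pos hε.1]
      calc _ ≤ ε * (z.length * ε * ∑ x ∈ words z.length, |p ((!b) :: x)|) :=
            mul_le_mul_of_nonneg_left this hε.1.le
        _ = _ := by ring
    have h3 : (fun ε : ℝ => flipSum (fun x => p (b :: x)) z * ε ^ 2)
        =O[𝓝[>] 0] fun ε : ℝ => ε ^ 2 := (isBigO_refl _ _).const_mul_left _
    refine (((h1.congr_right fun _ => one_mul _).add h2).sub h3).congr_left fun ε => ?_
    rw [output_cons, flipSum_cons]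
    ring

/-! ### Conditional entropy -/

/-- The entropy of a binary choice with the unnormalized weights `a`, `b`, times the total
weight: `-a log (a / (a + b)) - b log (b / (a + b))`. -/
noncomputable def ent2 (a b : ℝ) : ℝ :=
  Real.negMulLog a + Real.negMulLog b - Real.negMulLog (a + b)

lemma ent2_mul (c a b : ℝ) : ent2 (c * a) (c * b) = c * ent2 a b := by
  rw [ent2, ent2, ← mul_add, Real.negMulLog_mul, Real.negMulLog_mul, Real.negMulLog_mul]
  ring

/-- The quadratic remainder in Gibbs' inequality comes from `log t ≤ t - 1` at
`t = √(y / x)`. -/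
lemma sq_sub_le_mul_log {x y : ℝ} (hx : 0 ≤ x) (hx1 : x ≤ 1) (hy : 0 ≤ y) (hy1 : y ≤ 1)
    (hxy : y = 0 → x = 0) :
    (x - y) ^ 2 / 4 ≤ x * Real.log x - x * Real.log y - x + y := by
  rcases hx.eq_or_lt with rfl | hx0
  · simp
    nlinarith
  have hy0 : 0 < y := hy.lt_of_ne fun h => hx0.ne' (hxy h.symm)
  set s := Real.sqrt x with hs
  set t := Real.sqrt y with ht
  have hs0 : 0 < s := Real.sqrt_pos.2 hx0
  have ht0 : 0 < t := Real.sqrt_pos.2 hy0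
  have hxs : x = s ^ 2 := (Real.sq_sqrt hx).symm
  have hyt : y = t ^ 2 := (Real.sq_sqrt hy).symm
  have hlog : Real.log (t / s) ≤ t / s - 1 := Real.log_le_sub_one_of_pos (by positivity)
  rw [Real.log_div ht0.ne' hs0.ne'] at hlog
  have hs1 : s ≤ 1 := Real.sqrt_le_one.2 hx1
  have ht1 : t ≤ 1 := Real.sqrt_le_one.2 hy1
  have h1 : s ^ 2 * (Real.log t - Real.log s) ≤ s * t - s ^ 2 := by
    calc _ ≤ s ^ 2 * (t / s - 1) := mul_le_mul_of_nonneg_left hlog (by positivity)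
      _ = _ := by field_simp
  have h2 : (s ^ 2 - t ^ 2) ^ 2 / 4 ≤ (s - t) ^ 2 := by
    have : (s ^ 2 - t ^ 2) ^ 2 = (s - t) ^ 2 * (s + t) ^ 2 := by ring
    have h3 : (s + t) ^ 2 ≤ 4 := by nlinarith
    rw [this]
    nlinarith [mul_le_mul_of_nonneg_left h3 (sq_nonneg (s - t))]
  rw [hxs, hyt, Real.log_pow, Real.log_pow]
  push_cast
  nlinarith

/-- Gibbs' inequality with a quadratic remainder. -/
lemma ent2_le {a b q r : ℝ} (ha : 0 ≤ a) (hb : 0 ≤ b) (hab : a + b ≤ 1) (hq : 0 ≤ q) (hr : 0 ≤ r)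
    (hqr : q + r = 1) (hqa : q = 0 → a = 0) (hrb : r = 0 → b = 0) :
    ent2 a b ≤ -a * Real.log q - b * Real.log r
      - ((a - (a + b) * q) ^ 2 + (b - (a + b) * r) ^ 2) / 4 := by
  rcases (add_nonneg ha hb).eq_or_lt with h0 | h0
  · have ha0 : a = 0 := by linarith
    have hb0 : b = 0 := by linarith
    simp [ha0, hb0, ent2]
  have hq1 : q ≤ 1 := by linarith
  have hr1 : r ≤ 1 := by linarith
  have i1 := sq_sub_le_mul_log ha (by linarith) (mul_nonneg h0.le hq)
    (by nlinarith) (fun h => hqa ((mul_eq_zero.1 h).resolve_left h0.ne'))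
  have i2 := sq_sub_le_mul_log hb (by linarith) (mul_nonneg h0.le hr)
    (by nlinarith) (fun h => hrb ((mul_eq_zero.1 h).resolve_left h0.ne'))
  have e1 : a * Real.log ((a + b) * q) = a * Real.log (a + b) + a * Real.log q := by
    rcases eq_or_ne q 0 with h | h
    · simp [hqa h]
    · rw [Real.log_mul h0.ne' h]; ring
  have e2 : b * Real.log ((a + b) * r) = b * Real.log (a + b) + b * Real.log r := by
    rcases eq_or_ne r 0 with h | h
    · simp [hrb h]
    · rw [Real.log_mul h0.ne' h]; ring
  have e3 : (a + b) * q + (a + b) * r = a + b := by rw [← mul_add, hqr, mul_one]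
  rw [e1] at i1
  rw [e2] at i2
  simp only [ent2, Real.negMulLog]
  linarith

lemma ent2_eq {a b : ℝ} (ha : 0 ≤ a) (hb : 0 ≤ b) :
    ent2 a b = -a * Real.log (a / (a + b)) - b * Real.log (b / (a + b)) := by
  have key : ∀ x : ℝ, 0 ≤ x → x ≤ a + b →
      x * Real.log (x / (a + b)) = x * Real.log x - x * Real.log (a + b) := by
    intro x hx hxs
    rcases hx.eq_or_lt with rfl | h
    · simp
    · rw [Real.log_div h.ne' (by linarith)]; ring
  have h1 := key a ha (by linarith)
  have h2 := key b hb (by linarith)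
  simp only [ent2, Real.negMulLog]
  linarith

lemma ent2_nonneg {a b : ℝ} (ha : 0 ≤ a) (hb : 0 ≤ b) : 0 ≤ ent2 a b := by
  have key : ∀ x : ℝ, 0 ≤ x → x ≤ a + b → x * Real.log (x / (a + b)) ≤ 0 := fun x hx hxs =>
    mul_nonpos_of_nonneg_of_nonpos hx (Real.log_nonpos (by positivity)
      (div_le_one_of_le₀ hxs (by positivity)))
  rw [ent2_eq ha hb]
  linarith [key a ha (by linarith), key b hb (by linarith)]

/-- Conditioning reduces entropy. -/
lemma sum_ent2_le {ι : Type*} (s : Finset ι) {a b : ι → ℝ} (ha : ∀ i ∈ s, 0 ≤ a i)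
    (hb : ∀ i ∈ s, 0 ≤ b i) (hab : ∑ i ∈ s, a i + ∑ i ∈ s, b i ≤ 1) :
    ∑ i ∈ s, ent2 (a i) (b i) ≤ ent2 (∑ i ∈ s, a i) (∑ i ∈ s, b i) := by
  set A := ∑ i ∈ s, a i with hA
  set B := ∑ i ∈ s, b i with hB
  have hA0 : 0 ≤ A := Finset.sum_nonneg ha
  have hB0 : 0 ≤ B := Finset.sum_nonneg hb
  have hle1 : ∀ i ∈ s, a i ≤ A := fun i hi => Finset.single_le_sum ha hi
  have hle2 : ∀ i ∈ s, b i ≤ B := fun i hi => Finset.single_le_sum hb hi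
  rcases (add_nonneg hA0 hB0).eq_or_lt with h0 | h0
  · have hA1 : A = 0 := by linarith
    have hB1 : B = 0 := by linarith
    rw [hA1, hB1, Finset.sum_eq_zero]
    · simp [ent2]
    · intro i hi
      have h1 : a i = 0 := le_antisymm (hA1 ▸ hle1 i hi) (ha i hi)
      have h2 : b i = 0 := le_antisymm (hB1 ▸ hle2 i hi) (hb i hi)
      simp [ent2, h1, h2]
  rw [ent2_eq hA0 hB0]
  have step : ∀ i ∈ s, ent2 (a i) (b i) ≤
      -a i * Real.log (A / (A + B)) - b i * Real.log (B / (A + B)) := by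
    intro i hi
    refine (ent2_le (ha i hi) (hb i hi) (by linarith [hle1 i hi, hle2 i hi])
      (q := A / (A + B)) (r := B / (A + B)) (by positivity) (by positivity)
      (by rw [← add_div, div_self h0.ne']) ?_ ?_).trans ?_
    · intro h
      rcases div_eq_zero_iff.1 h with h | h
      · exact le_antisymm (h ▸ hle1 i hi) (ha i hi)
      · exact absurd h h0.ne'
    · intro h
      rcases div_eq_zero_iff.1 h with h | h
      · exact le_antisymm (h ▸ hle2 i hi) (hb i hi)
      · exact absurd h h0.ne'
    · linarith [sq_nonneg (a i - (a i + b i) * (A / (A + B))),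
        sq_nonneg (b i - (a i + b i) * (B / (A + B)))]
  refine (Finset.sum_le_sum step).trans_eq ?_
  rw [Finset.sum_sub_distrib, ← Finset.sum_mul, ← Finset.sum_mul, Finset.sum_neg_distrib]

lemma IsStationaryOfLength.condEntropy_eq_ent2 {N n : ℕ} {p : List Bool → ℝ}
    (hp : IsStationaryOfLength N p) (hn : n < N) :
    condEntropy p n = ∑ w ∈ words n, ent2 (p (w ++ [false])) (p (w ++ [true])) := by
  rw [condEntropy_eq, ← Finset.sum_neg_distrib]
  refine Finset.sum_congr rfl fun w hw => ?_
  have hl := mem_words.1 hw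
  rw [ent2_eq (hp.nonneg _ (by simp; omega)) (hp.nonneg _ (by simp; omega)),
    hp.append w (by omega), Fintype.sum_bool]
  ring

lemma IsStationaryOfLength.condEntropy_eq_sub {N n : ℕ} {p : List Bool → ℝ}
    (hp : IsStationaryOfLength N p) (hn : n < N) :
    condEntropy p n = ∑ u ∈ words (n + 1), Real.negMulLog (p u)
      - ∑ w ∈ words n, Real.negMulLog (p w) := by
  rw [hp.condEntropy_eq_ent2 hn, sum_words_snoc, ← Finset.sum_sub_distrib]
  refine Finset.sum_congr rfl fun w hw => ?_
  rw [ent2, hp.append w (by rw [mem_words.1 hw]; exact hn), Fintype.sum_bool,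
    add_comm (Real.negMulLog (p (w ++ [true])))]

lemma IsStationary.condEntropy_nonneg {p : List Bool → ℝ} (hp : IsStationary p) (n : ℕ) :
    0 ≤ condEntropy p n := by
  rw [(hp (n + 1)).condEntropy_eq_ent2 (Nat.lt_succ_self n)]
  exact Finset.sum_nonneg fun w _ => ent2_nonneg (hp.nonneg _) (hp.nonneg _)

lemma IsStationary.condEntropy_antitone {p : List Bool → ℝ} (hp : IsStationary p) :
    Antitone (condEntropy p) := by
  refine antitone_nat_of_succ_le fun n => ?_
  rw [(hp (n + 1)).condEntropy_eq_ent2 (Nat.lt_succ_self n),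
    (hp (n + 2)).condEntropy_eq_ent2 (Nat.lt_succ_self _), sum_words_cons, Finset.sum_comm]
  refine Finset.sum_le_sum fun w _ => ?_
  have key := sum_ent2_le Finset.univ (a := fun b : Bool => p (b :: w ++ [false]))
    (b := fun b : Bool => p (b :: w ++ [true])) (fun _ _ => hp.nonneg _) (fun _ _ => hp.nonneg _)
  simp only [List.cons_append, hp.sum_cons] at key
  refine key ?_
  rw [(hp (w.length + 1)).append w (Nat.lt_succ_self _)]
  exact (hp w.length).le_one le_rfl

lemma IsStationary.blockEntropy_eq_sum {p : List Bool → ℝ} (hp : IsStationary p) (n : ℕ) :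
    blockEntropy p n = ∑ k ∈ Finset.range n, condEntropy p k := by
  induction n with
  | zero => simp [blockEntropy_eq, (hp 0).nil]
  | succ n ih =>
    rw [Finset.sum_range_succ, ← ih, (hp (n + 1)).condEntropy_eq_sub (Nat.lt_succ_self n),
      blockEntropy_eq, blockEntropy_eq]
    ring

/-- The entropy rate of a stationary process is the limit of the conditional entropies. -/
lemma IsStationary.tendsto_condEntropy {p : List Bool → ℝ} (hp : IsStationary p) :
    Tendsto (condEntropy p) atTop (𝓝 (entropyRate p)) := by
  have h1 := tendsto_atTop_ciInf hp.condEntropy_antitone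
    ⟨0, by rintro _ ⟨n, rfl⟩; exact hp.condEntropy_nonneg n⟩
  have h2 := (h1.cesaro.comp (tendsto_add_atTop_nat 1))
  have h3 : entropyRate p = ⨅ n, condEntropy p n := by
    refine Tendsto.limUnder_eq (h2.congr fun n => ?_)
    simp only [Function.comp]
    rw [hp.blockEntropy_eq_sum, div_eq_inv_mul]
    push_cast
    rfl
  rw [h3]
  exact h1

lemma IsStationary.entropyRate_le_condEntropy {p : List Bool → ℝ} (hp : IsStationary p) (n : ℕ) :
    entropyRate p ≤ condEntropy p n :=
  hp.condEntropy_antitone.le_of_tendsto hp.tendsto_condEntropy n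

lemma IsStationary.le_entropyRate {p : List Bool → ℝ} (hp : IsStationary p) {c : ℝ} {N : ℕ}
    (h : ∀ n, N ≤ n → c ≤ condEntropy p n) : c ≤ entropyRate p :=
  ge_of_tendsto hp.tendsto_condEntropy (eventually_atTop.2 ⟨N, h⟩)

/-! ### Irreducible finite type constraints -/

/-- What is used of an irreducible finite type constraint `S` of topological order at most `m`:
it is closed under subwords, words can be extended on both sides and joined, and words that overlap
in at least `m` letters can be glued. -/
structure IsLanguage (S : Set (List Bool)) (m : ℕ) : Prop where
  nil_mem : [] ∈ S
  infix_mem : ∀ {u w : List Bool}, w ∈ S → u <:+: w → u ∈ S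
  exists_snoc : ∀ {w : List Bool}, w ∈ S → ∃ b, w ++ [b] ∈ S
  exists_cons : ∀ {w : List Bool}, w ∈ S → ∃ a, a :: w ∈ S
  glue_cons : ∀ {a b : Bool} {w : List Bool}, m ≤ w.length → a :: w ∈ S → w ++ [b] ∈ S →
    a :: w ++ [b] ∈ S
  irreducible : IsIrreducible S

lemma topOrder_spec {S : Set (List Bool)} (hfin : IsFiniteType S) :
    ∃ F : Set (List Bool), (∀ u ∈ F, u.length = topOrder S + 1) ∧
      ∀ w : List Bool, topOrder S + 1 ≤ w.length → (w ∈ S ↔ ∀ u ∈ F, ¬ u <:+: w) := by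
  refine Nat.sInf_mem (s := {m : ℕ | ∃ F : Set (List Bool), (∀ u ∈ F, u.length = m + 1) ∧
    ∀ w : List Bool, m + 1 ≤ w.length → (w ∈ S ↔ ∀ u ∈ F, ¬ u <:+: w)}) ?_
  obtain ⟨F, hF, rfl⟩ := hfin
  obtain ⟨M, hM⟩ := (hF.image List.length).bddAbove
  refine ⟨M, {w | w.length = M + 1 ∧ ∃ u ∈ F, u <:+: w}, fun u hu => hu.1, fun w hw => ?_⟩
  constructor
  · rintro h u ⟨_, x, hx, hxu⟩ huw
    exact h x hx (hxu.trans huw)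
  · rintro h u hu ⟨s, t, hst⟩
    have hul : u.length ≤ M := hM ⟨u, hu, rfl⟩
    have hlen : s.length + u.length + t.length = w.length := by
      rw [← hst]; simp [add_assoc]
    -- a window of `M + 1` letters of `w` that contains this occurrence of `u`
    rcases le_total (M + 1) (u.length + t.length) with h1 | h1
    · refine h ((u ++ t).take (M + 1)) ⟨by simp [h1], u, hu, ?_⟩ ?_
      · rw [List.take_append, List.take_of_length_le (by omega)]
        exact (List.prefix_append _ _).isInfix
      · refine (List.take_prefix _ _).isInfix.trans ?_
        rw [← hst, List.append_assoc]
        exact (List.suffix_append _ _).isInfix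
    · refine h (w.drop (w.length - (M + 1))) ⟨by simp; omega, u, hu, ?_⟩
        (List.drop_suffix _ _).isInfix
      rw [← hst, List.append_assoc, List.drop_append_of_le_length (by simp; omega)]
      exact ⟨s.drop ((s ++ (u ++ t)).length - (M + 1)), t, by simp⟩

lemma isLanguage {S : Set (List Bool)} (hfin : IsFiniteType S) (hirr : IsIrreducible S)
    (hne : ∃ w ∈ S, w ≠ []) : IsLanguage S (topOrder S) := by
  have hinf : ∀ {u w : List Bool}, w ∈ S → u <:+: w → u ∈ S := by
    obtain ⟨F, -, rfl⟩ := hfin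
    exact fun hw huw x hx hxu => hw x hx (hxu.trans huw)
  obtain ⟨x, hx, hx0⟩ := hne
  refine ⟨hinf hx List.nil_infix, hinf, ?_, ?_, ?_, hirr⟩
  · intro u hu
    obtain ⟨w, -, hw⟩ := hirr u hu x hx
    rw [List.append_assoc] at hw
    obtain ⟨b, y, hby⟩ := List.exists_cons_of_ne_nil (l := w ++ x) (by simp [hx0])
    exact ⟨b, hinf hw ⟨[], y, by simp [hby]⟩⟩
  · intro u hu
    obtain ⟨w, -, hw⟩ := hirr x hx u hu
    obtain ⟨y, b, hby⟩ : ∃ y b, x ++ w = y ++ [b] :=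
      ⟨_, _, (List.dropLast_append_getLast (l := x ++ w) (by simp [hx0])).symm⟩
    exact ⟨b, hinf hw ⟨y, [], by simp [hby]⟩⟩
  · intro a b w hm h1 h2
    obtain ⟨F, hF, hS⟩ := topOrder_spec hfin
    rw [hS _ (by simp; omega)] at h1 h2 ⊢
    intro u hu hinfix
    rw [List.cons_append, List.infix_cons_iff] at hinfix
    rcases hinfix with h | h
    · refine h1 u hu (List.IsPrefix.isInfix ?_)
      exact List.prefix_of_prefix_length_le h (List.prefix_append (a :: w) [b])
        (by rw [hF u hu]; simp; omega)
    · exact h2 u hu h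

namespace IsLanguage

variable {S : Set (List Bool)} {m : ℕ}

lemma of_append_left (hS : IsLanguage S m) {u v : List Bool} (h : u ++ v ∈ S) : u ∈ S :=
  hS.infix_mem h (List.prefix_append _ _).isInfix

lemma of_append_right (hS : IsLanguage S m) {u v : List Bool} (h : u ++ v ∈ S) : v ∈ S :=
  hS.infix_mem h (List.suffix_append _ _).isInfix

lemma glue (hS : IsLanguage S m) {u w v : List Bool} (hm : m ≤ w.length) (h1 : u ++ w ∈ S)
    (h2 : w ++ v ∈ S) : u ++ w ++ v ∈ S := by
  induction v using List.reverseRecOn with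
  | nil => simpa using h1
  | append_singleton v b ih =>
    rw [← List.append_assoc] at h2
    have h3 := ih (hS.of_append_left h2)
    clear ih
    induction u with
    | nil => simpa using h2
    | cons a u ihu =>
      have h4 := ihu (hS.infix_mem h1 ⟨[a], [], by simp⟩) (hS.infix_mem h3 ⟨[a], [], by simp⟩)
      have := hS.glue_cons (a := a) (b := b) (w := u ++ w ++ v) (by simp; omega)
        (by simpa using h3) (by simpa using h4)
      simpa using this

lemma exists_append (hS : IsLanguage S m) {w : List Bool} (hw : w ∈ S) (k : ℕ) :
    ∃ v : List Bool, v.length = k ∧ w ++ v ∈ S := by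
  induction k with
  | zero => exact ⟨[], rfl, by simpa⟩
  | succ k ih =>
    obtain ⟨v, hv, hwv⟩ := ih
    obtain ⟨b, hb⟩ := hS.exists_snoc hwv
    exact ⟨v ++ [b], by simp [hv], by simpa using hb⟩

end IsLanguage

/-! ### A positive eigenvector of an irreducible matrix -/

/-- The Perron–Frobenius theorem, by the argument of Collatz and Wielandt: the largest `t` such that
`A x ≥ t x` for some probability vector `x` is an eigenvalue with a positive eigenvector. -/
lemma exists_pos_eigenvector {ι : Type*} [Fintype ι] [DecidableEq ι] [Nonempty ι]
    (A : Matrix ι ι ℝ) (h0 : ∀ i j, 0 ≤ A i j)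
    (hconn : ∀ i j, Relation.ReflTransGen (fun i j => 0 < A i j) i j)
    (hrow : ∀ i, ∃ j, 0 < A i j) :
    ∃ t : ℝ, 0 < t ∧ ∃ x : ι → ℝ, (∀ i, 0 < x i) ∧ ∀ i, ∑ j, A i j * x j = t * x i := by
  -- some power of `1 + A` has positive entries
  set B : Matrix ι ι ℝ := 1 + A with hB
  have hPsucc : ∀ (k : ℕ) (i j : ι), (B ^ (k + 1)) i j =
      (B ^ k) i j + ∑ l, (B ^ k) i l * A l j := by
    intro k i j
    rw [pow_succ, hB, mul_add, mul_one, Matrix.add_apply, Matrix.mul_apply]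
  have hPnn : ∀ (k : ℕ) (i j : ι), 0 ≤ (B ^ k) i j := by
    intro k
    induction k with
    | zero => intro i j; rw [pow_zero, Matrix.one_apply]; split_ifs <;> norm_num
    | succ k ih =>
      intro i j
      rw [hPsucc]
      exact add_nonneg (ih i j) (Finset.sum_nonneg fun l _ => mul_nonneg (ih i l) (h0 l j))
  have hPmono : ∀ i j, Monotone fun k => (B ^ k) i j := by
    intro i j
    refine monotone_nat_of_le_succ fun k => ?_
    rw [hPsucc]
    exact le_add_of_nonneg_right (Finset.sum_nonneg fun l _ => mul_nonneg (hPnn k i l) (h0 l j))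
  have hPex : ∀ i j, ∃ k, 0 < (B ^ k) i j := by
    intro i j
    induction hconn i j with
    | refl => exact ⟨0, by simp⟩
    | @tail b c _ hbc ih =>
      obtain ⟨k, hk⟩ := ih
      refine ⟨k + 1, ?_⟩
      rw [hPsucc]
      refine add_pos_of_nonneg_of_pos (hPnn k i c) ?_
      exact Finset.sum_pos' (fun l _ => mul_nonneg (hPnn k i l) (h0 l c))
        ⟨b, Finset.mem_univ _, mul_pos hk hbc⟩
  choose κ hκ using hPex
  obtain ⟨k, hk⟩ : ∃ k, ∀ i j, 0 < (B ^ k) i j := by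
    refine ⟨∑ i, ∑ j, κ i j, fun i j => (hκ i j).trans_le (hPmono i j ?_)⟩
    exact (Finset.single_le_sum (f := fun j => κ i j) (fun _ _ => Nat.zero_le _)
      (Finset.mem_univ j)).trans (Finset.single_le_sum (f := fun i => ∑ j, κ i j)
        (fun _ _ => Nat.zero_le _) (Finset.mem_univ i))
  set P := B ^ k with hP
  have hcomm : A * P = P * A := ((Commute.one_left A).add_left (Commute.refl A)).symm.pow_right k
  have hPpos : ∀ x : ι → ℝ, (∀ i, 0 ≤ x i) → (∃ i, 0 < x i) → ∀ i, 0 < (P.mulVec x) i := by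
    rintro x hx ⟨j, hj⟩ i
    exact Finset.sum_pos' (fun l _ => mul_nonneg (hk i l).le (hx l))
      ⟨j, Finset.mem_univ _, mul_pos (hk i j) hj⟩
  -- the compact set of pairs `(x, t)` with `A x ≥ t x`
  set M := ∑ i, ∑ j, A i j
  have hbound : ∀ x ∈ stdSimplex ℝ ι, ∀ t : ℝ, (∀ i, t * x i ≤ (A.mulVec x) i) → t ≤ M := by
    intro x hx t ht
    calc t = ∑ i, t * x i := by rw [← Finset.mul_sum, hx.2, mul_one]
      _ ≤ ∑ i, (A.mulVec x) i := Finset.sum_le_sum fun i _ => ht i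
      _ ≤ M := Finset.sum_le_sum fun i _ => Finset.sum_le_sum fun j _ => by
          have : x j ≤ 1 := by
            rw [← hx.2]
            exact Finset.single_le_sum (fun l _ => hx.1 l) (Finset.mem_univ j)
          exact mul_le_of_le_one_right (h0 i j) this
  have hcont : ∀ i, Continuous fun x : ι → ℝ => (A.mulVec x) i := fun i => by
    simp only [Matrix.mulVec, dotProduct]
    fun_prop
  have hK : IsCompact ((stdSimplex ℝ ι ×ˢ Set.Icc (0 : ℝ) M) ∩
      {q | ∀ i, q.2 * q.1 i ≤ (A.mulVec q.1) i}) := by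
    refine ((isCompact_stdSimplex ℝ ι).prod isCompact_Icc).inter_right ?_
    rw [Set.ofPred_forall]
    refine isClosed_iInter fun i => isClosed_le ?_ ((hcont i).comp continuous_fst)
    exact continuous_snd.mul ((continuous_apply i).comp continuous_fst)
  have hM0 : 0 ≤ M := Finset.sum_nonneg fun i _ => Finset.sum_nonneg fun j _ => h0 i j
  obtain ⟨i₀⟩ := ‹Nonempty ι›
  have hKne : ((stdSimplex ℝ ι ×ˢ Set.Icc (0 : ℝ) M) ∩
      {q | ∀ i, q.2 * q.1 i ≤ (A.mulVec q.1) i}).Nonempty := by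
    refine ⟨(Pi.single i₀ 1, 0), ⟨single_mem_stdSimplex ℝ i₀, le_rfl, hM0⟩, fun i => ?_⟩
    simp [h0]
  obtain ⟨⟨x, t⟩, ⟨⟨hx, ht⟩, hxt⟩, hmax⟩ := hK.exists_isMaxOn hKne continuous_snd.continuousOn
  replace hxt : ∀ i, t * x i ≤ (A.mulVec x) i := hxt
  have hx0 : ∃ i, 0 < x i := by
    by_contra! h
    have : ∑ i, x i ≤ 0 := Finset.sum_nonpos fun i _ => h i
    rw [hx.2] at this
    norm_num at this
  have heq : A.mulVec x = t • x := by
    by_contra hne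
    set z := A.mulVec x - t • x with hz
    have hz0 : ∀ i, 0 ≤ z i := fun i => by
      have := hxt i
      simp only [hz, Pi.sub_apply, Pi.smul_apply, smul_eq_mul]
      linarith
    have hz1 : ∃ i, 0 < z i := by
      by_contra! h
      exact hne (sub_eq_zero.1 (funext fun i => le_antisymm (h i) (hz0 i)))
    have hPz := hPpos z hz0 hz1
    set y := P.mulVec x with hy
    have hypos := hPpos x hx.1 hx0
    have hAy : A.mulVec y = t • y + P.mulVec z := by
      rw [hy, hz, Matrix.mulVec_mulVec, hcomm, ← Matrix.mulVec_mulVec, Matrix.mulVec_sub,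
        Matrix.mulVec_smul]
      abel
    set σ := ∑ i, y i
    have hσ : 0 < σ := Finset.sum_pos (fun i _ => hypos i) ⟨i₀, Finset.mem_univ _⟩
    obtain ⟨j, -, hj⟩ := Finset.exists_min_image Finset.univ (P.mulVec z) ⟨i₀, Finset.mem_univ _⟩
    have hmem : σ⁻¹ • y ∈ stdSimplex ℝ ι := by
      refine ⟨fun i => mul_nonneg (by positivity) (hypos i).le, ?_⟩
      simp only [Pi.smul_apply, smul_eq_mul]
      rw [← Finset.mul_sum, inv_mul_cancel₀ hσ.ne']
    have hle : ∀ i, (t + (P.mulVec z) j / σ) * (σ⁻¹ • y) i ≤ (A.mulVec (σ⁻¹ • y)) i := by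
      intro i
      rw [Matrix.mulVec_smul, hAy]
      simp only [Pi.smul_apply, Pi.add_apply, smul_eq_mul]
      have h1 : y i ≤ σ := Finset.single_le_sum (fun l _ => (hypos l).le) (Finset.mem_univ i)
      have h2 : (P.mulVec z) j / σ * y i ≤ (P.mulVec z) i := by
        calc (P.mulVec z) j / σ * y i ≤ (P.mulVec z) j / σ * σ :=
              mul_le_mul_of_nonneg_left h1 (div_nonneg (hPz j).le hσ.le)
          _ = (P.mulVec z) j := by field_simp
          _ ≤ _ := hj i (Finset.mem_univ i)
      calc _ = σ⁻¹ * (t * y i + (P.mulVec z) j / σ * y i) := by ring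
        _ ≤ _ := mul_le_mul_of_nonneg_left (by linarith) (by positivity)
    have hlt : 0 < (P.mulVec z) j / σ := div_pos (hPz j) hσ
    have hm : t + (P.mulVec z) j / σ ≤ t :=
      hmax (a := (σ⁻¹ • y, t + (P.mulVec z) j / σ))
        ⟨⟨hmem, by have := ht.1; simp only at this ⊢; linarith, hbound _ hmem _ hle⟩, hle⟩
    linarith
  have hAx : ∀ i, ∑ j, A i j * x j = t * x i := fun i => congrFun heq i
  have hPx : ∀ k : ℕ, (B ^ k).mulVec x = (1 + t) ^ k • x := by
    intro k
    induction k with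
    | zero => simp
    | succ k ih =>
      rw [pow_succ, ← Matrix.mulVec_mulVec, show B.mulVec x = x + t • x by
          rw [hB, Matrix.add_mulVec, Matrix.one_mulVec, heq],
        show x + t • x = (1 + t) • x by rw [add_smul, one_smul], Matrix.mulVec_smul, ih, smul_smul,
        pow_succ, mul_comm]
  have ht0 : 0 ≤ t := ht.1
  have hxpos : ∀ i, 0 < x i := by
    intro i
    have h1 := hPpos x hx.1 hx0 i
    rw [hP, hPx] at h1
    simp only [Pi.smul_apply, smul_eq_mul] at h1
    exact pos_of_mul_pos_right h1 (by positivity)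
  refine ⟨t, ?_, x, hxpos, hAx⟩
  obtain ⟨j, hj⟩ := hrow i₀
  have h1 : 0 < ∑ j, A i₀ j * x j := Finset.sum_pos'
    (fun l _ => mul_nonneg (h0 _ _) (hxpos l).le) ⟨j, Finset.mem_univ _, mul_pos hj (hxpos j)⟩
  rw [hAx] at h1
  exact pos_of_mul_pos_left h1 (hxpos i₀).le

/-! ### The chain of maximal entropy -/

/-- The last `m` letters of a word. -/
def lastWord (m : ℕ) (w : List Bool) : List Bool := w.drop (w.length - m)

lemma length_lastWord {m : ℕ} {w : List Bool} (h : m ≤ w.length) :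
    (lastWord m w).length = m := by
  simp [lastWord]; omega

lemma lastWord_append {m : ℕ} (u : List Bool) {w : List Bool} (h : m ≤ w.length) :
    lastWord m (u ++ w) = lastWord m w := by
  rw [lastWord, lastWord, List.drop_append, List.drop_of_length_le (by simp; omega)]
  simp only [List.length_append, List.nil_append]
  congr 1
  omega

lemma lastWord_cons {m : ℕ} (a : Bool) {w : List Bool} (h : m ≤ w.length) :
    lastWord m (a :: w) = lastWord m w := lastWord_append [a] h

lemma lastWord_self {m : ℕ} {w : List Bool} (h : w.length = m) : lastWord m w = w := by
  simp [lastWord, h]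

lemma lastWord_suffix (m : ℕ) (w : List Bool) : lastWord m w <:+ w := List.drop_suffix _ _

lemma eq_append_lastWord (m : ℕ) (w : List Bool) :
    w = w.take (w.length - m) ++ lastWord m w := (List.take_append_drop _ _).symm

lemma lastWord_snoc {m : ℕ} (b : Bool) {w : List Bool} (h : m ≤ w.length) :
    lastWord m (w ++ [b]) = (lastWord m w ++ [b]).tail := by
  conv_lhs => rw [eq_append_lastWord m w]
  have hl := length_lastWord h
  generalize lastWord m w = x at hl
  rw [List.append_assoc]
  rw [lastWord_append _ (by simp; omega)]
  cases x with
  | nil => simp at hl; subst hl; simp [lastWord]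
  | cons a x => simp at hl; simp [lastWord_cons a (w := x ++ [b]) (m := m) (by simp; omega),
      lastWord_self (m := m) (w := x ++ [b]) (by simp; omega)]

namespace IsLanguage

variable {S : Set (List Bool)} {m : ℕ}

lemma append_mem_iff_lastWord (hS : IsLanguage S m) {w v : List Bool} (hm : m ≤ w.length) :
    w ++ v ∈ S ↔ w ∈ S ∧ lastWord m w ++ v ∈ S := by
  constructor
  · intro h
    refine ⟨hS.of_append_left h, hS.of_append_right (u := w.take (w.length - m)) ?_⟩
    rwa [← List.append_assoc, ← eq_append_lastWord]
  · rintro ⟨h1, h2⟩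
    have := hS.glue (u := w.take (w.length - m)) (w := lastWord m w) (v := v)
      (length_lastWord hm).ge (by rwa [← eq_append_lastWord]) h2
    rwa [← eq_append_lastWord] at this

lemma cons_mem_iff_take (hS : IsLanguage S m) {a : Bool} {w : List Bool} (hm : m ≤ w.length) :
    a :: w ∈ S ↔ w ∈ S ∧ a :: w.take m ∈ S := by
  constructor
  · intro h
    refine ⟨hS.infix_mem h ⟨[a], [], by simp⟩, hS.of_append_left (v := w.drop m) ?_⟩
    simpa using h
  · rintro ⟨h1, h2⟩
    have := hS.glue (u := [a]) (w := w.take m) (v := w.drop m) (by simp; omega)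
      (by simpa using h2) (by simpa using h1)
    simpa using this

open Classical in
/-- Left and right eigenvectors of the transition matrix between the words of length `m` in `S`. -/
lemma exists_eigenvectors (hS : IsLanguage S m) : ∃ t : ℝ, 0 < t ∧ ∃ l r : List Bool → ℝ,
    (∀ w ∈ S, w.length = m → 0 < l w ∧ 0 < r w) ∧
    (∀ w ∈ S, w.length = m →
      ∑ b : Bool, (if w ++ [b] ∈ S then r (w ++ [b]).tail else 0) = t * r w) ∧
    (∀ w ∈ S, w.length = m →
      ∑ a : Bool, (if a :: w ∈ S then l (a :: w).dropLast else 0) = t * l w) ∧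
    ∑ w ∈ words m, (if w ∈ S then l w * r w else 0) = 1 := by
  let ι := {w : List Bool // w ∈ (words m).filter (· ∈ S)}
  have hι : ∀ i : ι, i.1.length = m ∧ i.1 ∈ S := fun i => by
    have := Finset.mem_filter.1 i.2
    simpa using this
  let mk : (w : List Bool) → w.length = m → w ∈ S → ι := fun w h1 h2 => ⟨w, by simp [h1, h2]⟩
  have hne : Nonempty ι := by
    obtain ⟨v, hv, hvS⟩ := hS.exists_append hS.nil_mem m
    exact ⟨mk v hv (by simpa using hvS)⟩
  let A : Matrix ι ι ℝ := fun i j =>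
    ∑ y ∈ words (m + 1), if y ∈ S ∧ y.dropLast = i.1 ∧ y.tail = j.1 then 1 else 0
  have hA0 : ∀ i j, 0 ≤ A i j := fun i j =>
    Finset.sum_nonneg fun y _ => by split_ifs <;> norm_num
  have hApos : ∀ i j : ι, ∀ y ∈ S, y.length = m + 1 → y.dropLast = i.1 → y.tail = j.1 →
      0 < A i j := by
    intro i j y hy hl h1 h2
    refine Finset.sum_pos' (fun y _ => by split_ifs <;> norm_num) ⟨y, mem_words.2 hl, ?_⟩
    rw [if_pos ⟨hy, h1, h2⟩]
    norm_num
  -- a word of `S` is a path from its first to its last window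
  have hpath : ∀ (y : List Bool) (u : ι), u.1 ++ y ∈ S → ∀ v : ι, lastWord m (u.1 ++ y) = v.1 →
      Relation.ReflTransGen (fun i j => 0 < A i j) u v := by
    intro y
    induction y with
    | nil =>
      intro u _ v hv
      rw [List.append_nil, lastWord_self (hι u).1] at hv
      rw [Subtype.ext hv]
    | cons b y ih =>
      intro u hu v hv
      have hub : u.1 ++ [b] ∈ S := hS.of_append_left (v := y) (by simpa using hu)
      have hlen : (u.1 ++ [b]).tail.length = m := by simp [(hι u).1]
      have htail : ∃ c, u.1 ++ [b] = c :: (u.1 ++ [b]).tail := by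
        cases h : u.1 with
        | nil => exact ⟨b, by simp⟩
        | cons c x => exact ⟨c, by simp⟩
      obtain ⟨c, hc⟩ := htail
      have hrw : u.1 ++ b :: y = c :: ((u.1 ++ [b]).tail ++ y) := by
        rw [← List.cons_append, ← hc]; simp
      let u' : ι := mk (u.1 ++ [b]).tail hlen (hS.infix_mem hub (List.tail_suffix _).isInfix)
      refine Relation.ReflTransGen.head (b := u')
        (hApos u u' (u.1 ++ [b]) hub (by simp [(hι u).1]) (by simp) rfl) (ih u' ?_ v ?_)
      · exact hS.infix_mem hu ⟨[c], [], by simp [hrw, u', mk]⟩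
      · rw [← hv, hrw, lastWord_cons _ (by simp only [List.length_append, hlen]; omega)]
  have hconn : ∀ i j, Relation.ReflTransGen (fun i j => 0 < A i j) i j := by
    intro i j
    obtain ⟨w, -, hw⟩ := hS.irreducible i.1 (hι i).2 j.1 (hι j).2
    rw [List.append_assoc] at hw
    refine hpath (w ++ j.1) i hw j ?_
    rw [← List.append_assoc, lastWord_append _ (hι j).1.ge, lastWord_self (hι j).1]
  have hrow : ∀ i, ∃ j, 0 < A i j := by
    intro i
    obtain ⟨b, hb⟩ := hS.exists_snoc (hι i).2
    exact ⟨mk (i.1 ++ [b]).tail (by simp [(hι i).1])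
      (hS.infix_mem hb (List.tail_suffix _).isInfix),
      hApos _ _ (i.1 ++ [b]) hb (by simp [(hι i).1]) (by simp) rfl⟩
  have hcol : ∀ j, ∃ i, 0 < A i j := by
    intro j
    obtain ⟨a, ha⟩ := hS.exists_cons (hι j).2
    exact ⟨mk (a :: j.1).dropLast (by simp [(hι j).1])
      (hS.infix_mem ha (List.dropLast_prefix _).isInfix),
      hApos _ _ (a :: j.1) ha (by simp [(hι j).1]) rfl rfl⟩
  obtain ⟨t, ht, r, hr, hAr⟩ := exists_pos_eigenvector A hA0 hconn hrow
  obtain ⟨t', ht', l, hl, hAl⟩ := exists_pos_eigenvector A.transpose (fun i j => hA0 j i)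
    (fun i j => Relation.reflTransGen_swap.2 (hconn j i)) hcol
  simp only [Matrix.transpose_apply] at hAl
  -- the two eigenvalues agree
  have hσ : 0 < ∑ i, l i * r i :=
    Finset.sum_pos (fun i _ => mul_pos (hl i) (hr i)) Finset.univ_nonempty
  have htt : t' = t := by
    have h1 : ∑ i, l i * ∑ j, A i j * r j = t * ∑ i, l i * r i := by
      rw [Finset.mul_sum]
      exact Finset.sum_congr rfl fun i _ => by rw [hAr]; ring
    have h2 : ∑ i, l i * ∑ j, A i j * r j = t' * ∑ i, l i * r i := by
      simp only [Finset.mul_sum]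
      rw [Finset.sum_comm]
      refine Finset.sum_congr rfl fun j _ => ?_
      calc ∑ i, l i * (A i j * r j) = (∑ i, A i j * l i) * r j := by
            rw [Finset.sum_mul]
            exact Finset.sum_congr rfl fun i _ => by ring
        _ = _ := by rw [hAl]; ring
    exact mul_right_cancel₀ hσ.ne' (h2.symm.trans h1)
  subst htt
  set σ := ∑ i, l i * r i
  let R : List Bool → ℝ := fun w => if h : w.length = m ∧ w ∈ S then r (mk w h.1 h.2) else 0
  let L : List Bool → ℝ := fun w => if h : w.length = m ∧ w ∈ S then σ⁻¹ * l (mk w h.1 h.2) else 0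
  have hR : ∀ i : ι, R i.1 = r i := fun i => by
    simp only [R, dif_pos (hι i)]
    rfl
  have hL : ∀ i : ι, L i.1 = σ⁻¹ * l i := fun i => by
    simp only [L, dif_pos (hι i)]
    rfl
  have hAsum : ∀ (g : List Bool → ℝ) (y : List Bool) (c : Prop) [Decidable c] (f : List Bool → List Bool)
      (_ : y.length = m + 1) (_ : c → y ∈ S) (_ : (f y).length = m) (_ : f y <:+: y),
      ∑ j : ι, (if c ∧ f y = j.1 then 1 else 0) * g j.1 = if c then g (f y) else 0 := by
    intro g y c _ f hy hcS hf hfy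
    by_cases hc : c
    · rw [Finset.sum_eq_single (mk (f y) hf (hS.infix_mem (hcS hc) hfy))]
      · simp [hc, mk]
      · intro j _ hj
        rw [if_neg, zero_mul]
        rintro ⟨-, h⟩
        exact hj (Subtype.ext h.symm)
      · simp
    · simp [hc]
  refine ⟨t', ht, L, R, ?_, ?_, ?_, ?_⟩
  · intro w hw hwm
    have h1 := hL (mk w hwm hw)
    have h2 := hR (mk w hwm hw)
    simp only [mk] at h1 h2
    rw [h1, h2]
    exact ⟨mul_pos (inv_pos.2 hσ) (hl _), hr _⟩
  · intro w hw hwm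
    have h1 := hAr (mk w hwm hw)
    rw [← hR] at h1
    rw [← h1]
    simp only [← hR, A, Finset.sum_mul]
    rw [Finset.sum_comm]
    have h2 : ∀ y ∈ words (m + 1), ∑ j : ι,
        (if y ∈ S ∧ y.dropLast = (mk w hwm hw).1 ∧ y.tail = j.1 then 1 else 0) * R j.1
        = if y ∈ S ∧ y.dropLast = w then R y.tail else 0 := by
      intro y hy
      rw [← hAsum R y (y ∈ S ∧ y.dropLast = w) List.tail (mem_words.1 hy) (fun h => h.1)
        (by simp [mem_words.1 hy]) (List.tail_suffix _).isInfix]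
      simp only [and_assoc, mk]
    rw [Finset.sum_congr rfl h2, sum_words_snoc, Finset.sum_eq_single w]
    · simp
    · intro x _ hx
      simp [hx]
    · simp [hwm]
  · intro w hw hwm
    have h1 := hAl (mk w hwm hw)
    have h1' : ∑ j : ι, A j (mk w hwm hw) * L j.1 = t' * L w := by
      have := hL (mk w hwm hw)
      simp only [mk] at this
      rw [this, mul_left_comm, ← h1, Finset.mul_sum]
      exact Finset.sum_congr rfl fun j _ => by rw [hL]; ring
    rw [← h1']
    simp only [A, Finset.sum_mul]
    rw [Finset.sum_comm]
    have h2 : ∀ y ∈ words (m + 1), ∑ j : ι,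
        (if y ∈ S ∧ y.dropLast = j.1 ∧ y.tail = (mk w hwm hw).1 then 1 else 0) * L j.1
        = if y ∈ S ∧ y.tail = w then L y.dropLast else 0 := by
      intro y hy
      rw [← hAsum L y (y ∈ S ∧ y.tail = w) List.dropLast (mem_words.1 hy) (fun h => h.1)
        (by simp [mem_words.1 hy]) (List.dropLast_prefix _).isInfix]
      refine Finset.sum_congr rfl fun j _ => ?_
      congr 1
      simp only [mk, and_assoc, and_comm (a := y.dropLast = j.1)]
    rw [Finset.sum_congr rfl h2, sum_words_cons]
    refine Finset.sum_congr rfl fun a _ => ?_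
    rw [Finset.sum_eq_single w]
    · simp
    · intro x _ hx
      simp [hx]
    · simp [hwm]
  · rw [← Finset.sum_filter, ← Finset.sum_coe_sort]
    have : ∀ i : ι, L i.1 * R i.1 = σ⁻¹ * (l i * r i) := fun i => by
      rw [hL, hR, mul_assoc]
    rw [Finset.sum_congr rfl fun i _ => this i, ← Finset.mul_sum]
    exact inv_mul_cancel₀ hσ.ne'

end IsLanguage

/-- `p` is the measure of maximal entropy of `S`: it has support `S`, it is Markov of order `m`, and
its transition probabilities are `exp (ρ (w b) - ρ w) / t`, where `ρ` depends on the last `m` letters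
only (`ρ` is the logarithm of a Perron eigenvector, `t` the Perron eigenvalue).  Moreover `- log p`
is the length times `log t` up to a bounded error. -/
structure IsParry (S : Set (List Bool)) (m : ℕ) (t : ℝ) (ρ p : List Bool → ℝ) : Prop where
  stationary : IsStationary p
  pos_iff : ∀ w : List Bool, 0 < p w ↔ w ∈ S
  markov : ∀ (u w : List Bool) (b : Bool), m ≤ w.length →
    p (u ++ w ++ [b]) * p w = p (u ++ w) * p (w ++ [b])
  log_ratio : ∀ (w : List Bool) (b : Bool), m ≤ w.length → w ++ [b] ∈ S →
    Real.log (p (w ++ [b]) / p w) = ρ (w ++ [b]) - ρ w - Real.log t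
  potential_cons : ∀ (a : Bool) (w : List Bool), m ≤ w.length → ρ (a :: w) = ρ w
  log_bound : ∃ K : ℝ, ∀ w ∈ S, m ≤ w.length → |Real.log (p w) + w.length * Real.log t| ≤ K

open Classical in
/-- The Parry measure on the words of length at least `m`, from the eigenvectors `l`, `r` and the
eigenvalue `t` of the transition matrix. -/
noncomputable def parryLong (S : Set (List Bool)) (m : ℕ) (t : ℝ) (l r : List Bool → ℝ)
    (w : List Bool) : ℝ :=
  if w ∈ S then l (w.take m) * r (lastWord m w) * (t⁻¹) ^ (w.length - m) else 0

/-- The Parry measure; a word shorter than `m` gets the total mass of its extensions of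
length `m`. -/
noncomputable def parry (S : Set (List Bool)) (m : ℕ) (t : ℝ) (l r : List Bool → ℝ)
    (w : List Bool) : ℝ :=
  ∑ u ∈ words (m - w.length), parryLong S m t l r (w ++ u)

lemma parry_of_le {S : Set (List Bool)} {m : ℕ} {t : ℝ} {l r : List Bool → ℝ} {w : List Bool}
    (h : m ≤ w.length) : parry S m t l r w = parryLong S m t l r w := by
  rw [parry, Nat.sub_eq_zero_of_le h, sum_words_zero, List.append_nil]

lemma IsLanguage.exists_isParry {S : Set (List Bool)} {m : ℕ} (hS : IsLanguage S m) :
    ∃ (t : ℝ) (ρ p : List Bool → ℝ), IsParry S m t ρ p := by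
  classical
  obtain ⟨t, ht, l, r, hlr, hr, hl, hσ⟩ := hS.exists_eigenvectors
  have hnot : ∀ w ∉ S, parryLong S m t l r w = 0 := fun w hw => if_neg hw
  have htake : ∀ w ∈ S, w.take m ∈ S := fun w hw => hS.infix_mem hw (List.take_prefix _ _).isInfix
  have hlast : ∀ w ∈ S, lastWord m w ∈ S := fun w hw =>
    hS.infix_mem hw (lastWord_suffix _ _).isInfix
  have hpos : ∀ w ∈ S, m ≤ w.length → 0 < parryLong S m t l r w := by
    intro w hw hm
    rw [parryLong, if_pos hw]
    have h1 := (hlr _ (htake w hw) (by simp [hm])).1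
    have h2 := (hlr _ (hlast w hw) (length_lastWord hm)).2
    positivity
  have hnn : ∀ w, m ≤ w.length → 0 ≤ parryLong S m t l r w := by
    intro w hm
    by_cases hw : w ∈ S
    · exact (hpos w hw hm).le
    · rw [hnot w hw]
  have hsnoc : ∀ w, m ≤ w.length →
      ∑ b : Bool, parryLong S m t l r (w ++ [b]) = parryLong S m t l r w := by
    intro w hm
    by_cases hw : w ∈ S
    · have key : ∀ b : Bool, parryLong S m t l r (w ++ [b]) =
          l (w.take m) * t⁻¹ ^ (w.length - m) * t⁻¹ *
          (if lastWord m w ++ [b] ∈ S then r (lastWord m w ++ [b]).tail else 0) := by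
        intro b
        rw [parryLong]
        by_cases hb : lastWord m w ++ [b] ∈ S
        · rw [if_pos hb, if_pos ((hS.append_mem_iff_lastWord hm).2 ⟨hw, hb⟩), lastWord_snoc b hm,
            List.take_append_of_le_length hm, List.length_append, List.length_singleton,
            Nat.sub_add_comm hm, pow_succ]
          ring
        · rw [if_neg hb, if_neg fun h => hb ((hS.append_mem_iff_lastWord hm).1 h).2, mul_zero]
      rw [Finset.sum_congr rfl fun b _ => key b, ← Finset.mul_sum,
        hr _ (hlast w hw) (length_lastWord hm), parryLong, if_pos hw]
      field_simp
    · rw [hnot w hw]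
      exact Finset.sum_eq_zero fun b _ => hnot _ fun h => hw (hS.of_append_left h)
  have hcons : ∀ w, m ≤ w.length →
      ∑ a : Bool, parryLong S m t l r (a :: w) = parryLong S m t l r w := by
    intro w hm
    by_cases hw : w ∈ S
    · have key : ∀ a : Bool, parryLong S m t l r (a :: w) =
          r (lastWord m w) * t⁻¹ ^ (w.length - m) * t⁻¹ *
          (if a :: w.take m ∈ S then l (a :: w.take m).dropLast else 0) := by
        intro a
        have hdl : (a :: w).take m = (a :: w.take m).dropLast := by
          rw [List.dropLast_eq_take, ← List.take_succ_cons, List.take_take]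
          congr 1
          simp; omega
        rw [parryLong]
        by_cases hb : a :: w.take m ∈ S
        · rw [if_pos hb, if_pos ((hS.cons_mem_iff_take hm).2 ⟨hw, hb⟩), lastWord_cons a hm, hdl,
            List.length_cons, Nat.sub_add_comm hm, pow_succ]
          ring
        · rw [if_neg hb, if_neg fun h => hb ((hS.cons_mem_iff_take hm).1 h).2, mul_zero]
      rw [Finset.sum_congr rfl fun b _ => key b, ← Finset.mul_sum,
        hl _ (htake w hw) (by simp [hm]), parryLong, if_pos hw]
      field_simp
    · rw [hnot w hw]
      exact Finset.sum_eq_zero fun b _ => hnot _ fun h =>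
        hw (hS.infix_mem h ⟨[b], [], by simp⟩)
  set p := parry S m t l r with hp
  have hpl : ∀ w, m ≤ w.length → p w = parryLong S m t l r w := fun w hw => parry_of_le hw
  have hpsnoc : ∀ w, ∑ b : Bool, p (w ++ [b]) = p w := by
    intro w
    rcases le_or_gt m w.length with hm | hm
    · rw [hpl w hm, ← hsnoc w hm]
      exact Finset.sum_congr rfl fun b _ => hpl _ (by simp; omega)
    · simp only [hp, parry, List.length_append, List.length_singleton, List.append_assoc,
        List.singleton_append]
      rw [show m - w.length = m - (w.length + 1) + 1 by omega, sum_words_cons]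
  have hpcons : ∀ w, ∑ a : Bool, p (a :: w) = p w := by
    intro w
    rcases le_or_gt m w.length with hm | hm
    · rw [hpl w hm, ← hcons w hm]
      exact Finset.sum_congr rfl fun b _ => hpl _ (by simp; omega)
    · simp only [hp, parry, List.length_cons]
      rw [show m - w.length = m - (w.length + 1) + 1 by omega, sum_words_snoc, Finset.sum_comm]
      refine Finset.sum_congr rfl fun u hu => ?_
      have hu' := mem_words.1 hu
      -- both sides are the mass of the words of length `m + 1` with `w ++ u` in the middle
      have e1 : ∀ a : Bool, parryLong S m t l r (a :: w ++ u)
          = ∑ b : Bool, parryLong S m t l r (a :: w ++ u ++ [b]) := fun a =>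
        (hsnoc _ (by simp; omega)).symm
      have e2 : ∀ b : Bool, parryLong S m t l r (w ++ (u ++ [b]))
          = ∑ a : Bool, parryLong S m t l r (a :: (w ++ (u ++ [b]))) := fun b =>
        (hcons _ (by simp; omega)).symm
      rw [Finset.sum_congr rfl fun a _ => e1 a, Finset.sum_congr rfl fun b _ => e2 b,
        Finset.sum_comm]
      simp
  have hpnn : ∀ w, 0 ≤ p w := fun w => Finset.sum_nonneg fun u hu =>
    hnn _ (by rw [List.length_append, mem_words.1 hu]; omega)
  have hppos : ∀ w, 0 < p w ↔ w ∈ S := by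
    intro w
    constructor
    · intro h
      by_contra hw
      refine h.ne' (Finset.sum_eq_zero fun u _ => hnot _ fun h => hw (hS.of_append_left h))
    · intro hw
      obtain ⟨v, hv, hwv⟩ := hS.exists_append hw (m - w.length)
      exact Finset.sum_pos' (fun u hu => hnn _ (by rw [List.length_append, mem_words.1 hu]; omega))
        ⟨v, mem_words.2 hv, hpos _ hwv (by simp; omega)⟩
  have hpS : ∀ w ∈ S, m ≤ w.length → p w =
      l (w.take m) * r (lastWord m w) * t⁻¹ ^ (w.length - m) := fun w hw hm => by
    rw [hpl w hm, parryLong, if_pos hw]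
  have hp0 : ∀ w ∉ S, p w = 0 := fun w hw =>
    le_antisymm (not_lt.1 fun h => hw ((hppos w).1 h)) (hpnn w)
  refine ⟨t, fun w => Real.log (r (lastWord m w)), p, ?_, hppos, ?_, ?_, ?_, ?_⟩
  · refine fun N => ⟨?_, fun w _ => hpnn w, fun w _ => ?_, fun w _ => ?_⟩
    · rw [← hσ, hp, parry]
      refine Finset.sum_congr (by simp) fun u hu => ?_
      have hu' : u.length = m := by simpa using hu
      rw [List.nil_append, parryLong, lastWord_self hu', ← hu', List.take_length]
      simp
    · rw [← hpsnoc w, Fintype.sum_bool, add_comm]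
    · rw [← hpcons w, Fintype.sum_bool, add_comm]
  · intro u w b hm
    by_cases h : u ++ w ++ [b] ∈ S
    · have h1 : u ++ w ∈ S := hS.of_append_left h
      have h2 : w ++ [b] ∈ S := hS.of_append_right (u := u) (by simpa using h)
      have h3 : w ∈ S := hS.of_append_left h2
      rw [hpS _ h (by simp; omega), hpS _ h1 (by simp; omega), hpS _ h2 (by simp; omega),
        hpS _ h3 hm, List.take_append_of_le_length (l₁ := u ++ w) (by simp; omega),
        List.take_append_of_le_length hm, lastWord_append u hm,
        show u ++ w ++ [b] = u ++ (w ++ [b]) by simp, lastWord_append u (w := w ++ [b])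
          (by simp; omega)]
      have e1 : (u ++ (w ++ [b])).length - m = u.length + (w.length - m) + 1 := by simp; omega
      have e2 : (u ++ w).length - m = u.length + (w.length - m) := by simp; omega
      have e3 : (w ++ [b]).length - m = (w.length - m) + 1 := by simp; omega
      rw [e1, e2, e3]
      ring
    · rw [hp0 _ h, zero_mul]
      rcases not_and_or.1 fun hh : u ++ w ∈ S ∧ w ++ [b] ∈ S => h (hS.glue hm hh.1 hh.2) with
        h1 | h1
      · rw [hp0 _ h1, zero_mul]
      · rw [hp0 _ h1, mul_zero]
  · intro w b hm hwb
    have hw := hS.of_append_left hwb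
    have h1 := (hlr _ (htake w hw) (by simp [hm])).1
    have h2 := (hlr _ (hlast w hw) (length_lastWord hm)).2
    have h3 := (hlr _ (hlast _ hwb) (length_lastWord (by simp; omega))).2
    have e : p (w ++ [b]) / p w = r (lastWord m (w ++ [b])) / r (lastWord m w) / t := by
      rw [hpS _ hw hm, hpS _ hwb (by simp; omega), List.take_append_of_le_length hm,
        List.length_append, List.length_singleton, Nat.sub_add_comm hm, pow_succ]
      field_simp
    rw [e, Real.log_div (by positivity) ht.ne', Real.log_div h3.ne' h2.ne']
  · intro a w hm
    simp only [lastWord_cons a hm]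
  · refine ⟨∑ u ∈ words m, (|Real.log (l u)| + |Real.log (r u)|) + m * |Real.log t|,
      fun w hw hm => ?_⟩
    have h1 := (hlr _ (htake w hw) (by simp [hm])).1
    have h2 := (hlr _ (hlast w hw) (length_lastWord hm)).2
    have e : Real.log (p w) + w.length * Real.log t =
        Real.log (l (w.take m)) + Real.log (r (lastWord m w)) + m * Real.log t := by
      rw [hpS _ hw hm, Real.log_mul (by positivity) (by positivity), Real.log_mul h1.ne' h2.ne',
        Real.log_pow, Real.log_inv, Nat.cast_sub hm]
      ring
    rw [e, Finset.sum_add_distrib]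
    refine (abs_add_le _ _).trans (add_le_add ((abs_add_le _ _).trans (add_le_add ?_ ?_)) ?_)
    · exact Finset.single_le_sum (f := fun u => |Real.log (l u)|) (fun _ _ => abs_nonneg _)
        (mem_words.2 (by simp [hm]))
    · exact Finset.single_le_sum (f := fun u => |Real.log (r u)|) (fun _ _ => abs_nonneg _)
        (mem_words.2 (length_lastWord hm))
    · rw [abs_mul, Nat.abs_cast]

namespace IsParry

variable {S : Set (List Bool)} {m : ℕ} {t : ℝ} {ρ p : List Bool → ℝ}

lemma pos (hp : IsParry S m t ρ p) {w : List Bool} (hw : w ∈ S) : 0 < p w := (hp.pos_iff w).2 hw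

lemma eq_zero (hp : IsParry S m t ρ p) {w : List Bool} (hw : w ∉ S) : p w = 0 :=
  le_antisymm (not_lt.1 fun h => hw ((hp.pos_iff w).1 h)) (hp.stationary.nonneg w)

lemma allowed_eq (hp : IsParry S m t ρ p) : allowed p = S := Set.ext hp.pos_iff

/-- The Markov property for several steps. -/
lemma markov_append (hp : IsParry S m t ρ p) (hS : IsLanguage S m) (u : List Bool)
    {w : List Bool} (v : List Bool) (hm : m ≤ w.length) :
    p (u ++ w ++ v) * p w = p (u ++ w) * p (w ++ v) := by
  induction v using List.reverseRecOn with
  | nil => simp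
  | append_singleton v b ih =>
    have h1 := hp.markov u (w ++ v) b (by simp; omega)
    simp only [← List.append_assoc] at h1 ih ⊢
    by_cases hwv : w ++ v ∈ S
    · refine mul_right_cancel₀ (hp.pos hwv).ne' ?_
      calc _ = (p (u ++ w ++ v ++ [b]) * p (w ++ v)) * p w := by ring
        _ = (p (u ++ w ++ v) * p w) * p (w ++ v ++ [b]) := by rw [h1]; ring
        _ = _ := by rw [ih]; ring
    · have h2 : w ++ v ++ [b] ∉ S := fun h => hwv (hS.of_append_left h)
      have h3 : u ++ w ++ v ++ [b] ∉ S := fun h =>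
        h2 (hS.of_append_right (u := u) (by simpa using h))
      rw [hp.eq_zero h2, hp.eq_zero h3, zero_mul, mul_zero]

lemma isMarkovChain (hp : IsParry S m t ρ p) (hS : IsLanguage S m) {M : ℕ} (hM : m ≤ M) :
    IsMarkovChain M p where
  stationary := hp.stationary
  markov u w a hw := hp.markov u w a (hw ▸ hM)
  irreducible u v _ _ hu hv := by
    obtain ⟨w, -, hw⟩ := hS.irreducible u ((hp.pos_iff u).1 hu) v ((hp.pos_iff v).1 hv)
    exact ⟨u ++ w ++ v, hp.pos hw, ⟨w ++ v, by simp⟩, ⟨u ++ w, rfl⟩⟩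

/-- A signed stationary distribution on the words of length `n + 1`, supported in `S`, gives the
information `- log p (v | w)` the mean `log t` times the total mass: the rest telescopes. -/
lemma sum_mul_log_ratio (hp : IsParry S m t ρ p) {n : ℕ} (hn : m ≤ n) {δ : List Bool → ℝ}
    (hδ : ∀ x : List Bool, x.length = n → ∑ a : Bool, δ (a :: x) = ∑ b : Bool, δ (x ++ [b]))
    (hδS : ∀ y : List Bool, y.length = n + 1 → y ∉ S → δ y = 0) :
    ∑ w ∈ words n, ∑ v : Bool, δ (w ++ [v]) * Real.log (p (w ++ [v]) / p w) =
      -Real.log t * ∑ y ∈ words (n + 1), δ y := by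
  have h1 : ∀ w ∈ words n, ∀ v : Bool, δ (w ++ [v]) * Real.log (p (w ++ [v]) / p w) =
      δ (w ++ [v]) * ρ (w ++ [v]) - δ (w ++ [v]) * ρ w - δ (w ++ [v]) * Real.log t := by
    intro w hw v
    have hw' := mem_words.1 hw
    by_cases h : w ++ [v] ∈ S
    · rw [hp.log_ratio w v (by omega) h]
      ring
    · rw [hδS _ (by simp [hw']) h]
      simp
  rw [Finset.sum_congr rfl fun w hw => Finset.sum_congr rfl fun v _ => h1 w hw v]
  simp only [Finset.sum_sub_distrib]
  have h2 : ∑ w ∈ words n, ∑ v : Bool, δ (w ++ [v]) * ρ (w ++ [v]) =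
      ∑ w ∈ words n, ∑ v : Bool, δ (w ++ [v]) * ρ w := by
    rw [← sum_words_snoc n fun y => δ y * ρ y, sum_words_cons, Finset.sum_comm]
    refine Finset.sum_congr rfl fun w hw => ?_
    have hw' := mem_words.1 hw
    rw [← Finset.sum_mul, ← hδ w hw', Finset.sum_mul]
    exact Finset.sum_congr rfl fun a _ => by rw [hp.potential_cons a w (by omega)]
  rw [h2, sub_self, zero_sub, sum_words_snoc]
  simp only [← Finset.sum_mul]
  ring

lemma condEntropy_eq (hp : IsParry S m t ρ p) {n : ℕ} (hn : m ≤ n) :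
    condEntropy p n = Real.log t := by
  rw [BSC.condEntropy_eq, hp.sum_mul_log_ratio hn (δ := p)
    (fun x _ => by rw [hp.stationary.sum_cons, hp.stationary.sum_snoc])
    (fun y _ h => hp.eq_zero h), (hp.stationary (n + 1)).sum_words le_rfl]
  ring

lemma entropyRate_eq (hp : IsParry S m t ρ p) : entropyRate p = Real.log t := by
  refine tendsto_nhds_unique hp.stationary.tendsto_condEntropy ?_
  refine tendsto_const_nhds.congr' ?_
  filter_upwards [eventually_ge_atTop m] with n hn
  rw [hp.condEntropy_eq hn]

end IsParry

/-- Gibbs' inequality for conditional entropies, with a quadratic remainder: the transition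
probabilities of any process `M` bound the conditional entropy of `P`. -/
lemma condEntropy_le {n : ℕ} {P M : List Bool → ℝ} (hP : IsStationaryOfLength (n + 1) P)
    (hM : IsStationaryOfLength (n + 1) M)
    (hPM : ∀ y : List Bool, y.length = n + 1 → M y = 0 → P y = 0) :
    condEntropy P n ≤ -∑ w ∈ words n, ∑ v : Bool, P (w ++ [v]) * Real.log (M (w ++ [v]) / M w)
      - (∑ w ∈ words n, ∑ v : Bool, (P (w ++ [v]) - P w * (M (w ++ [v]) / M w)) ^ 2) / 4 := by
  rw [hP.condEntropy_eq_ent2 (Nat.lt_succ_self n), ← Finset.sum_neg_distrib, Finset.sum_div,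
    ← Finset.sum_sub_distrib]
  refine Finset.sum_le_sum fun w hw => ?_
  have hw' := mem_words.1 hw
  have hP0 : ∀ v : Bool, 0 ≤ P (w ++ [v]) := fun v => hP.nonneg _ (by simp [hw'])
  have hM0 : ∀ v : Bool, 0 ≤ M (w ++ [v]) := fun v => hM.nonneg _ (by simp [hw'])
  have hPw := hP.append w (by omega)
  have hMw := hM.append w (by omega)
  simp only [Fintype.sum_bool]
  rcases (hM.nonneg w (by omega)).eq_or_lt with h0 | h0
  · have e : ∀ v : Bool, P (w ++ [v]) = 0 := by
      intro v
      refine hPM _ (by simp [hw']) ?_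
      have h1 := hM0 true
      have h2 := hM0 false
      cases v <;> linarith
    have hPw0 : P w = 0 := by rw [← hPw, e, e, add_zero]
    simp [e, hPw0, ent2]
  · have key := ent2_le (hP0 false) (hP0 true) (by rw [hPw]; exact hP.le_one (by omega))
      (div_nonneg (hM0 false) h0.le) (div_nonneg (hM0 true) h0.le)
      (by rw [← add_div, hMw, div_self h0.ne'])
      (fun h => hPM _ (by simp [hw']) ((div_eq_zero_iff.1 h).resolve_right h0.ne'))
      (fun h => hPM _ (by simp [hw']) ((div_eq_zero_iff.1 h).resolve_right h0.ne'))
    rw [hPw] at key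
    linarith

namespace IsParry

variable {S : Set (List Bool)} {m : ℕ} {t : ℝ} {ρ p : List Bool → ℝ}

/-- The stationary distribution of the chain is unique, even among signed distributions. -/
lemma eq_zero_of_transition (hp : IsParry S m t ρ p) (hS : IsLanguage S m) {n : ℕ}
    {δ : List Bool → ℝ}
    (hδ : ∀ x : List Bool, x.length = n → ∑ a : Bool, δ (a :: x) = ∑ b : Bool, δ (x ++ [b]))
    (hδS : ∀ y : List Bool, y.length = n + 1 → y ∉ S → δ y = 0)
    (hδ0 : ∑ y ∈ words (n + 1), δ y = 0)
    (htr : ∀ w ∈ S, w.length = n → ∀ v : Bool,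
      δ (w ++ [v]) = (∑ b : Bool, δ (w ++ [b])) * (p (w ++ [v]) / p w)) :
    ∀ y : List Bool, y.length = n + 1 → δ y = 0 := by
  classical
  set μ : List Bool → ℝ := fun w => ∑ b : Bool, δ (w ++ [b]) with hμ
  have hμS : ∀ w : List Bool, w.length = n → w ∉ S → μ w = 0 := fun w hw hwS =>
    Finset.sum_eq_zero fun b _ => hδS _ (by simp [hw]) fun h => hwS (hS.of_append_left h)
  obtain ⟨v₀, hv₀, hv₀S⟩ := hS.exists_append hS.nil_mem n
  rw [List.nil_append] at hv₀S
  -- subtract the largest multiple of `p` that leaves a nonnegative distribution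
  obtain ⟨w₀, hw₀, hmin⟩ := Finset.exists_min_image ((words n).filter (· ∈ S))
    (fun w => μ w / p w) ⟨v₀, by simp [hv₀, hv₀S]⟩
  have hw₀' : w₀.length = n ∧ w₀ ∈ S := by simpa using hw₀
  set c := μ w₀ / p w₀ with hc
  have hν : ∀ w : List Bool, w.length = n → 0 ≤ μ w - c * p w := by
    intro w hw
    by_cases hwS : w ∈ S
    · have := hmin w (by simp [hw, hwS])
      rw [le_div_iff₀ (hp.pos hwS)] at this
      linarith
    · rw [hμS w hw hwS, hp.eq_zero hwS]
      simp
  have hη : ∀ (w : List Bool) (b : Bool), w.length = n → w ∈ S →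
      δ (w ++ [b]) - c * p (w ++ [b]) = (μ w - c * p w) * (p (w ++ [b]) / p w) := by
    intro w b hw hwS
    have := (hp.pos hwS).ne'
    rw [htr w hwS hw b]
    field_simp
    ring
  have hη0 : ∀ y : List Bool, y.length = n + 1 → 0 ≤ δ y - c * p y := by
    intro y hy
    by_cases hyS : y ∈ S
    · obtain ⟨w, b, rfl⟩ : ∃ w b, y = w ++ [b] := by
        rcases List.eq_nil_or_concat y with h | ⟨w, b, h⟩
        · simp [h] at hy
        · exact ⟨w, b, by simpa using h⟩
      have hwl : w.length = n := by simpa using hy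
      have hwS := hS.of_append_left hyS
      rw [hη w b hwl hwS]
      exact mul_nonneg (hν w hwl) (div_nonneg (hp.stationary.nonneg _) (hp.pos hwS).le)
    · rw [hδS y hy hyS, hp.eq_zero hyS]
      simp
  -- a zero of the difference propagates backwards along the words of `S`
  have hback : ∀ y : List Bool, y ∈ S → n ≤ y.length →
      μ (lastWord n y) - c * p (lastWord n y) = 0 → μ (y.take n) - c * p (y.take n) = 0 := by
    intro y
    induction y using List.reverseRecOn with
    | nil =>
      intro _ hn h
      have : n = 0 := by simpa using hn
      subst this
      simpa [lastWord] using h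
    | append_singleton y b ih =>
      intro hy hn h
      rcases Nat.lt_or_ge y.length n with hlt | hle
      · rwa [lastWord_self (by simp at hn ⊢; omega), ← List.take_of_length_le (i := n)
          (l := y ++ [b]) (by simp; omega)] at h
      · rw [List.take_append_of_le_length hle]
        refine ih (hS.of_append_left hy) hle ?_
        rw [lastWord_snoc b hle] at h
        have hwl := length_lastWord hle
        have hwb : lastWord n y ++ [b] ∈ S :=
          hS.of_append_right (u := y.take (y.length - n)) (by
            rwa [← List.append_assoc, ← eq_append_lastWord])
        set w := lastWord n y
        have hwS := hS.of_append_left hwb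
        obtain ⟨a, ha⟩ : ∃ a, w ++ [b] = a :: (w ++ [b]).tail := by
          cases w with
          | nil => exact ⟨b, by simp⟩
          | cons c x => exact ⟨c, by simp⟩
        have hxl : (w ++ [b]).tail.length = n := by simp [hwl]
        generalize (w ++ [b]).tail = x at *
        have hsum : ∑ a : Bool, (δ (a :: x) - c * p (a :: x)) = 0 := by
          rw [Finset.sum_sub_distrib, ← Finset.mul_sum, hp.stationary.sum_cons, hδ x hxl]
          exact h
        have hz : δ (w ++ [b]) - c * p (w ++ [b]) = 0 := by
          rw [ha]
          exact (Finset.sum_eq_zero_iff_of_nonneg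
            (fun a _ => hη0 (a :: x) (by simp [hxl]))).1 hsum a (Finset.mem_univ a)
        rw [hη w b hwl hwS] at hz
        exact (mul_eq_zero.1 hz).resolve_right (div_pos (hp.pos hwb) (hp.pos hwS)).ne'
  have hall : ∀ w : List Bool, w.length = n → μ w = c * p w := by
    intro w hw
    by_cases hwS : w ∈ S
    · obtain ⟨x, -, hx⟩ := hS.irreducible w hwS w₀ hw₀'.2
      have h1 := hback (w ++ x ++ w₀) hx (by simp; omega) (by
        rw [lastWord_append _ hw₀'.1.ge, lastWord_self hw₀'.1, hc,
          div_mul_cancel₀ _ (hp.pos hw₀'.2).ne', sub_self])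
      rw [List.append_assoc, List.take_append_of_le_length hw.ge, ← hw, List.take_length] at h1
      linarith
    · rw [hμS w hw hwS, hp.eq_zero hwS, mul_zero]
  have hc0 : c = 0 := by
    rw [sum_words_snoc, Finset.sum_congr rfl fun w hw => hall w (mem_words.1 hw),
      ← Finset.mul_sum, (hp.stationary n).sum_words le_rfl, mul_one] at hδ0
    exact hδ0
  intro y hy
  by_cases hyS : y ∈ S
  · obtain ⟨w, b, rfl⟩ : ∃ w b, y = w ++ [b] := by
      rcases List.eq_nil_or_concat y with h | ⟨w, b, h⟩
      · simp [h] at hy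
      · exact ⟨w, b, by simpa using h⟩
    have hwl : w.length = n := by simpa using hy
    rw [htr w (hS.of_append_left hyS) hwl b]
    have := hall w hwl
    rw [hc0, zero_mul] at this
    rw [show ∑ b : Bool, δ (w ++ [b]) = 0 from this, zero_mul]
  · exact hδS y hy hyS

/-- The measure of maximal entropy is the only stationary process supported in `S` whose entropy
rate reaches `log t`. -/
lemma eq_of_le_entropyRate (hp : IsParry S m t ρ p) (hS : IsLanguage S m) {q : List Bool → ℝ}
    (hq : IsStationary q) (hqS : allowed q ⊆ S) (h : Real.log t ≤ entropyRate q) : q = p := by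
  have hq0 : ∀ y ∉ S, q y = 0 := fun y hy =>
    le_antisymm (not_lt.1 fun h => hy (hqS h)) (hq.nonneg y)
  have hlong : ∀ n, m ≤ n → ∀ y : List Bool, y.length = n + 1 → q y = p y := by
    intro n hn
    have h1 := condEntropy_le (hq (n + 1)) (hp.stationary (n + 1)) (fun y _ hy =>
      hq0 y fun hyS => (hp.pos hyS).ne' hy)
    rw [hp.sum_mul_log_ratio hn (δ := q) (fun x _ => by rw [hq.sum_cons, hq.sum_snoc])
      (fun y _ hy => hq0 y hy), (hq (n + 1)).sum_words le_rfl] at h1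
    have h2 := hq.entropyRate_le_condEntropy n
    have h3 : ∀ w ∈ words n, 0 ≤ ∑ v : Bool, (q (w ++ [v]) - q w * (p (w ++ [v]) / p w)) ^ 2 :=
      fun w _ => Finset.sum_nonneg fun v _ => sq_nonneg _
    have h4 : ∑ w ∈ words n, ∑ v : Bool, (q (w ++ [v]) - q w * (p (w ++ [v]) / p w)) ^ 2 = 0 :=
      le_antisymm (by linarith) (Finset.sum_nonneg h3)
    have h5 : ∀ w : List Bool, w.length = n → ∀ v : Bool,
        q (w ++ [v]) = q w * (p (w ++ [v]) / p w) := by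
      intro w hw v
      have h6 := (Finset.sum_eq_zero_iff_of_nonneg h3).1 h4 w (mem_words.2 hw)
      have h7 := (Finset.sum_eq_zero_iff_of_nonneg fun v _ => sq_nonneg _).1 h6 v
        (Finset.mem_univ v)
      exact sub_eq_zero.1 (pow_eq_zero_iff two_ne_zero |>.1 h7)
    intro y hy
    refine sub_eq_zero.1 (hp.eq_zero_of_transition hS (n := n) (δ := fun y => q y - p y)
      ?_ ?_ ?_ ?_ y hy)
    · intro x _
      simp only [Finset.sum_sub_distrib, hq.sum_cons, hq.sum_snoc, hp.stationary.sum_cons,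
        hp.stationary.sum_snoc]
    · intro y _ hyS
      rw [hq0 y hyS, hp.eq_zero hyS, sub_zero]
    · rw [Finset.sum_sub_distrib, (hq (n + 1)).sum_words le_rfl,
        (hp.stationary (n + 1)).sum_words le_rfl, sub_self]
    · intro w hwS hw v
      have := (hp.pos hwS).ne'
      simp only [Finset.sum_sub_distrib, hq.sum_snoc, hp.stationary.sum_snoc]
      rw [h5 w hw v]
      field_simp
  have hdown : ∀ k (y : List Bool), m + 1 ≤ y.length + k → q y = p y := by
    intro k
    induction k with
    | zero => intro y hy; exact hlong (y.length - 1) (by omega) y (by omega)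
    | succ k ih =>
      intro y hy
      rw [← hq.sum_snoc y, ← hp.stationary.sum_snoc y]
      exact Finset.sum_congr rfl fun b _ => ih _ (by simp; omega)
  exact funext fun y => hdown (m + 1) y (by omega)

lemma isMaxEntropyChain_iff (hp : IsParry S m t ρ p) (hS : IsLanguage S m) {M : ℕ} (hM : m ≤ M)
    (q : List Bool → ℝ) : IsMaxEntropyChain S M q ↔ q = p := by
  constructor
  · intro h
    refine hp.eq_of_le_entropyRate hS h.markovChain.stationary h.allowed_eq.le ?_
    rw [← hp.entropyRate_eq]
    exact h.entropyRate_le p (hp.isMarkovChain hS hM) hp.allowed_eq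
  · rintro rfl
    refine ⟨hp.isMarkovChain hS hM, hp.allowed_eq, fun r hr hrS => ?_⟩
    by_contra! h
    rw [hp.eq_of_le_entropyRate hS hr.stationary hrS.le (by rw [← hp.entropyRate_eq]; exact h.le)]
      at h
    exact h.false

end IsParry

/-! ### The noiseless capacity -/

lemma bscKernel_zero {N : ℕ} (x z : Fin N → Bool) :
    bscKernel 0 x z = if x = z then 1 else 0 := by
  rw [bscKernel]
  split_ifs with h
  · simp [h]
  · obtain ⟨i, hi⟩ := Function.ne_iff.1 h
    exact Finset.prod_eq_zero (Finset.mem_univ i) (if_neg hi)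

lemma mutualInfo_zero {N : ℕ} (q : (Fin N → Bool) → ℝ) :
    mutualInfo 0 q = ∑ z, Real.negMulLog (q z) := by
  simp only [mutualInfo, bscKernel_zero, mul_ite, mul_one, mul_zero, Finset.sum_ite_eq',
    Finset.mem_univ, if_true]
  have : ∀ x z : Fin N → Bool, Real.negMulLog (if x = z then (1 : ℝ) else 0) = 0 := by
    intro x z
    split_ifs <;> simp
  simp [this]

lemma IsParry.capacity_eq {S : Set (List Bool)} {m : ℕ} {t : ℝ} {ρ p : List Bool → ℝ}
    (hp : IsParry S m t ρ p) : capacity S = Real.log t := by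
  obtain ⟨K, hK⟩ := hp.log_bound
  rw [capacity, noisyCapacity]
  refine Tendsto.limUnder_eq ?_
  have hlim : Tendsto (fun n : ℕ => K / ((n : ℝ) + 1)) atTop (𝓝 0) :=
    tendsto_const_div_atTop_nhds_zero_nat K |>.comp (tendsto_add_atTop_nat 1) |>.congr
      fun n => by simp
  rw [tendsto_iff_dist_tendsto_zero]
  refine squeeze_zero' (Eventually.of_forall fun _ => dist_nonneg) ?_ hlim
  filter_upwards [eventually_ge_atTop m] with n hn
  set A := {I : ℝ | ∃ q ∈ stdSimplex ℝ (Fin (n + 1) → Bool),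
      (∀ x, 0 < q x → List.ofFn x ∈ S) ∧ I = mutualInfo 0 q}
  have hsum : ∑ x : Fin (n + 1) → Bool, p (List.ofFn x) = 1 := by
    rw [sum_ofFn, (hp.stationary (n + 1)).sum_words le_rfl]
  have hlog : ∀ x : Fin (n + 1) → Bool, List.ofFn x ∈ S →
      |Real.log (p (List.ofFn x)) + ((n : ℝ) + 1) * Real.log t| ≤ K := by
    intro x hx
    have := hK _ hx (by simp; omega)
    simpa using this
  have hub : ∀ I ∈ A, I ≤ ((n : ℝ) + 1) * Real.log t + K := by
    rintro _ ⟨q, hq, hqS, rfl⟩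
    rw [mutualInfo_zero]
    have h1 : ∀ x, Real.negMulLog (q x) ≤
        q x * (((n : ℝ) + 1) * Real.log t + K) + (p (List.ofFn x) - q x) := by
      intro x
      by_cases hx : List.ofFn x ∈ S
      · have hpx := hp.pos hx
        have hq1 : q x ≤ 1 := by
          rw [← hq.2]
          exact Finset.single_le_sum (fun z _ => hq.1 z) (Finset.mem_univ x)
        have h2 := sq_sub_le_mul_log (hq.1 x) hq1 hpx.le
          ((hp.stationary (n + 1)).le_one (w := List.ofFn x) (by simp)) fun h => absurd h hpx.ne'
        have h3 := mul_le_mul_of_nonneg_left (neg_le_of_abs_le (hlog x hx)) (hq.1 x)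
        rw [Real.negMulLog]
        nlinarith [sq_nonneg (q x - p (List.ofFn x))]
      · have h0 : q x = 0 := le_antisymm (not_lt.1 fun h => hx (hqS x h)) (hq.1 x)
        rw [h0, hp.eq_zero hx]; simp
    refine (Finset.sum_le_sum fun x _ => h1 x).trans_eq ?_
    rw [Finset.sum_add_distrib, ← Finset.sum_mul, Finset.sum_sub_distrib, hsum, hq.2]
    ring
  have hmem : ∑ x : Fin (n + 1) → Bool, Real.negMulLog (p (List.ofFn x)) ∈ A :=
    ⟨fun x => p (List.ofFn x), ⟨fun x => hp.stationary.nonneg _, hsum⟩,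
      fun x hx => (hp.pos_iff _).1 hx, (mutualInfo_zero _).symm⟩
  have hlb : ((n : ℝ) + 1) * Real.log t - K ≤ sSup A := by
    refine le_trans ?_ (le_csSup ⟨_, hub⟩ hmem)
    have h1 : ∀ x : Fin (n + 1) → Bool,
        p (List.ofFn x) * (((n : ℝ) + 1) * Real.log t - K) ≤ Real.negMulLog (p (List.ofFn x)) := by
      intro x
      by_cases hx : List.ofFn x ∈ S
      · have h3 := mul_le_mul_of_nonneg_left (le_of_abs_le (hlog x hx)) (hp.pos hx).le
        rw [Real.negMulLog]
        linarith
      · rw [hp.eq_zero hx]; simp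
    refine le_trans (le_of_eq ?_) (Finset.sum_le_sum fun x _ => h1 x)
    rw [← Finset.sum_mul, hsum, one_mul]
  have hub' : sSup A ≤ ((n : ℝ) + 1) * Real.log t + K := csSup_le ⟨_, hmem⟩ hub
  have hn0 : (0 : ℝ) < (n : ℝ) + 1 := by positivity
  rw [Real.dist_eq, abs_le]
  constructor
  · rw [neg_le_sub_iff_le_add, ← add_div, le_div_iff₀ hn0]
    linarith
  · rw [sub_le_iff_le_add, div_le_iff₀ hn0, add_mul, div_mul_cancel₀ _ hn0.ne']
    linarith

/-! ### The optimal input is the chain of maximal entropy, up to second order -/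

/-- The total variation on the words of length `n`. -/
noncomputable def variation (n : ℕ) (δ : List Bool → ℝ) : ℝ := ∑ y ∈ words n, |δ y|

lemma variation_nonneg (n : ℕ) (δ : List Bool → ℝ) : 0 ≤ variation n δ :=
  Finset.sum_nonneg fun _ _ => abs_nonneg _

lemma abs_le_variation {n : ℕ} (δ : List Bool → ℝ) {y : List Bool} (hy : y.length = n) :
    |δ y| ≤ variation n δ :=
  Finset.single_le_sum (f := fun y => |δ y|) (fun _ _ => abs_nonneg _) (mem_words.2 hy)

/-- `δ` behaves on words of length `n + 1` like the difference of two stationary processes supported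
in `S`. -/
structure IsPerturbation (S : Set (List Bool)) (n : ℕ) (δ : List Bool → ℝ) : Prop where
  shift : ∀ x : List Bool, x.length = n → ∑ a : Bool, δ (a :: x) = ∑ b : Bool, δ (x ++ [b])
  support : ∀ y : List Bool, y.length = n + 1 → y ∉ S → δ y = 0
  sum_eq : ∑ y ∈ words (n + 1), δ y = 0

/-- The amount by which `δ` fails to have the transition probabilities of `M`, at the transition
`x.1 → x.2`. -/
noncomputable def defect (M δ : List Bool → ℝ) (x : List Bool × Bool) : ℝ :=
  δ (x.1 ++ [x.2]) - (∑ b : Bool, δ (x.1 ++ [b])) * (M (x.1 ++ [x.2]) / M x.1)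

open Classical in
/-- The pairs of a word of length `n` of `S` and a next letter. -/
noncomputable def transitions (S : Set (List Bool)) (n : ℕ) : Finset (List Bool × Bool) :=
  (words n).filter (· ∈ S) ×ˢ Finset.univ

lemma mem_transitions {S : Set (List Bool)} {n : ℕ} {x : List Bool × Bool} :
    x ∈ transitions S n ↔ x.1.length = n ∧ x.1 ∈ S := by
  simp [transitions]

namespace IsParry

variable {S : Set (List Bool)} {m : ℕ} {t : ℝ} {ρ p : List Bool → ℝ}

/-- By compactness, uniqueness of the stationary distribution is quantitative. -/
lemma exists_le_sum_defect (hp : IsParry S m t ρ p) (hS : IsLanguage S m) (n : ℕ) :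
    ∃ c : ℝ, 0 < c ∧ ∀ δ : List Bool → ℝ, IsPerturbation S n δ →
      c * variation (n + 1) δ ≤ ∑ x ∈ transitions S n, |defect p δ x| := by
  set G : (List Bool → ℝ) → ℝ := fun δ => ∑ x ∈ transitions S n, |defect p δ x| with hG
  have hGcont : Continuous G := by
    simp only [hG, defect]
    fun_prop
  have hGnn : ∀ δ, 0 ≤ G δ := fun δ => Finset.sum_nonneg fun _ _ => abs_nonneg _
  set K : Set (List Bool → ℝ) := {δ | ∀ y, δ y ∈ Set.Icc (-1 : ℝ) 1} ∩
    ({δ | variation (n + 1) δ = 1} ∩ {δ | IsPerturbation S n δ}) with hK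
  have hKc : IsCompact K := by
    have h1 : IsCompact {δ : List Bool → ℝ | ∀ y, δ y ∈ Set.Icc (-1 : ℝ) 1} := by
      have := isCompact_univ_pi (X := fun _ : List Bool => ℝ) fun _ =>
        isCompact_Icc (a := (-1 : ℝ)) (b := 1)
      simpa [Set.pi] using this
    refine h1.inter_right (IsClosed.inter ?_ ?_)
    · have : Continuous fun δ : List Bool → ℝ => variation (n + 1) δ := by
        unfold variation
        fun_prop
      exact isClosed_eq this continuous_const
    · have : {δ | IsPerturbation S n δ} =
          {δ : List Bool → ℝ | ∀ x : List Bool, x.length = n →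
              ∑ a : Bool, δ (a :: x) = ∑ b : Bool, δ (x ++ [b])} ∩
          ({δ : List Bool → ℝ | ∀ y : List Bool, y.length = n + 1 → y ∉ S → δ y = 0} ∩
          {δ : List Bool → ℝ | ∑ y ∈ words (n + 1), δ y = 0}) := by
        ext δ
        exact ⟨fun h => ⟨h.1, h.2, h.3⟩, fun h => ⟨h.1, h.2.1, h.2.2⟩⟩
      rw [this]
      refine IsClosed.inter ?_ (IsClosed.inter ?_ ?_)
      · simp only [Set.ofPred_forall]
        exact isClosed_iInter fun x => isClosed_iInter fun _ =>
          isClosed_eq (by fun_prop) (by fun_prop)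
      · simp only [Set.ofPred_forall]
        exact isClosed_iInter fun x => isClosed_iInter fun _ => isClosed_iInter fun _ =>
          isClosed_eq (by fun_prop) (by fun_prop)
      · exact isClosed_eq (by fun_prop) (by fun_prop)
  have hGpos : ∀ δ ∈ K, 0 < G δ := by
    rintro δ ⟨-, h1, h2⟩
    refine (hGnn δ).lt_of_ne fun h0 => ?_
    have h3 := (Finset.sum_eq_zero_iff_of_nonneg fun x _ => abs_nonneg (defect p δ x)).1 h0.symm
    have h4 := hp.eq_zero_of_transition hS h2.shift h2.support h2.sum_eq fun w hw hwl v =>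
      sub_eq_zero.1 (abs_eq_zero.1 (h3 (w, v) (mem_transitions.2 ⟨hwl, hw⟩)))
    have h5 : variation (n + 1) δ = 0 :=
      Finset.sum_eq_zero fun y hy => by rw [h4 y (mem_words.1 hy), abs_zero]
    rw [Set.mem_ofPred_eq, h5] at h1
    exact zero_ne_one h1
  obtain ⟨c, hc, hcK⟩ : ∃ c : ℝ, 0 < c ∧ ∀ δ ∈ K, c ≤ G δ := by
    rcases K.eq_empty_or_nonempty with h | h
    · exact ⟨1, one_pos, by simp [h]⟩
    · obtain ⟨δ, hδ, hmin⟩ := hKc.exists_isMinOn h hGcont.continuousOn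
      exact ⟨G δ, hGpos δ hδ, fun δ' h' => hmin h'⟩
  refine ⟨c, hc, fun δ hδ => ?_⟩
  rcases (variation_nonneg (n + 1) δ).eq_or_lt with h0 | h0
  · rw [← h0, mul_zero]
    exact hGnn δ
  -- normalize, and forget the words of other lengths
  set V := variation (n + 1) δ with hV
  set η : List Bool → ℝ := fun y => if y.length = n + 1 then V⁻¹ * δ y else 0 with hη
  have hηy : ∀ y : List Bool, y.length = n + 1 → η y = V⁻¹ * δ y := fun y hy => if_pos hy
  have hηV : ∑ y ∈ words (n + 1), |η y| = 1 := by
    rw [Finset.sum_congr rfl fun y hy => by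
      rw [hηy y (mem_words.1 hy), abs_mul, abs_of_pos (inv_pos.2 h0)], ← Finset.mul_sum]
    exact inv_mul_cancel₀ h0.ne'
  have hηK : η ∈ K := by
    refine ⟨fun y => ?_, hηV, ?_, ?_, ?_⟩
    · by_cases hy : y.length = n + 1
      · rw [Set.mem_Icc, ← abs_le, ← hηV]
        exact abs_le_variation η hy
      · simp [hη, hy]
    · intro x hx
      rw [Finset.sum_congr rfl fun a _ => hηy (a :: x) (by simp [hx]),
        Finset.sum_congr rfl fun b _ => hηy (x ++ [b]) (by simp [hx]), ← Finset.mul_sum,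
        ← Finset.mul_sum, hδ.shift x hx]
    · intro y hy hyS
      rw [hηy y hy, hδ.support y hy hyS, mul_zero]
    · rw [Finset.sum_congr rfl fun y hy => hηy y (mem_words.1 hy), ← Finset.mul_sum, hδ.sum_eq,
        mul_zero]
  have hGη : G η = V⁻¹ * G δ := by
    simp only [hG]
    rw [Finset.mul_sum]
    refine Finset.sum_congr rfl fun x hx => ?_
    have hx' := (mem_transitions.1 hx).1
    rw [defect, Finset.sum_congr rfl fun b _ => hηy (x.1 ++ [b]) (by simp [hx']),
      hηy _ (by simp [hx']), ← Finset.mul_sum, mul_assoc, ← mul_sub, abs_mul,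
      abs_of_pos (inv_pos.2 h0)]
    rfl
  have h6 := hcK η hηK
  rw [hGη, inv_mul_eq_div, le_div_iff₀ h0] at h6
  exact h6

lemma output_sub_isBigO (hp : IsParry S m t ρ p) (y : List Bool) :
    (fun ε => output ε p y - p y) =O[𝓝[>] 0] fun ε : ℝ => ε := by
  refine IsBigO.of_bound y.length ?_
  filter_upwards [Ioo_mem_nhdsGT (show (0 : ℝ) < 1 by norm_num)] with ε hε
  have h1 := abs_output_sub_le hε.1.le hε.2.le p y
  have h2 : ∑ x ∈ words y.length, |p x| = 1 := by
    rw [← (hp.stationary y.length).sum_words le_rfl]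
    exact Finset.sum_congr rfl fun x _ => abs_of_nonneg (hp.stationary.nonneg x)
  rw [h2, mul_one] at h1
  rwa [Real.norm_eq_abs, Real.norm_eq_abs, abs_of_pos hε.1]

lemma pow_le_output (hp : IsParry S m t ρ p) {ε : ℝ} (h0 : 0 ≤ ε) (h1 : ε ≤ 1 / 2)
    (y : List Bool) : ε ^ y.length ≤ output ε p y := by
  have := BSC.pow_le_output h0 h1 (p := p) (z := y) fun x _ => hp.stationary.nonneg x
  rwa [(hp.stationary y.length).sum_words le_rfl, one_mul] at this

lemma log_output_sub_isBigO (hp : IsParry S m t ρ p) {y : List Bool} (hy : y ∈ S) :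
    (fun ε => Real.log (output ε p y) - Real.log (p y)) =O[𝓝[>] 0] fun ε : ℝ => ε := by
  have h1 := hp.output_sub_isBigO y
  have h2 : Tendsto (fun ε => output ε p y) (𝓝[>] 0) (𝓝 (p y)) := by
    have h3 : Tendsto (fun ε : ℝ => ε) (𝓝[>] 0) (𝓝 0) := nhdsWithin_le_nhds
    have := (h1.trans_tendsto h3).add_const (p y)
    simpa using this
  exact ((Real.differentiableAt_log (hp.pos hy).ne').isBigO_sub.comp_tendsto h2).trans h1

/-- The defect with respect to the noisy transition probabilities is still coercive. -/
lemma exists_le_sum_defect_output (hp : IsParry S m t ρ p) (hS : IsLanguage S m) (n : ℕ) :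
    ∃ c : ℝ, 0 < c ∧ ∀ᶠ ε : ℝ in 𝓝[>] 0, ∀ δ : List Bool → ℝ, IsPerturbation S n δ →
      c * variation (n + 1) δ ≤
        ∑ x ∈ transitions S n, |defect (output ε p) (output ε δ) x| := by
  obtain ⟨c, hc, hcG⟩ := hp.exists_le_sum_defect hS n
  refine ⟨c / 2, by positivity, ?_⟩
  set k : ℝ := ((transitions S n).card : ℝ) with hk
  have hk0 : 0 ≤ k := Nat.cast_nonneg _
  set κ : ℝ := c / (2 * (k + 1)) with hκ
  have hκ0 : 0 < κ := by positivity
  have hq : ∀ x ∈ transitions S n, ∀ᶠ ε : ℝ in 𝓝[>] 0, 3 * ((n + 1 : ℕ) : ℝ) * ε +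
      |output ε p (x.1 ++ [x.2]) / output ε p x.1 - p (x.1 ++ [x.2]) / p x.1| < κ := by
    intro x hx
    have hpx := (hp.pos (mem_transitions.1 hx).2).ne'
    have h0 : Tendsto (fun ε : ℝ => ε) (𝓝[>] 0) (𝓝 0) := nhdsWithin_le_nhds
    have hlim : ∀ y, Tendsto (fun ε => output ε p y) (𝓝[>] 0) (𝓝 (p y)) := fun y => by
      have := ((hp.output_sub_isBigO y).trans_tendsto h0).add_const (p y)
      simpa using this
    have h1 := (h0.const_mul (3 * ((n + 1 : ℕ) : ℝ))).add
      ((((hlim (x.1 ++ [x.2])).div (hlim x.1) hpx).sub_const (p (x.1 ++ [x.2]) / p x.1)).abs)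
    simp only [mul_zero, sub_self, abs_zero, add_zero] at h1
    exact h1.eventually (gt_mem_nhds hκ0)
  filter_upwards [(Finset.eventually_all _).2 hq,
    Ioo_mem_nhdsGT (show (0 : ℝ) < 1 / 2 by norm_num)] with ε hε hε1 δ hδ
  have hε0 := hε1.1.le
  have hε2 : ε ≤ 1 := by linarith [hε1.2]
  set V := variation (n + 1) δ with hV
  have hV0 : 0 ≤ V := variation_nonneg _ _
  have hdiff : ∀ y : List Bool, y.length = n + 1 →
      |output ε δ y - δ y| ≤ ((n + 1 : ℕ) : ℝ) * ε * V := by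
    intro y hy
    have := abs_output_sub_le hε0 hε2 δ y
    rwa [hy] at this
  have key : ∀ x ∈ transitions S n,
      |defect p δ x| ≤ |defect (output ε p) (output ε δ) x| + κ * V := by
    intro x hx
    obtain ⟨hxl, hxS⟩ := mem_transitions.1 hx
    set Q := output ε p (x.1 ++ [x.2]) / output ε p x.1 with hQ
    set Q₀ := p (x.1 ++ [x.2]) / p x.1 with hQ₀
    set A := ∑ b : Bool, δ (x.1 ++ [b])
    set B := ∑ b : Bool, output ε δ (x.1 ++ [b])
    have hQ1 : |Q| ≤ 1 := by
      have hst := hp.stationary.output hε0 hε2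
      rw [abs_of_nonneg (div_nonneg (hst.nonneg _) (hst.nonneg _))]
      refine div_le_one_of_le₀ ?_ (hst.nonneg _)
      rw [← hst.sum_snoc x.1]
      exact Finset.single_le_sum (f := fun b => output ε p (x.1 ++ [b]))
        (fun _ _ => hst.nonneg _) (Finset.mem_univ x.2)
    have hBA : |B - A| ≤ 2 * (((n + 1 : ℕ) : ℝ) * ε * V) := by
      simp only [A, B, Fintype.sum_bool]
      have h1 := abs_le.1 (hdiff (x.1 ++ [true]) (by simp [hxl]))
      have h2 := abs_le.1 (hdiff (x.1 ++ [false]) (by simp [hxl]))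
      rw [abs_le]
      constructor <;> linarith
    have hA : |A| ≤ V := by
      refine (Finset.abs_sum_le_sum_abs _ _).trans ?_
      rw [hV, variation, sum_words_snoc]
      exact Finset.single_le_sum (f := fun w => ∑ b : Bool, |δ (w ++ [b])|)
        (fun w _ => Finset.sum_nonneg fun _ _ => abs_nonneg _) (mem_words.2 hxl)
    have e : defect p δ x = defect (output ε p) (output ε δ) x
        + (-(output ε δ (x.1 ++ [x.2]) - δ (x.1 ++ [x.2])) + ((B - A) * Q + A * (Q - Q₀))) := by
      simp only [defect]
      ring
    rw [e]
    refine (abs_add_le _ _).trans (add_le_add le_rfl ?_)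
    have i1 := hdiff (x.1 ++ [x.2]) (by simp [hxl])
    have i2 : |(B - A) * Q| ≤ 2 * (((n + 1 : ℕ) : ℝ) * ε * V) := by
      rw [abs_mul]
      exact (mul_le_of_le_one_right (abs_nonneg _) hQ1).trans hBA
    have i3 : |A * (Q - Q₀)| ≤ V * |Q - Q₀| := by
      rw [abs_mul]
      exact mul_le_mul_of_nonneg_right hA (abs_nonneg _)
    have i4 := mul_le_mul_of_nonneg_right (hε x hx).le hV0
    refine (abs_add_le _ _).trans ?_
    rw [abs_neg]
    have := abs_add_le ((B - A) * Q) (A * (Q - Q₀))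
    calc _ ≤ ((n + 1 : ℕ) : ℝ) * ε * V + (2 * (((n + 1 : ℕ) : ℝ) * ε * V) + V * |Q - Q₀|) := by
          linarith
      _ = (3 * ((n + 1 : ℕ) : ℝ) * ε + |Q - Q₀|) * V := by ring
      _ ≤ _ := i4
  have h1 := (hcG δ hδ).trans (Finset.sum_le_sum key)
  rw [Finset.sum_add_distrib, Finset.sum_const, nsmul_eq_mul, ← hk] at h1
  have h2 : k * (κ * V) ≤ c / 2 * V := by
    rw [← mul_assoc]
    refine mul_le_mul_of_nonneg_right ?_ hV0
    rw [hκ, mul_div_assoc', div_le_div_iff₀ (by positivity) (by norm_num)]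
    nlinarith
  linarith

/-- The linear part of the gain vanishes for `ε = 0`, and is small for small `ε`. -/
lemma exists_abs_sum_mul_log_le (hp : IsParry S m t ρ p) (hS : IsLanguage S m) {n : ℕ}
    (hn : m ≤ n) :
    ∃ C : ℝ, 0 ≤ C ∧ ∀ᶠ ε : ℝ in 𝓝[>] 0, ∀ δ : List Bool → ℝ, IsPerturbation S n δ →
      |∑ w ∈ words n, ∑ v : Bool, output ε δ (w ++ [v]) *
        Real.log (output ε p (w ++ [v]) / output ε p w)|
        ≤ C * (ε * Real.log (1 / ε)) * variation (n + 1) δ := by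
  have hlog1 : ∀ᶠ ε : ℝ in 𝓝[>] 0, 1 ≤ Real.log (1 / ε) := by
    filter_upwards [Ioo_mem_nhdsGT (Real.exp_pos (-1))] with ε hε
    rw [one_div, Real.log_inv, le_neg, ← Real.log_exp (-1)]
    exact Real.log_le_log hε.1 hε.2.le
  have key : ∀ y ∈ words (n + 1), ∃ C : ℝ, 0 ≤ C ∧ ∀ᶠ ε : ℝ in 𝓝[>] 0, ∀ δ : List Bool → ℝ,
      IsPerturbation S n δ →
      |output ε δ y * Real.log (output ε p y / output ε p y.dropLast)
        - δ y * Real.log (p y / p y.dropLast)|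
        ≤ C * (ε * Real.log (1 / ε)) * variation (n + 1) δ := by
    intro y hy
    have hyl := mem_words.1 hy
    by_cases hyS : y ∈ S
    · have hwS : y.dropLast ∈ S := hS.infix_mem hyS (List.dropLast_prefix _).isInfix
      obtain ⟨C₁, hC₁⟩ := (hp.log_output_sub_isBigO hyS).bound
      obtain ⟨C₂, hC₂⟩ := (hp.log_output_sub_isBigO hwS).bound
      set Q₀ := Real.log (p y / p y.dropLast) with hQ₀
      refine ⟨((n + 1 : ℕ) : ℝ) * (|Q₀| + (|C₁| + |C₂|)) + (|C₁| + |C₂|), by positivity, ?_⟩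
      filter_upwards [hC₁, hC₂, hlog1,
        Ioo_mem_nhdsGT (show (0 : ℝ) < 1 / 2 by norm_num)] with ε h1 h2 h3 hε δ hδ
      have hε0 := hε.1
      have hε1 : ε ≤ 1 := by linarith [hε.2]
      rw [Real.norm_eq_abs, Real.norm_eq_abs, abs_of_pos hε0] at h1 h2
      have hMy : 0 < output ε p y := (pow_pos hε0 _).trans_le (hp.pow_le_output hε0.le hε.2.le _)
      have hMw : 0 < output ε p y.dropLast :=
        (pow_pos hε0 _).trans_le (hp.pow_le_output hε0.le hε.2.le _)
      set Q := Real.log (output ε p y / output ε p y.dropLast) with hQ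
      set V := variation (n + 1) δ
      have hV0 : 0 ≤ V := variation_nonneg _ _
      have hQQ : |Q - Q₀| ≤ (|C₁| + |C₂|) * ε := by
        rw [hQ, hQ₀, Real.log_div hMy.ne' hMw.ne', Real.log_div (hp.pos hyS).ne' (hp.pos hwS).ne']
        have e : Real.log (output ε p y) - Real.log (output ε p y.dropLast)
            - (Real.log (p y) - Real.log (p y.dropLast))
            = (Real.log (output ε p y) - Real.log (p y))
              - (Real.log (output ε p y.dropLast) - Real.log (p y.dropLast)) := by ring
        rw [e, add_mul]
        refine (abs_sub _ _).trans (add_le_add (h1.trans ?_) (h2.trans ?_)) <;>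
        exact mul_le_mul_of_nonneg_right (le_abs_self _) hε0.le
      have hQ1 : |Q| ≤ |Q₀| + (|C₁| + |C₂|) := by
        have e : Q = Q₀ + (Q - Q₀) := by ring
        rw [e]
        refine (abs_add_le _ _).trans (add_le_add le_rfl (hQQ.trans ?_))
        exact mul_le_of_le_one_right (by positivity) hε1
      have hd := abs_output_sub_le hε0.le hε1 δ y
      rw [hyl] at hd
      have e : output ε δ y * Q - δ y * Q₀ = (output ε δ y - δ y) * Q + δ y * (Q - Q₀) := by ring
      rw [e]
      calc _ ≤ |(output ε δ y - δ y) * Q| + |δ y * (Q - Q₀)| := abs_add_le _ _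
        _ ≤ (((n + 1 : ℕ) : ℝ) * ε * V) * (|Q₀| + (|C₁| + |C₂|)) + V * ((|C₁| + |C₂|) * ε) := by
            rw [abs_mul, abs_mul]
            exact add_le_add (mul_le_mul hd hQ1 (abs_nonneg _) (by positivity))
              (mul_le_mul (abs_le_variation δ hyl) hQQ (abs_nonneg _) hV0)
        _ = (((n + 1 : ℕ) : ℝ) * (|Q₀| + (|C₁| + |C₂|)) + (|C₁| + |C₂|)) * (ε * 1) * V := by ring
        _ ≤ _ := by gcongr
    · refine ⟨((n + 1 : ℕ) : ℝ) * ((n + 1 : ℕ) : ℝ), by positivity, ?_⟩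
      filter_upwards [hlog1, Ioo_mem_nhdsGT (show (0 : ℝ) < 1 / 2 by norm_num)] with ε h3 hε δ hδ
      have hε0 := hε.1
      have hε1 : ε ≤ 1 := by linarith [hε.2]
      have hlow := hp.pow_le_output hε0.le hε.2.le y
      have hMy : 0 < output ε p y := (pow_pos hε0 _).trans_le hlow
      have hst := hp.stationary.output hε0.le hε1
      have hMw : 0 < output ε p y.dropLast :=
        (pow_pos hε0 _).trans_le (hp.pow_le_output hε0.le hε.2.le _)
      have hMw1 : output ε p y.dropLast ≤ 1 := (hst _).le_one le_rfl
      have hMyw : output ε p y ≤ output ε p y.dropLast := by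
        have hy0 : y ≠ [] := by rintro rfl; simp at hyl
        rw [← hst.sum_snoc y.dropLast]
        conv_lhs => rw [← List.dropLast_append_getLast hy0]
        exact Finset.single_le_sum (f := fun b => output ε p (y.dropLast ++ [b]))
          (fun _ _ => hst.nonneg _) (Finset.mem_univ _)
      rw [hδ.support y hyl hyS, zero_mul, sub_zero, abs_mul]
      have hd := abs_output_sub_le hε0.le hε1 δ y
      rw [hyl, hδ.support y hyl hyS, sub_zero] at hd
      have hQ : |Real.log (output ε p y / output ε p y.dropLast)|
          ≤ ((n + 1 : ℕ) : ℝ) * Real.log (1 / ε) := by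
        rw [abs_of_nonpos (Real.log_nonpos (by positivity) (div_le_one_of_le₀ hMyw hMw.le)), neg_le,
          one_div, Real.log_inv, mul_neg, neg_neg, ← hyl, ← Real.log_pow]
        refine Real.log_le_log (by positivity) ?_
        rw [le_div_iff₀ hMw]
        exact (mul_le_of_le_one_right (by positivity) hMw1).trans hlow
      have hV0 : 0 ≤ variation (n + 1) δ := variation_nonneg _ _
      calc _ ≤ (((n + 1 : ℕ) : ℝ) * ε * variation (n + 1) δ)
            * (((n + 1 : ℕ) : ℝ) * Real.log (1 / ε)) :=
            mul_le_mul hd hQ (abs_nonneg _) (by positivity)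
        _ = _ := by ring
  choose! C hC0 hC using key
  refine ⟨∑ y ∈ words (n + 1), C y, Finset.sum_nonneg hC0, ?_⟩
  filter_upwards [(Finset.eventually_all _).2 hC] with ε hε δ hδ
  have h0 := hp.sum_mul_log_ratio hn hδ.shift hδ.support
  rw [hδ.sum_eq, mul_zero] at h0
  have hconv : ∀ M δ : List Bool → ℝ, ∑ w ∈ words n, ∑ v : Bool, δ (w ++ [v]) *
      Real.log (M (w ++ [v]) / M w) =
      ∑ y ∈ words (n + 1), δ y * Real.log (M y / M y.dropLast) := by
    intro M δ
    rw [sum_words_snoc]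
    simp
  rw [hconv p δ] at h0
  rw [hconv (output ε p) (output ε δ), ← sub_zero (∑ y ∈ words (n + 1), _), ← h0,
    ← Finset.sum_sub_distrib, Finset.sum_mul, Finset.sum_mul]
  exact (Finset.abs_sum_le_sum_abs _ _).trans (Finset.sum_le_sum fun y hy => hε y hy δ hδ)

/-- No stationary input beats the chain of maximal entropy by more than `O(ε² log² ε)`: the gain is
at most `L x - d x²` for an input at distance `x`, with `L = O(ε log (1 / ε))`. -/
lemma exists_condEntropy_output_le (hp : IsParry S m t ρ p) (hS : IsLanguage S m) {n : ℕ}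
    (hn : m ≤ n) :
    ∃ C : ℝ, 0 ≤ C ∧ ∀ᶠ ε : ℝ in 𝓝[>] 0, ∀ q : List Bool → ℝ, IsStationaryOfLength (n + 1) q →
      allowedOfLength (n + 1) q ⊆ S →
      condEntropy (output ε q) n ≤
        condEntropy (output ε p) n + C * (ε ^ 2 * Real.log ε ^ 2) := by
  obtain ⟨c, hc, hdef⟩ := hp.exists_le_sum_defect_output hS n
  obtain ⟨K, hK0, hlin⟩ := hp.exists_abs_sum_mul_log_le hS hn
  set k : ℝ := ((transitions S n).card : ℝ) + 1 with hk
  have hk0 : 0 < k := by positivity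
  set d : ℝ := c ^ 2 / (4 * k) with hd
  have hd0 : 0 < d := by positivity
  refine ⟨K ^ 2 / (4 * d), by positivity, ?_⟩
  filter_upwards [hdef, hlin, Ioo_mem_nhdsGT (show (0 : ℝ) < 1 / 2 by norm_num)]
    with ε h1 h2 hε q hq hqS
  have hε0 := hε.1
  have hε1 : ε ≤ 1 := by linarith [hε.2]
  set δ : List Bool → ℝ := fun y => q y - p y with hδdef
  have hq0 : ∀ y : List Bool, y.length = n + 1 → y ∉ S → q y = 0 := fun y hy hyS =>
    le_antisymm (not_lt.1 fun h => hyS (hqS ⟨hy, h⟩)) (hq.nonneg y hy.le)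
  have hδ : IsPerturbation S n δ := by
    refine ⟨fun x hx => ?_, fun y hy hyS => ?_, ?_⟩
    · simp only [hδdef, Finset.sum_sub_distrib]
      rw [hq.sum_cons (by omega), hq.sum_snoc (by omega), hp.stationary.sum_cons,
        hp.stationary.sum_snoc]
    · simp only [hδdef]
      rw [hq0 y hy hyS, hp.eq_zero hyS, sub_zero]
    · simp only [hδdef, Finset.sum_sub_distrib]
      rw [hq.sum_words le_rfl, (hp.stationary (n + 1)).sum_words le_rfl, sub_self]
  have hPst := hq.output hε0.le hε1
  have hMst := hp.stationary.output hε0.le hε1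
  have hMpos : ∀ y, 0 < output ε p y := fun y =>
    (pow_pos hε0 _).trans_le (hp.pow_le_output hε0.le hε.2.le y)
  have hΔ : ∀ y, output ε q y = output ε p y + output ε δ y := fun y => by
    rw [output_sub]
    ring
  have h3 := condEntropy_le hPst (hMst (n + 1)) fun y _ hy => absurd hy (hMpos y).ne'
  have h4 : -∑ w ∈ words n, ∑ v : Bool, output ε q (w ++ [v]) *
      Real.log (output ε p (w ++ [v]) / output ε p w) = condEntropy (output ε p) n
      - ∑ w ∈ words n, ∑ v : Bool, output ε δ (w ++ [v]) *
        Real.log (output ε p (w ++ [v]) / output ε p w) := by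
    rw [BSC.condEntropy_eq]
    simp only [hΔ, add_mul, Finset.sum_add_distrib]
    ring
  have h5 : ∑ x ∈ transitions S n, defect (output ε p) (output ε δ) x ^ 2 ≤
      ∑ w ∈ words n, ∑ v : Bool, (output ε q (w ++ [v]) - output ε q w *
        (output ε p (w ++ [v]) / output ε p w)) ^ 2 := by
    classical
    rw [transitions, Finset.sum_product]
    refine (Finset.sum_le_sum_of_subset_of_nonneg (Finset.filter_subset _ _)
      fun w _ _ => Finset.sum_nonneg fun v _ => sq_nonneg _).trans_eq ?_
    refine Finset.sum_congr rfl fun w hw => Finset.sum_congr rfl fun v _ => ?_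
    have hw' := mem_words.1 hw
    have e1 : ∑ b : Bool, output ε δ (w ++ [b]) = output ε q w - output ε p w := by
      rw [← hPst.sum_snoc (by omega), ← hMst.sum_snoc w, ← Finset.sum_sub_distrib]
      exact Finset.sum_congr rfl fun b _ => by rw [hΔ]; ring
    have := (hMpos w).ne'
    congr 1
    simp only [defect]
    rw [e1, hΔ (w ++ [v])]
    field_simp
    ring
  set V := variation (n + 1) δ with hV
  have hV0 : 0 ≤ V := variation_nonneg _ _
  have h6 : 4 * d * V ^ 2 ≤ ∑ x ∈ transitions S n, defect (output ε p) (output ε δ) x ^ 2 := by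
    have i1 := sq_sum_le_card_mul_sum_sq (s := transitions S n)
      (f := fun x => |defect (output ε p) (output ε δ) x|)
    simp only [sq_abs] at i1
    have i2 : (c * V) ^ 2 ≤ (∑ x ∈ transitions S n, |defect (output ε p) (output ε δ) x|) ^ 2 :=
      pow_le_pow_left₀ (by positivity) (h1 δ hδ) 2
    have i3 : 0 ≤ ∑ x ∈ transitions S n, defect (output ε p) (output ε δ) x ^ 2 :=
      Finset.sum_nonneg fun x _ => sq_nonneg _
    have e : 4 * d * V ^ 2 = (c * V) ^ 2 / k := by
      rw [hd]
      field_simp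
    rw [e, div_le_iff₀ hk0, mul_comm, hk]
    linarith
  have h7 := neg_le_of_abs_le (h2 δ hδ)
  set L := K * (ε * Real.log (1 / ε)) with hL
  have h8 : L * V - d * V ^ 2 ≤ L ^ 2 / (4 * d) := by
    rw [le_div_iff₀ (by positivity)]
    nlinarith [sq_nonneg (L - 2 * d * V)]
  have e : L ^ 2 / (4 * d) = K ^ 2 / (4 * d) * (ε ^ 2 * Real.log ε ^ 2) := by
    rw [hL, one_div, Real.log_inv]
    ring
  rw [h4] at h3
  linarith

end IsParry

/-! ### Expansion of the entropy of the output -/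

lemma eventually_one_le_abs_log : ∀ᶠ ε : ℝ in 𝓝[>] 0, 1 ≤ |Real.log ε| := by
  filter_upwards [Ioo_mem_nhdsGT (Real.exp_pos (-1))] with ε hε
  have : Real.log ε ≤ -1 := by
    rw [← Real.log_exp (-1)]
    exact Real.log_le_log hε.1 hε.2.le
  rw [abs_of_neg (by linarith)]
  linarith

lemma isBigO_sq_mul_log :
    (fun ε : ℝ => ε ^ 2 * Real.log ε) =O[𝓝[>] 0] fun ε : ℝ => ε ^ 2 * Real.log ε ^ 2 := by
  refine IsBigO.of_bound 1 ?_
  filter_upwards [eventually_one_le_abs_log] with ε hε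
  rw [one_mul, norm_mul, norm_mul, norm_pow (Real.log ε), Real.norm_eq_abs (Real.log ε)]
  refine mul_le_mul_of_nonneg_left ?_ (norm_nonneg _)
  nlinarith

lemma isBigO_sq :
    (fun ε : ℝ => ε ^ 2) =O[𝓝[>] 0] fun ε : ℝ => ε ^ 2 * Real.log ε ^ 2 := by
  refine IsBigO.of_bound 1 ?_
  filter_upwards [eventually_one_le_abs_log] with ε hε
  rw [one_mul, norm_mul, norm_pow (Real.log ε), Real.norm_eq_abs (Real.log ε)]
  refine le_mul_of_one_le_right (norm_nonneg _) ?_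
  nlinarith

/-- The second order Taylor estimate for `- x log x`, from `log y ≤ y - 1` at `x / a` and
`a / x`. -/
lemma abs_negMulLog_sub_le {a x : ℝ} (ha : 0 < a) (hx : 0 < x) :
    |Real.negMulLog x - (Real.negMulLog a - (Real.log a + 1) * (x - a))| ≤ (x - a) ^ 2 / a := by
  have h1 : Real.log (x / a) ≤ x / a - 1 := Real.log_le_sub_one_of_pos (by positivity)
  have h2 : Real.log (a / x) ≤ a / x - 1 := Real.log_le_sub_one_of_pos (by positivity)
  rw [Real.log_div hx.ne' ha.ne'] at h1
  rw [Real.log_div ha.ne' hx.ne'] at h2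
  have h3 : x * (Real.log x - Real.log a) ≤ x ^ 2 / a - x := by
    calc _ ≤ x * (x / a - 1) := mul_le_mul_of_nonneg_left h1 hx.le
      _ = _ := by ring
  have h4 : x * (Real.log a - Real.log x) ≤ a - x := by
    calc _ ≤ x * (a / x - 1) := mul_le_mul_of_nonneg_left h2 hx.le
      _ = _ := by field_simp
  have e : (x - a) ^ 2 / a = x ^ 2 / a - 2 * x + a := by
    field_simp
    ring
  have h5 : 0 ≤ (x - a) ^ 2 / a := by positivity
  simp only [Real.negMulLog]
  rw [abs_le]
  constructor <;> nlinarith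

/-- The expansion of `- P log P` for a probability `P = a + h ε + O(ε²)`; the term
`ε log (1 / ε)` appears if `a = 0`. -/
lemma negMulLog_expansion {P : ℝ → ℝ} {a h : ℝ} (ha : 0 ≤ a) (hh : a = 0 → 0 ≤ h)
    (hP : ∀ᶠ ε in 𝓝[>] 0, 0 ≤ P ε)
    (hexp : (fun ε : ℝ => P ε - (a + h * ε)) =O[𝓝[>] 0] fun ε : ℝ => ε ^ 2) :
    (fun ε : ℝ => Real.negMulLog (P ε) - (Real.negMulLog a +
      (if a = 0 then h else 0) * (ε * Real.log (1 / ε)) +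
      (if a = 0 then Real.negMulLog h else -h * (Real.log a + 1)) * ε))
      =O[𝓝[>] 0] fun ε : ℝ => ε ^ 2 * Real.log ε ^ 2 := by
  have hid : Tendsto (fun ε : ℝ => ε) (𝓝[>] 0) (𝓝 0) := nhdsWithin_le_nhds
  have hpos : ∀ᶠ ε : ℝ in 𝓝[>] 0, 0 < ε := eventually_mem_nhdsWithin
  have hsq : (fun ε : ℝ => ε ^ 2) =O[𝓝[>] 0] fun ε : ℝ => ε :=
    (isLittleO_pow_id one_lt_two).isBigO.mono nhdsWithin_le_nhds
  rcases ha.eq_or_lt with rfl | ha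
  · simp only [if_true, Real.negMulLog_zero, zero_add]
    rcases (hh rfl).eq_or_lt with rfl | hh0
    · -- `0 ≤ P ≤ C ε²`
      simp only [zero_mul, add_zero, sub_zero, Real.negMulLog_zero] at hexp ⊢
      obtain ⟨C, hC0, hC⟩ := hexp.exists_pos
      obtain ⟨B, hB⟩ := (isCompact_Icc (a := (0 : ℝ)) (b := C)).exists_bound_of_continuousOn
        Real.continuous_negMulLog.continuousOn
      have hO : ((fun ε : ℝ => 2 * C * (ε ^ 2 * Real.log ε)) =O[𝓝[>] 0]
          fun ε : ℝ => ε ^ 2 * Real.log ε ^ 2) := isBigO_sq_mul_log.const_mul_left _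
      have hO2 : ((fun ε : ℝ => |2 * C * (ε ^ 2 * Real.log ε)| + B * ε ^ 2) =O[𝓝[>] 0]
          fun ε : ℝ => ε ^ 2 * Real.log ε ^ 2) := hO.abs_left.add (isBigO_sq.const_mul_left _)
      refine IsBigO.trans (IsBigO.of_bound 1 ?_) hO2
      filter_upwards [hC.bound, hP, hpos] with ε h1 h2 h3
      rw [Real.norm_eq_abs, Real.norm_eq_abs, abs_of_nonneg h2, abs_of_pos (by positivity)] at h1
      have e : P ε = ε ^ 2 * (P ε / ε ^ 2) := by field_simp
      have hk : P ε / ε ^ 2 ∈ Set.Icc 0 C :=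
        ⟨by positivity, (div_le_iff₀ (by positivity)).2 h1⟩
      have h4 := hB _ hk
      set k := P ε / ε ^ 2
      rw [one_mul, Real.norm_eq_abs, Real.norm_eq_abs, e, Real.negMulLog_mul]
      refine ((abs_add_le _ _).trans (add_le_add ?_ ?_)).trans (le_abs_self _)
      · have e2 : Real.negMulLog (ε ^ 2) = -(2 * (ε ^ 2 * Real.log ε)) := by
          rw [Real.negMulLog, Real.log_pow]
          push_cast
          ring
        rw [e2, abs_mul, abs_neg, abs_of_nonneg hk.1, abs_mul, abs_two, abs_mul (2 * C),
          abs_of_pos (show 0 < 2 * C by positivity), ← mul_assoc, mul_comm k]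
        exact mul_le_mul_of_nonneg_right (by linarith [hk.2]) (abs_nonneg _)
      · rw [abs_mul, abs_of_pos (by positivity : 0 < ε ^ 2), mul_comm B]
        exact mul_le_mul_of_nonneg_left h4 (by positivity)
    · -- `P = ε g` with `g → h > 0`
      have hg : (fun ε : ℝ => P ε / ε - h) =O[𝓝[>] 0] fun ε : ℝ => ε := by
        have h1 := hexp.mul (isBigO_refl (fun ε : ℝ => ε⁻¹) (𝓝[>] 0))
        refine h1.congr' ?_ ?_
        · filter_upwards [hpos] with ε hε
          field_simp
          ring
        · filter_upwards [hpos] with ε hε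
          field_simp
      have hgt : Tendsto (fun ε : ℝ => P ε / ε) (𝓝[>] 0) (𝓝 h) := by
        have := (hg.trans_tendsto hid).add_const h
        simpa using this
      have h1 : (fun ε : ℝ => Real.negMulLog (P ε / ε) - Real.negMulLog h)
          =O[𝓝[>] 0] fun ε : ℝ => ε :=
        ((Real.differentiableAt_negMulLog_iff.2 hh0.ne').isBigO_sub.comp_tendsto hgt).trans hg
      have h2 := (hg.mul (isBigO_refl (fun ε : ℝ => ε * Real.log ε) (𝓝[>] 0))).neg_left
      have h3 := (isBigO_refl (fun ε : ℝ => ε) (𝓝[>] 0)).mul h1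
      refine ((h2.trans ?_).add (h3.trans ?_)).congr' ?_ (EventuallyEq.refl _ _)
      · exact isBigO_sq_mul_log.congr_left fun ε => by ring
      · exact isBigO_sq.congr_left fun ε => by ring
      · filter_upwards [hpos] with ε hε
        have e : Real.negMulLog (P ε) =
            P ε / ε * Real.negMulLog ε + ε * Real.negMulLog (P ε / ε) := by
          rw [← Real.negMulLog_mul, mul_div_cancel₀ _ hε.ne']
        have e3 : Real.negMulLog ε = -(ε * Real.log ε) := by simp [Real.negMulLog]
        rw [e, e3, one_div, Real.log_inv]
        ring
  · simp only [if_neg ha.ne', zero_mul, add_zero]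
    have h1 : (fun ε : ℝ => P ε - a) =O[𝓝[>] 0] fun ε : ℝ => ε := by
      have := (hexp.trans hsq).add ((isBigO_refl (fun ε : ℝ => ε) (𝓝[>] 0)).const_mul_left h)
      exact this.congr_left fun ε => by ring
    have h2 : Tendsto P (𝓝[>] 0) (𝓝 a) := by
      have := (h1.trans_tendsto hid).add_const a
      simpa using this
    have h3 : (fun ε : ℝ => Real.negMulLog (P ε)
        - (Real.negMulLog a - (Real.log a + 1) * (P ε - a))) =O[𝓝[>] 0] fun ε : ℝ => ε ^ 2 := by
      refine IsBigO.trans (IsBigO.of_bound a⁻¹ ?_) (h1.pow 2)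
      filter_upwards [h2.eventually (lt_mem_nhds ha)] with ε hε
      refine (abs_negMulLog_sub_le ha hε).trans_eq ?_
      rw [norm_pow, Real.norm_eq_abs, sq_abs]
      ring
    have h4 := (h3.sub (hexp.const_mul_left (Real.log a + 1))).trans isBigO_sq
    exact h4.congr_left fun ε => by ring

/-- The law of a block whose first `s` letters are transmitted without error. -/
noncomputable def partialOutput (s : ℕ) (ε : ℝ) (p : List Bool → ℝ) (u : List Bool) : ℝ :=
  output ε (fun x => p (u.take s ++ x)) (u.drop s)

/-- The derivative of `partialOutput s` at `ε = 0`. -/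
noncomputable def partialFlipSum (s : ℕ) (p : List Bool → ℝ) (u : List Bool) : ℝ :=
  flipSum (fun x => p (u.take s ++ x)) (u.drop s)

lemma partialOutput_zero (ε : ℝ) (p : List Bool → ℝ) (u : List Bool) :
    partialOutput 0 ε p u = output ε p u := by
  simp [partialOutput]

lemma partialFlipSum_zero (p : List Bool → ℝ) (u : List Bool) :
    partialFlipSum 0 p u = flipSum p u := by
  simp [partialFlipSum]

lemma partialOutput_append {s : ℕ} (ε : ℝ) (p : List Bool → ℝ) {c : List Bool} (z : List Bool)
    (hc : c.length = s) : partialOutput s ε p (c ++ z) = output ε (fun x => p (c ++ x)) z := by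
  subst hc
  simp [partialOutput]

lemma modify_append_of_lt {i : ℕ} (f : Bool → Bool) {a : List Bool} (b : List Bool)
    (hi : i < a.length) : (a ++ b).modify i f = a.modify i f ++ b := by
  induction a generalizing i with
  | nil => simp at hi
  | cons c a ih =>
    cases i with
    | zero => simp
    | succ i => simp [ih (by simpa using hi)]

lemma modify_append_length_add (i : ℕ) (f : Bool → Bool) (a b : List Bool) :
    (a ++ b).modify (a.length + i) f = a ++ b.modify i f := by
  induction a with
  | nil => simp
  | cons c a ih =>
    rw [List.cons_append, List.length_cons, add_right_comm, List.modify_succ_cons, ih,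
      List.cons_append]

lemma partialFlipSum_eq {s : ℕ} (p : List Bool → ℝ) {u : List Bool} (hs : s ≤ u.length) :
    partialFlipSum s p u =
      ∑ i ∈ Finset.Ico s u.length, p (u.modify i not) - ((u.length - s : ℕ) : ℝ) * p u := by
  rw [partialFlipSum, flipSum, List.length_drop, Finset.sum_Ico_eq_sum_range,
    List.take_append_drop]
  congr 1
  refine Finset.sum_congr rfl fun i _ => ?_
  conv_rhs => rw [← List.take_append_drop s u]
  have hl : (u.take s).length = s := by simp [hs]
  have := modify_append_length_add i not (u.take s) (u.drop s)
  rw [hl] at this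
  rw [this]

lemma sum_partialOutput_snoc {s : ℕ} {ε : ℝ} {p : List Bool → ℝ} (hp : IsStationary p)
    {w : List Bool} (hs : s ≤ w.length) :
    ∑ b : Bool, partialOutput s ε p (w ++ [b]) = partialOutput s ε p w := by
  simp only [partialOutput, List.take_append_of_le_length hs, List.drop_append_of_le_length hs]
  rw [sum_output_snoc]
  refine output_congr fun x _ => ?_
  simp only [← List.append_assoc]
  exact hp.sum_snoc _

lemma sum_partialFlipSum_snoc {s : ℕ} {p : List Bool → ℝ} (hp : IsStationary p)
    {w : List Bool} (hs : s ≤ w.length) :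
    ∑ b : Bool, partialFlipSum s p (w ++ [b]) = partialFlipSum s p w := by
  have h1 : ∀ b : Bool, partialFlipSum s p (w ++ [b]) =
      ∑ i ∈ Finset.Ico s w.length, p (w.modify i not ++ [b]) + p (w ++ [!b])
        - ((w.length - s : ℕ) + 1 : ℝ) * p (w ++ [b]) := by
    intro b
    rw [partialFlipSum_eq p (by simp; omega), List.length_append, List.length_singleton,
      Finset.sum_Ico_succ_top hs, Nat.sub_add_comm hs]
    have e : (w ++ [b]).modify w.length not = w ++ [!b] :=
      modify_append_length_add 0 not w [b]
    rw [e, Nat.cast_succ, Finset.sum_congr rfl fun i hi => by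
      rw [modify_append_of_lt not [b] (Finset.mem_Ico.1 hi).2]]
  rw [Finset.sum_congr rfl fun b _ => h1 b, Finset.sum_sub_distrib, Finset.sum_add_distrib,
    Finset.sum_comm, ← Finset.mul_sum, hp.sum_snoc, partialFlipSum_eq p hs,
    Finset.sum_congr rfl fun i _ => hp.sum_snoc _]
  have h2 : ∑ b : Bool, p (w ++ [!b]) = p w := by
    rw [← hp.sum_snoc w, Fintype.sum_bool, Fintype.sum_bool, add_comm]
    rfl
  rw [h2]
  ring

lemma partialOutput_nonneg {s : ℕ} {ε : ℝ} (h0 : 0 ≤ ε) (h1 : ε ≤ 1) {p : List Bool → ℝ}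
    (hp : IsStationary p) (u : List Bool) : 0 ≤ partialOutput s ε p u :=
  output_nonneg h0 h1 fun _ _ => hp.nonneg _

/-- The conditional entropy of the last of `n + 1` letters given the others, when the first `s`
letters are transmitted without error. -/
noncomputable def partialCondEntropy (s : ℕ) (ε : ℝ) (p : List Bool → ℝ) (n : ℕ) : ℝ :=
  ∑ u ∈ words (n + 1), Real.negMulLog (partialOutput s ε p u)
    - ∑ w ∈ words n, Real.negMulLog (partialOutput s ε p w)

lemma partialCondEntropy_eq_ent2 {s n : ℕ} {ε : ℝ} {p : List Bool → ℝ} (hp : IsStationary p)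
    (hs : s ≤ n) : partialCondEntropy s ε p n =
      ∑ w ∈ words n, ent2 (partialOutput s ε p (w ++ [false]))
        (partialOutput s ε p (w ++ [true])) := by
  rw [partialCondEntropy, sum_words_snoc, ← Finset.sum_sub_distrib]
  refine Finset.sum_congr rfl fun w hw => ?_
  rw [ent2, ← sum_partialOutput_snoc hp (by rw [mem_words.1 hw]; exact hs), Fintype.sum_bool,
    Fintype.sum_bool, add_comm (Real.negMulLog (partialOutput s ε p (w ++ [true]))),
    add_comm (partialOutput s ε p (w ++ [true]))]

open Classical in
/-- The coefficient of `ε log (1 / ε)` in `- P log P`, where `P = partialOutput s ε p u`. -/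
noncomputable def blockF (S : Set (List Bool)) (s : ℕ) (p : List Bool → ℝ) (u : List Bool) : ℝ :=
  if u ∈ S then 0 else partialFlipSum s p u

open Classical in
/-- The coefficient of `ε` in `- P log P`, where `P = partialOutput s ε p u`. -/
noncomputable def blockG (S : Set (List Bool)) (s : ℕ) (p : List Bool → ℝ) (u : List Bool) : ℝ :=
  if u ∈ S then -partialFlipSum s p u * (Real.log (p u) + 1)
  else Real.negMulLog (partialFlipSum s p u)

/-- The coefficient of `ε log (1 / ε)` in `partialCondEntropy`. -/
noncomputable def condF (S : Set (List Bool)) (s : ℕ) (p : List Bool → ℝ) (n : ℕ) : ℝ :=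
  ∑ u ∈ words (n + 1), blockF S s p u - ∑ w ∈ words n, blockF S s p w

/-- The coefficient of `ε` in `partialCondEntropy`. -/
noncomputable def condG (S : Set (List Bool)) (s : ℕ) (p : List Bool → ℝ) (n : ℕ) : ℝ :=
  ∑ u ∈ words (n + 1), blockG S s p u - ∑ w ∈ words n, blockG S s p w

namespace IsParry

variable {S : Set (List Bool)} {m : ℕ} {t : ℝ} {ρ p : List Bool → ℝ}

lemma partialFlipSum_nonneg (hp : IsParry S m t ρ p) {s : ℕ} {u : List Bool} (hs : s ≤ u.length)
    (hu : u ∉ S) : 0 ≤ partialFlipSum s p u := by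
  rw [partialFlipSum_eq p hs, hp.eq_zero hu, mul_zero, sub_zero]
  exact Finset.sum_nonneg fun i _ => hp.stationary.nonneg _

lemma negMulLog_partialOutput (hp : IsParry S m t ρ p) {s : ℕ} {u : List Bool}
    (hs : s ≤ u.length) :
    (fun ε : ℝ => Real.negMulLog (partialOutput s ε p u) - (Real.negMulLog (p u) +
      blockF S s p u * (ε * Real.log (1 / ε)) + blockG S s p u * ε))
      =O[𝓝[>] 0] fun ε : ℝ => ε ^ 2 * Real.log ε ^ 2 := by
  have h1 := output_expansion (fun x => p (u.take s ++ x)) (u.drop s)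
  simp only [List.take_append_drop] at h1
  have hu : p u = 0 ↔ u ∉ S := by
    rw [← hp.pos_iff]
    exact ⟨fun h => by simp [h], fun h => le_antisymm (not_lt.1 h) (hp.stationary.nonneg u)⟩
  refine (negMulLog_expansion (hp.stationary.nonneg u)
    (fun h => hp.partialFlipSum_nonneg hs (hu.1 h)) ?_ h1).congr_left fun ε => ?_
  · filter_upwards [Ioo_mem_nhdsGT (show (0 : ℝ) < 1 by norm_num)] with ε hε
    exact partialOutput_nonneg hε.1.le hε.2.le hp.stationary u
  · by_cases h : u ∈ S
    · simp only [blockF, blockG, h, if_true, hu, not_true, if_false]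
      rfl
    · simp only [blockF, blockG, h, if_false, hu, not_false_eq_true, if_true]
      rfl

lemma partialCondEntropy_expansion (hp : IsParry S m t ρ p) {s n : ℕ} (hs : s ≤ n) (hn : m ≤ n) :
    (fun ε : ℝ => partialCondEntropy s ε p n - (Real.log t +
      condF S s p n * (ε * Real.log (1 / ε)) + condG S s p n * ε))
      =O[𝓝[>] 0] fun ε : ℝ => ε ^ 2 * Real.log ε ^ 2 := by
  have h : ∀ k, s ≤ k → (fun ε : ℝ => ∑ u ∈ words k, (Real.negMulLog (partialOutput s ε p u) -
      (Real.negMulLog (p u) + blockF S s p u * (ε * Real.log (1 / ε)) + blockG S s p u * ε)))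
      =O[𝓝[>] 0] fun ε : ℝ => ε ^ 2 * Real.log ε ^ 2 := fun k hk =>
    IsBigO.fun_sum fun u hu => hp.negMulLog_partialOutput (by rw [mem_words.1 hu]; exact hk)
  refine ((h (n + 1) (by omega)).sub (h n hs)).congr_left fun ε => ?_
  have h3 := hp.condEntropy_eq hn
  rw [(hp.stationary (n + 1)).condEntropy_eq_sub (Nat.lt_succ_self n)] at h3
  simp only [Finset.sum_sub_distrib, Finset.sum_add_distrib, ← Finset.sum_mul]
  rw [partialCondEntropy, condF, condG, ← h3]
  ring

end IsParry

/-! ### The coefficients of the expansion -/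

lemma IsLanguage.modify_notMem_of_lt {S : Set (List Bool)} {m : ℕ} (hS : IsLanguage S m)
    {a b : List Bool} (hb : b ∉ S) {i : ℕ} (hi : i < a.length) :
    (a ++ b).modify i not ∉ S := by
  rw [modify_append_of_lt not b hi]
  exact fun h => hb (hS.of_append_right h)

lemma IsLanguage.modify_notMem_of_le {S : Set (List Bool)} {m : ℕ} (hS : IsLanguage S m)
    {a b : List Bool} (ha : a ∉ S) {i : ℕ} (hi : a.length ≤ i) :
    (a ++ b).modify i not ∉ S := by
  obtain ⟨j, rfl⟩ := Nat.exists_eq_add_of_le hi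
  rw [modify_append_length_add]
  exact fun h => ha (hS.of_append_left h)

lemma lastWord_modify {m i : ℕ} {w : List Bool} (h : i + m < w.length) :
    lastWord m (w.modify i not) = lastWord m w := by
  have hl := length_lastWord (m := m) (w := w) (by omega)
  conv_lhs => rw [eq_append_lastWord m w]
  rw [modify_append_of_lt not _ (by simp; omega), lastWord_append _ hl.ge, lastWord_self hl]

/-- If `w ∈ S` but `w b ∉ S`, the last `m + 1` letters of `w b` are to blame, so that a flip at an
earlier position leaves `w b` outside `S`. -/
lemma IsLanguage.modify_snoc_notMem {S : Set (List Bool)} {m : ℕ} (hS : IsLanguage S m)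
    {w : List Bool} {b : Bool} (hw : w ∈ S) (hwb : w ++ [b] ∉ S) {i : ℕ}
    (hi : i + m < w.length) : (w ++ [b]).modify i not ∉ S := by
  rw [modify_append_of_lt not _ (by omega)]
  intro h
  rw [hS.append_mem_iff_lastWord (by simp; omega), lastWord_modify hi] at h
  exact hwb ((hS.append_mem_iff_lastWord (by omega)).2 ⟨hw, h.2⟩)

lemma partialFlipSum_eq_add {s : ℕ} (p : List Bool → ℝ) {u : List Bool} (hs : s ≤ u.length) :
    partialFlipSum 0 p u = partialFlipSum s p u +
      ∑ i ∈ Finset.range s, (p (u.modify i not) - p u) := by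
  rw [partialFlipSum_eq p (Nat.zero_le _), partialFlipSum_eq p hs, Finset.sum_sub_distrib,
    Nat.Ico_zero_eq_range, ← Finset.sum_range_add_sum_Ico _ hs, Finset.sum_const, Finset.card_range,
    nsmul_eq_mul, Nat.cast_sub hs, Nat.sub_zero]
  ring

namespace IsParry

variable {S : Set (List Bool)} {m : ℕ} {t : ℝ} {ρ p : List Bool → ℝ}

open Classical in
lemma condF_eq (hp : IsParry S m t ρ p) (hS : IsLanguage S m) {s n : ℕ} (hs : s ≤ n) :
    condF S s p n = ∑ w ∈ words n, ∑ v : Bool,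
      if w ∈ S ∧ w ++ [v] ∉ S then partialFlipSum s p (w ++ [v]) else 0 := by
  rw [condF, sum_words_snoc, ← Finset.sum_sub_distrib]
  refine Finset.sum_congr rfl fun w hw => ?_
  by_cases hwS : w ∈ S
  · simp only [blockF, hwS, if_true, sub_zero, true_and]
    exact Finset.sum_congr rfl fun v _ => by by_cases h : w ++ [v] ∈ S <;> simp [h]
  · have h : ∀ v : Bool, w ++ [v] ∉ S := fun v h => hwS (hS.of_append_left h)
    simp only [blockF, hwS, h, if_false, false_and, Finset.sum_const_zero]
    rw [sum_partialFlipSum_snoc hp.stationary (by rw [mem_words.1 hw]; exact hs), sub_self]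

lemma fCoeff_eq (hp : IsParry S m t ρ p) (hS : IsLanguage S m) (n : ℕ) :
    fCoeff n p = condF S 0 p n := by
  classical
  rw [hp.condF_eq hS (Nat.zero_le n), fCoeff, hp.allowed_eq]
  simp only [partialFlipSum_zero]
  exact sum_ofFn n fun w => ∑ v : Bool,
    if w ∈ S ∧ w ++ [v] ∉ S then flipSum p (w ++ [v]) else 0

/-- Errors more than `m` letters before the end do not contribute to the coefficient of
`ε log (1 / ε)`. -/
lemma condF_eq_condF_zero (hp : IsParry S m t ρ p) (hS : IsLanguage S m) {s n : ℕ} (hs : s + m ≤ n) :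
    condF S s p n = condF S 0 p n := by
  classical
  rw [hp.condF_eq hS (by omega), hp.condF_eq hS (Nat.zero_le n)]
  refine Finset.sum_congr rfl fun w hw => Finset.sum_congr rfl fun v _ => ?_
  have hwl := mem_words.1 hw
  split_ifs with h
  · rw [partialFlipSum_eq_add (s := s) p (by simp; omega), Finset.sum_eq_zero, add_zero]
    intro i hi
    rw [hp.eq_zero h.2, hp.eq_zero (hS.modify_snoc_notMem h.1 h.2 (by
      have := Finset.mem_range.1 hi; omega)), sub_zero]
  · rfl

lemma condF_succ (hp : IsParry S m t ρ p) (hS : IsLanguage S m) {n : ℕ} (hn : 2 * m ≤ n) :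
    condF S 0 p (n + 1) = condF S 0 p n := by
  classical
  rw [← hp.condF_eq_condF_zero hS (s := 1) (n := n + 1) (by omega), hp.condF_eq hS (by omega),
    hp.condF_eq hS (Nat.zero_le n), sum_words_cons, Finset.sum_comm]
  refine Finset.sum_congr rfl fun w hw => ?_
  have hwl := mem_words.1 hw
  rw [Finset.sum_comm]
  refine Finset.sum_congr rfl fun v _ => ?_
  have hfs : ∀ a : Bool, partialFlipSum 1 p (a :: w ++ [v]) =
      flipSum (fun x => p (a :: x)) (w ++ [v]) := fun a => by simp [partialFlipSum]
  by_cases h : w ∈ S ∧ w ++ [v] ∉ S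
  · have key : ∀ a : Bool, (if a :: w ∈ S ∧ a :: w ++ [v] ∉ S then
        partialFlipSum 1 p (a :: w ++ [v]) else 0) =
        flipSum (fun x => p (a :: x)) (w ++ [v]) := by
      intro a
      have h2 : a :: w ++ [v] ∉ S := fun h' => h.2 (hS.of_append_right (u := [a]) (by simpa using h'))
      rw [← hfs]
      by_cases h1 : a :: w ∈ S
      · rw [if_pos ⟨h1, h2⟩]
      · -- `a :: w` is already bad in its first `m + 1` letters, `w ++ [v]` in its last `m + 1`
        rw [if_neg fun h' => h1 h'.1, partialFlipSum_eq p (by simp), hp.eq_zero h2, mul_zero,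
          sub_zero]
        symm
        refine Finset.sum_eq_zero fun i hi => hp.eq_zero ?_
        obtain ⟨j, rfl⟩ := Nat.exists_eq_add_of_le (Finset.mem_Ico.1 hi).1
        rcases Nat.lt_or_ge (j + m) w.length with hj | hj
        · rw [add_comm, List.cons_append, List.modify_succ_cons]
          exact fun h' => hS.modify_snoc_notMem h.1 h.2 hj
            (hS.of_append_right (u := [_]) (by simpa using h'))
        · have hb : a :: w.take m ∉ S := fun h' =>
            h1 ((hS.cons_mem_iff_take (by omega)).2 ⟨h.1, h'⟩)
          have e : a :: w ++ [v] = (a :: w.take m) ++ (w.drop m ++ [v]) := by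
            rw [List.cons_append, List.cons_append, ← List.append_assoc, List.take_append_drop]
          rw [e]
          exact hS.modify_notMem_of_le hb (by simp; omega)
    rw [Finset.sum_congr rfl fun a _ => key a, if_pos h, partialFlipSum_zero]
    simp only [flipSum, Finset.sum_sub_distrib, ← Finset.mul_sum]
    rw [Finset.sum_comm, hp.stationary.sum_cons,
      Finset.sum_congr rfl fun i _ => hp.stationary.sum_cons _]
  · rw [if_neg h]
    refine Finset.sum_eq_zero fun a _ => if_neg ?_
    rintro ⟨h1, h2⟩
    refine h ⟨hS.of_append_right (u := [a]) (by simpa using h1), fun h3 => h2 ?_⟩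
    exact hS.glue_cons (by omega) h1 h3

lemma condF_eq_two_mul (hp : IsParry S m t ρ p) (hS : IsLanguage S m) {n : ℕ} (hn : 2 * m ≤ n) :
    condF S 0 p n = condF S 0 p (2 * m) := by
  induction n, hn using Nat.le_induction with
  | base => rfl
  | succ n hn ih => rw [hp.condF_succ hS hn, ih]

lemma outputThetaEps_iff (hp : IsParry S m t ρ p) (w : List Bool) :
    OutputThetaEps p w ↔ w ∉ S ∧ 0 < flipSum p w := by
  have hexp := output_expansion p w
  have hid : Tendsto (fun ε : ℝ => ε) (𝓝[>] 0) (𝓝 0) := nhdsWithin_le_nhds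
  have hsq : (fun ε : ℝ => ε ^ 2) =o[𝓝[>] 0] fun ε : ℝ => ε :=
    (isLittleO_pow_id one_lt_two).mono nhdsWithin_le_nhds
  constructor
  · intro h
    have hwS : w ∉ S := by
      intro hwS
      have h1 : Tendsto (fun ε => output ε p w) (𝓝[>] 0) (𝓝 0) := h.1.trans_tendsto hid
      have h2 := ((hp.output_sub_isBigO w).trans_tendsto hid).add_const (p w)
      simp only [sub_add_cancel, zero_add] at h2
      exact (hp.pos hwS).ne' (tendsto_nhds_unique h2 h1)
    refine ⟨hwS, ?_⟩
    have h0 := hp.partialFlipSum_nonneg (Nat.zero_le _) hwS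
    rw [partialFlipSum_zero] at h0
    refine h0.lt_of_ne fun h1 => ?_
    rw [hp.eq_zero hwS, ← h1] at hexp
    simp only [zero_mul, add_zero, sub_zero] at hexp
    have h2 : (fun ε : ℝ => ε) =o[𝓝[>] 0] fun ε : ℝ => ε := (h.2.trans hexp).trans_isLittleO hsq
    have h3 := h2.bound (show (0 : ℝ) < 1 / 2 by norm_num)
    obtain ⟨ε, h4, h5⟩ := (h3.and (eventually_mem_nhdsWithin (a := (0 : ℝ)) (s := Set.Ioi 0))).exists
    have h5' : (0 : ℝ) < ε := h5
    rw [Real.norm_eq_abs, abs_of_pos h5'] at h4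
    linarith
  · rintro ⟨hwS, h0⟩
    rw [hp.eq_zero hwS] at hexp
    simp only [zero_add] at hexp
    have h1 : (fun ε : ℝ => flipSum p w * ε) =Θ[𝓝[>] 0] fun ε : ℝ => ε :=
      (isTheta_const_mul_left h0.ne').2 (isTheta_refl _ _)
    have h2 : IsEquivalent (𝓝[>] 0) (fun ε => output ε p w) (fun ε : ℝ => flipSum p w * ε) :=
      (hexp.trans_isLittleO hsq).trans_isTheta h1.symm
    exact h2.isTheta.trans h1

lemma gCoeff_eq (hp : IsParry S m t ρ p) (hS : IsLanguage S m) (n : ℕ) :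
    gCoeff n p = condG S 0 p n := by
  classical
  have hconv : ∀ f : List Bool → Bool → ℝ,
      ∑ w : Fin n → Bool, ∑ v : Bool, f (List.ofFn w) v = ∑ w ∈ words n, ∑ v : Bool, f w v :=
    fun f => sum_ofFn n fun w => ∑ v : Bool, f w v
  rw [gCoeff, hp.allowed_eq]
  simp only [hp.outputThetaEps_iff]
  rw [hconv fun w v => if w ++ [v] ∈ S then flipSum p (w ++ [v]) * Real.log (p (w ++ [v]) / p w)
        + (flipSum p (w ++ [v]) * p w - flipSum p w * p (w ++ [v])) / p w else 0,
    hconv fun w v => if w ∈ S ∧ w ++ [v] ∉ S then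
      flipSum p (w ++ [v]) * Real.log (flipSum p (w ++ [v]) / p w) else 0,
    hconv fun w v => if (w ∉ S ∧ 0 < flipSum p w) ∧ w ++ [v] ∉ S ∧ 0 < flipSum p (w ++ [v]) then
      flipSum p (w ++ [v]) * Real.log (flipSum p (w ++ [v]) / flipSum p w) else 0,
    condG, sum_words_snoc, ← Finset.sum_neg_distrib, ← Finset.sum_sub_distrib,
    ← Finset.sum_sub_distrib, ← Finset.sum_sub_distrib]
  refine Finset.sum_congr rfl fun w hw => ?_
  have hsum : ∑ v : Bool, flipSum p (w ++ [v]) = flipSum p w := by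
    simpa only [partialFlipSum_zero] using
      sum_partialFlipSum_snoc hp.stationary (s := 0) (w := w) (Nat.zero_le _)
  have hnn : ∀ u ∉ S, 0 ≤ flipSum p u := fun u hu => by
    simpa only [partialFlipSum_zero] using hp.partialFlipSum_nonneg (Nat.zero_le _) hu
  rw [← Finset.sum_neg_distrib, ← Finset.sum_sub_distrib, ← Finset.sum_sub_distrib]
  by_cases hwS : w ∈ S
  · have hpw := hp.pos hwS
    have key : ∀ v : Bool,
        (-(if w ++ [v] ∈ S then flipSum p (w ++ [v]) * Real.log (p (w ++ [v]) / p w)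
          + (flipSum p (w ++ [v]) * p w - flipSum p w * p (w ++ [v])) / p w else 0)
        - (if w ∈ S ∧ w ++ [v] ∉ S then
          flipSum p (w ++ [v]) * Real.log (flipSum p (w ++ [v]) / p w) else 0)
        - (if (w ∉ S ∧ 0 < flipSum p w) ∧ w ++ [v] ∉ S ∧ 0 < flipSum p (w ++ [v]) then
          flipSum p (w ++ [v]) * Real.log (flipSum p (w ++ [v]) / flipSum p w) else 0))
        = blockG S 0 p (w ++ [v]) + flipSum p (w ++ [v]) * Real.log (p w)
          + flipSum p w * (p (w ++ [v]) / p w) := by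
      intro v
      simp only [blockG, partialFlipSum_zero]
      by_cases h : w ++ [v] ∈ S
      · simp only [h, hwS, if_true, not_true, and_false, false_and, if_false]
        rw [Real.log_div (hp.pos h).ne' hpw.ne']
        field_simp
        ring
      · simp only [h, hwS, if_false, not_true, not_false_eq_true, and_self, if_true, false_and,
          hp.eq_zero h]
        rcases (hnn _ h).eq_or_lt with h0 | h0
        · simp [← h0]
        · rw [Real.log_div h0.ne' hpw.ne', Real.negMulLog]
          ring
    rw [Finset.sum_congr rfl fun v _ => key v, Finset.sum_add_distrib, Finset.sum_add_distrib,
      ← Finset.sum_mul, ← Finset.mul_sum, ← Finset.sum_div, hp.stationary.sum_snoc, hsum,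
      div_self hpw.ne']
    simp only [blockG, partialFlipSum_zero, hwS, if_true]
    ring
  · have key : ∀ v : Bool,
        (-(if w ++ [v] ∈ S then flipSum p (w ++ [v]) * Real.log (p (w ++ [v]) / p w)
          + (flipSum p (w ++ [v]) * p w - flipSum p w * p (w ++ [v])) / p w else 0)
        - (if w ∈ S ∧ w ++ [v] ∉ S then
          flipSum p (w ++ [v]) * Real.log (flipSum p (w ++ [v]) / p w) else 0)
        - (if (w ∉ S ∧ 0 < flipSum p w) ∧ w ++ [v] ∉ S ∧ 0 < flipSum p (w ++ [v]) then
          flipSum p (w ++ [v]) * Real.log (flipSum p (w ++ [v]) / flipSum p w) else 0))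
        = blockG S 0 p (w ++ [v]) + flipSum p (w ++ [v]) * Real.log (flipSum p w) := by
      intro v
      have h : w ++ [v] ∉ S := fun h => hwS (hS.of_append_left h)
      have hle : flipSum p (w ++ [v]) ≤ flipSum p w := by
        rw [← hsum]
        exact Finset.single_le_sum (f := fun v => flipSum p (w ++ [v]))
          (fun b _ => hnn _ fun h => hwS (hS.of_append_left h)) (Finset.mem_univ v)
      simp only [blockG, partialFlipSum_zero, h, hwS, if_false, false_and, not_false_eq_true,
        true_and]
      rcases (hnn _ h).eq_or_lt with h0 | h0
      · simp [← h0]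
      · rw [if_pos ⟨h0.trans_le hle, h0⟩, Real.log_div h0.ne' (h0.trans_le hle).ne',
          Real.negMulLog]
        ring
    rw [Finset.sum_congr rfl fun v _ => key v, Finset.sum_add_distrib, ← Finset.sum_mul, hsum]
    simp only [blockG, partialFlipSum_zero, hwS, if_false, Real.negMulLog]
    ring

/-- The Markov property in terms of the last `m` letters; both sides vanish if `p w = 0`. -/
lemma snoc_eq (hp : IsParry S m t ρ p) (hS : IsLanguage S m) {w : List Bool} (hw : m ≤ w.length)
    (v : Bool) : p (w ++ [v]) = p w * (p (lastWord m w ++ [v]) / p (lastWord m w)) := by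
  by_cases hwS : w ∈ S
  · have h := hp.markov (w.take (w.length - m)) (lastWord m w) v (length_lastWord hw).ge
    rw [← eq_append_lastWord] at h
    have h0 := (hp.pos (hS.infix_mem hwS (lastWord_suffix m w).isInfix)).ne'
    rw [mul_div_assoc', eq_div_iff h0, h]
  · rw [hp.eq_zero hwS, hp.eq_zero fun h => hwS (hS.of_append_left h), zero_mul]

/-- If an error in the first `2 m` letters of `w` has been detected, the next letter is distributed
according to the transition probabilities, as the last `m` letters of `w` are free of errors. -/
lemma partialFlipSum_snoc_eq (hp : IsParry S m t ρ p) (hS : IsLanguage S m) {s : ℕ}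
    {w : List Bool} (hw : w.length = 3 * m) (hs : s ≤ 3 * m) (hwS : w.take (2 * m) ∉ S)
    (v : Bool) : partialFlipSum s p (w ++ [v]) =
      partialFlipSum s p w * (p (lastWord m w ++ [v]) / p (lastWord m w)) := by
  have h1 : w ∉ S := fun h => hwS (hS.infix_mem h (List.take_prefix _ _).isInfix)
  have h2 : w ++ [v] ∉ S := fun h => h1 (hS.of_append_left h)
  have hlate : ∀ (x : List Bool) (i : ℕ), 2 * m ≤ i → p ((w ++ x).modify i not) = 0 := by
    intro x i hi
    refine hp.eq_zero ?_
    have e : w ++ x = w.take (2 * m) ++ (w.drop (2 * m) ++ x) := by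
      rw [← List.append_assoc, List.take_append_drop]
    rw [e]
    exact hS.modify_notMem_of_le hwS (by simp; omega)
  rw [partialFlipSum_eq p (by simp; omega), partialFlipSum_eq p (by omega), hp.eq_zero h1,
    hp.eq_zero h2, mul_zero, mul_zero, sub_zero, sub_zero, List.length_append,
    List.length_singleton, Finset.sum_Ico_succ_top (by omega), hlate [v] w.length (by omega),
    add_zero, Finset.sum_mul]
  refine Finset.sum_congr rfl fun i hi => ?_
  have hi' := (Finset.mem_Ico.1 hi).2
  rcases Nat.lt_or_ge i (2 * m) with h | h
  · rw [modify_append_of_lt not _ hi', hp.snoc_eq hS (by simp; omega), lastWord_modify (by omega)]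
  · have := hlate [] i h
    rw [List.append_nil] at this
    rw [hlate [v] i h, this, zero_mul]

/-- Errors in the first `m` of `3 m + 1` letters do not contribute to the coefficient of `ε`: either
they change nothing but a context that has been forgotten, or they are detected, and known to be
over, before the last `m` letters.  In both cases their contribution is linear in the
probabilities, and cancels when a flip is undone. -/
lemma condG_eq_condG_zero (hp : IsParry S m t ρ p) (hS : IsLanguage S m) :
    condG S m p (3 * m) = condG S 0 p (3 * m) := by
  classical
  set c : List Bool → Bool → ℝ := fun w v =>
    Real.log (p (lastWord m w ++ [v]) / p (lastWord m w)) with hc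
  set k : List Bool → ℝ := fun u => ∑ i ∈ Finset.range m, (p (u.modify i not) - p u) with hk
  have hadd : ∀ u : List Bool, m ≤ u.length →
      partialFlipSum 0 p u = partialFlipSum m p u + k u := fun u hu => partialFlipSum_eq_add p hu
  have hsumk : ∀ w : List Bool, m ≤ w.length → ∑ v : Bool, k (w ++ [v]) = k w := by
    intro w hw
    have h1 := sum_partialFlipSum_snoc hp.stationary (s := 0) (w := w) (Nat.zero_le _)
    have h2 := sum_partialFlipSum_snoc hp.stationary (s := m) (w := w) hw
    rw [Finset.sum_congr rfl fun v _ => hadd (w ++ [v]) (by simp; omega),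
      Finset.sum_add_distrib, h2, hadd w hw] at h1
    linarith
  have key : ∀ w ∈ words (3 * m),
      (∑ v : Bool, blockG S 0 p (w ++ [v]) - blockG S 0 p w)
        - (∑ v : Bool, blockG S m p (w ++ [v]) - blockG S m p w)
      = -∑ v : Bool, k (w ++ [v]) * c w v := by
    intro w hw
    have hwl := mem_words.1 hw
    have hwm : m ≤ w.length := by omega
    by_cases hwS : w ∈ S
    · have hpw := hp.pos hwS
      have e : ∀ v : Bool, blockG S 0 p (w ++ [v]) - blockG S m p (w ++ [v]) =
          -(k (w ++ [v]) * c w v) - k (w ++ [v]) * (Real.log (p w) + 1) := by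
        intro v
        by_cases h : w ++ [v] ∈ S
        · have hcv : c w v = Real.log (p (w ++ [v])) - Real.log (p w) := by
            rw [← Real.log_div (hp.pos h).ne' hpw.ne', hc, hp.snoc_eq hS hwm v,
              mul_div_cancel_left₀ _ hpw.ne']
          simp only [blockG, h, if_true]
          rw [hadd _ (by simp; omega), hcv]
          ring
        · have hk0 : k (w ++ [v]) = 0 := Finset.sum_eq_zero fun i hi => by
            have := Finset.mem_range.1 hi
            rw [hp.eq_zero h, hp.eq_zero (hS.modify_snoc_notMem hwS h (by omega)), sub_zero]
          simp only [blockG, h, if_false]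
          rw [hadd _ (by simp; omega), hk0]
          simp
      have e2 : blockG S 0 p w - blockG S m p w = -(k w * (Real.log (p w) + 1)) := by
        simp only [blockG, hwS, if_true]
        rw [hadd _ hwm]
        ring
      have e3 := Finset.sum_congr (rfl : (Finset.univ : Finset Bool) = _) fun v _ => e v
      rw [Finset.sum_sub_distrib, Finset.sum_sub_distrib, Finset.sum_neg_distrib, ← Finset.sum_mul,
        hsumk w hwm] at e3
      linarith
    · have hwv : ∀ v : Bool, w ++ [v] ∉ S := fun v h => hwS (hS.of_append_left h)
      by_cases htake : w.take (2 * m) ∈ S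
      · -- the first forbidden window starts after the first `m` letters
        have hdrop : w.drop m ∉ S := by
          intro h
          have e : w = w.take m ++ (w.take (2 * m)).drop m ++ w.drop (2 * m) := by
            rw [List.append_assoc]
            conv_lhs => rw [← List.take_append_drop m w]
            congr 1
            conv_lhs => rw [← List.take_append_drop (2 * m) w]
            rw [List.drop_append_of_le_length (by simp; omega)]
          apply hwS
          rw [e]
          refine hS.glue (by simp; omega) ?_ ?_
          · have : (w.take (2 * m)).take m = w.take m := by rw [List.take_take]; congr 1; omega
            rw [← this, List.take_append_drop]
            exact htake
          · have : (w.take (2 * m)).drop m ++ w.drop (2 * m) = w.drop m := by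
              conv_rhs => rw [← List.take_append_drop (2 * m) w]
              rw [List.drop_append_of_le_length (by simp; omega)]
            rw [this]
            exact h
        have hk0 : ∀ x : List Bool, k (w ++ x) = 0 := by
          intro x
          have hx : w.drop m ++ x ∉ S := fun h => hdrop (hS.of_append_left h)
          have e : w ++ x = w.take m ++ (w.drop m ++ x) := by
            rw [← List.append_assoc, List.take_append_drop]
          refine Finset.sum_eq_zero fun i hi => ?_
          have := Finset.mem_range.1 hi
          rw [hp.eq_zero (fun h => hwS (hS.of_append_left h)), e,
            hp.eq_zero (hS.modify_notMem_of_lt hx (by simp; omega)), sub_zero]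
        have hk1 : k w = 0 := by simpa using hk0 []
        simp only [blockG, hwS, hwv, if_false]
        rw [hadd w hwm, hk1, add_zero, Finset.sum_congr rfl fun v _ => by
          rw [hadd (w ++ [v]) (by simp; omega), hk0, add_zero]]
        simp [hk0]
      · -- the error is detected and over before the last `m` letters
        have hlin : ∀ s : ℕ, s ≤ 3 * m → ∑ v : Bool, blockG S s p (w ++ [v]) - blockG S s p w =
            -∑ v : Bool, partialFlipSum s p (w ++ [v]) * c w v := by
          intro s hs
          simp only [blockG, hwS, hwv, if_false]
          have hsum := sum_partialFlipSum_snoc hp.stationary (s := s) (w := w) (by omega)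
          have hQ : ∀ v, partialFlipSum s p (w ++ [v]) = _ :=
            fun v => hp.partialFlipSum_snoc_eq hS hwl hs htake v
          rw [Finset.sum_congr rfl fun v _ => hQ v, ← Finset.mul_sum] at hsum
          have hH : Real.negMulLog (partialFlipSum s p w) *
              (∑ v : Bool, p (lastWord m w ++ [v]) / p (lastWord m w)) =
              Real.negMulLog (partialFlipSum s p w) := by
            rw [Real.negMulLog, mul_right_comm, neg_mul, hsum]
          rw [Finset.sum_congr rfl fun v _ => by rw [hQ v, Real.negMulLog_mul],
            Finset.sum_add_distrib, ← Finset.sum_mul, mul_comm, hH, add_sub_cancel_left,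
            ← Finset.sum_neg_distrib]
          refine Finset.sum_congr rfl fun v _ => ?_
          rw [hQ v, Real.negMulLog]
          ring
        rw [hlin 0 (by omega), hlin m (by omega), Finset.sum_congr rfl fun v _ => by
          rw [hadd (w ++ [v]) (by simp; omega), add_mul], Finset.sum_add_distrib]
        ring
  have hflip : ∑ w ∈ words (3 * m), ∑ v : Bool, k (w ++ [v]) * c w v = 0 := by
    have h1 : ∀ w v, k (w ++ [v]) * c w v = ∑ i ∈ Finset.range m,
        (p ((w ++ [v]).modify i not) * c w v - p (w ++ [v]) * c w v) := by
      intro w v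
      rw [hk, Finset.sum_mul]
      exact Finset.sum_congr rfl fun i _ => sub_mul _ _ _
    rw [Finset.sum_congr rfl fun w _ => (Finset.sum_congr rfl fun v _ => h1 w v).trans
      Finset.sum_comm, Finset.sum_comm]
    refine Finset.sum_eq_zero fun i hi => ?_
    have hi' := Finset.mem_range.1 hi
    simp only [Finset.sum_sub_distrib]
    rw [sub_eq_zero, ← sum_words_flip (3 * m) i fun w => ∑ v : Bool, p (w ++ [v]) * c w v]
    refine Finset.sum_congr rfl fun w hw => Finset.sum_congr rfl fun v _ => ?_
    have hwl := mem_words.1 hw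
    rw [modify_append_of_lt not _ (by omega)]
    simp only [hc]
    rw [lastWord_modify (by omega)]
  have htot := Finset.sum_congr rfl key
  rw [Finset.sum_neg_distrib, hflip, neg_zero, Finset.sum_sub_distrib, Finset.sum_sub_distrib,
    Finset.sum_sub_distrib, ← sum_words_snoc, ← sum_words_snoc] at htot
  rw [condG, condG]
  linarith

end IsParry

/-! ### Long pasts and the entropy rate of the output -/

lemma sum_chanProb (ε : ℝ) : ∀ x : List Bool, ∑ z ∈ words x.length, chanProb ε x z = 1
  | [] => by simp [chanProb]
  | a :: x => by
    have ih := sum_chanProb ε x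
    rw [List.length_cons, sum_words_cons]
    simp only [chanProb, ← Finset.mul_sum, ih, mul_one]
    cases a <;> simp

lemma sum_append_left {p : List Bool → ℝ} (hp : IsStationary p) (k : ℕ) (c : List Bool) :
    ∑ y ∈ words k, p (y ++ c) = p c := by
  induction k with
  | zero => simp
  | succ k ih =>
    rw [sum_words_cons, Finset.sum_comm, ← ih]
    exact Finset.sum_congr rfl fun y _ => hp.sum_cons (y ++ c)

namespace IsParry

variable {S : Set (List Bool)} {m : ℕ} {t : ℝ} {ρ p : List Bool → ℝ}

/-- However long the past of the output, it tells no more about the next output letter than the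
last `j` output letters together with the `m` input letters before them: given these input
letters, the earlier outputs are independent of the later ones. -/
lemma partialCondEntropy_le (hp : IsParry S m t ρ p) (hS : IsLanguage S m) {ε : ℝ} (h0 : 0 ≤ ε)
    (h1 : ε ≤ 1) (k j : ℕ) :
    partialCondEntropy m ε p (m + j) ≤ condEntropy (output ε p) (k + m + j) := by
  have hst := hp.stationary.output h0 h1
  rw [partialCondEntropy_eq_ent2 hp.stationary (Nat.le_add_right m j),
    (hst (k + m + j + 1)).condEntropy_eq_ent2 (Nat.lt_succ_self _), sum_words_add m j,
    sum_words_add (k + m) j]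
  -- `β c z` is the joint weight of the clean letters `c` and the output `z`, and `α a c` the
  -- conditional probability of the earlier output `a`
  set β : List Bool → List Bool → ℝ := fun c z => output ε (fun x => p (c ++ x)) z with hβ
  set α : List Bool → List Bool → ℝ := fun a c =>
    ∑ y ∈ words k, chanProb ε (y ++ c) a * (p (y ++ c) / p c) with hα
  have hβ0 : ∀ c z, 0 ≤ β c z := fun c z => output_nonneg h0 h1 fun _ _ => hp.stationary.nonneg _
  have hα0 : ∀ a c, 0 ≤ α a c := fun a c => Finset.sum_nonneg fun y _ =>
    mul_nonneg (chanProb_nonneg h0 h1 _ _)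
      (div_nonneg (hp.stationary.nonneg _) (hp.stationary.nonneg _))
  have hzero : ∀ c ∉ S, ∀ z, β c z = 0 := by
    intro c hc z
    rw [hβ]
    simp only
    rw [output_congr (q := fun x => 0 * p x) fun x _ => by
      rw [zero_mul, hp.eq_zero fun h => hc (hS.of_append_left h)], output_mul_left, zero_mul]
  have hsplit : ∀ a z : List Bool, a.length = k + m →
      output ε p (a ++ z) = ∑ c ∈ words m, α a c * β c z := by
    intro a z ha
    rw [output_append, ha, sum_words_add, Finset.sum_comm]
    refine Finset.sum_congr rfl fun c hc => ?_
    rw [hα, Finset.sum_mul]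
    refine Finset.sum_congr rfl fun y _ => ?_
    rw [mul_assoc]
    congr 1
    rw [hβ]
    simp only
    rw [← output_mul_left]
    refine output_congr fun x _ => ?_
    by_cases hcS : c ∈ S
    · have h2 := hp.markov_append hS y (w := c) x (mem_words.1 hc).ge
      have h3 := (hp.pos hcS).ne'
      field_simp
      linarith
    · rw [hp.eq_zero fun h => hcS (hS.of_append_right (u := y) (hS.of_append_left h)),
        hp.eq_zero (w := c ++ x) fun h => hcS (hS.of_append_left h), mul_zero]
  have hαsum : ∀ c ∈ S, c.length = m → ∑ a ∈ words (k + m), α a c = 1 := by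
    intro c hcS hc
    rw [hα]
    simp only
    rw [Finset.sum_comm]
    have h2 : ∀ y ∈ words k, ∑ a ∈ words (k + m), chanProb ε (y ++ c) a * (p (y ++ c) / p c) =
        p (y ++ c) / p c := by
      intro y hy
      have h3 := sum_chanProb ε (y ++ c)
      rw [List.length_append, mem_words.1 hy, hc] at h3
      rw [← Finset.sum_mul, h3, one_mul]
    rw [Finset.sum_congr rfl h2, ← Finset.sum_div, sum_append_left hp.stationary,
      div_self (hp.pos hcS).ne']
  have hstep : ∀ a ∈ words (k + m), ∀ z ∈ words j,
      ∑ c ∈ words m, α a c * ent2 (β c (z ++ [false])) (β c (z ++ [true])) ≤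
        ent2 (output ε p (a ++ z ++ [false])) (output ε p (a ++ z ++ [true])) := by
    intro a ha z hz
    rw [List.append_assoc, List.append_assoc, hsplit a _ (mem_words.1 ha),
      hsplit a _ (mem_words.1 ha)]
    simp only [← ent2_mul]
    refine sum_ent2_le _ (fun c _ => mul_nonneg (hα0 a c) (hβ0 c _))
      (fun c _ => mul_nonneg (hα0 a c) (hβ0 c _)) ?_
    rw [← hsplit a _ (mem_words.1 ha), ← hsplit a _ (mem_words.1 ha), ← List.append_assoc,
      ← List.append_assoc, (hst ((a ++ z).length + 1)).append _ (Nat.lt_succ_self _)]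
    exact (hst _).le_one le_rfl
  refine le_trans (le_of_eq ?_)
    (Finset.sum_le_sum fun a ha => Finset.sum_le_sum fun z hz => hstep a ha z hz)
  have hre : ∑ a ∈ words (k + m), ∑ z ∈ words j, ∑ c ∈ words m,
      α a c * ent2 (β c (z ++ [false])) (β c (z ++ [true])) =
      ∑ c ∈ words m, ∑ z ∈ words j,
        (∑ a ∈ words (k + m), α a c) * ent2 (β c (z ++ [false])) (β c (z ++ [true])) := by
    simp only [Finset.sum_mul]
    rw [Finset.sum_comm, Finset.sum_congr rfl fun z _ => Finset.sum_comm, Finset.sum_comm]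
  rw [hre]
  refine Finset.sum_congr rfl fun c hc => Finset.sum_congr rfl fun z _ => ?_
  rw [List.append_assoc, List.append_assoc, partialOutput_append ε p _ (mem_words.1 hc),
    partialOutput_append ε p _ (mem_words.1 hc)]
  by_cases hcS : c ∈ S
  · rw [hαsum c hcS (mem_words.1 hc), one_mul]
  · have e : ∀ z, output ε (fun x => p (c ++ x)) z = 0 := hzero c hcS
    rw [e, e, hzero c hcS, hzero c hcS]
    simp [ent2]

/-- The lower bound for the conditional entropies of the output does not depend on the length of
the past. -/
lemma partialCondEntropy_le_condEntropy (hp : IsParry S m t ρ p) (hS : IsLanguage S m) {ε : ℝ}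
    (h0 : 0 ≤ ε) (h1 : ε ≤ 1) {n : ℕ} (hn : 3 * m ≤ n) :
    partialCondEntropy m ε p (3 * m) ≤ condEntropy (output ε p) n := by
  have := hp.partialCondEntropy_le hS h0 h1 (n - 3 * m) (2 * m)
  rwa [show m + 2 * m = 3 * m by ring, show n - 3 * m + m + 2 * m = n by omega] at this

/-- With `3 m` letters of the past, `m` of them clean or not, the entropy of the output has the
asserted expansion. -/
lemma partialCondEntropy_isBigO (hp : IsParry S m t ρ p) (hS : IsLanguage S m) {s : ℕ}
    (hs : s = 0 ∨ s = m) :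
    (fun ε : ℝ => partialCondEntropy s ε p (3 * m) - (capacity S
      + fCoeff (2 * m) p * (ε * Real.log (1 / ε)) + gCoeff (3 * m) p * ε))
      =O[𝓝[>] 0] fun ε : ℝ => ε ^ 2 * Real.log ε ^ 2 := by
  have hsm : s ≤ m := by omega
  have h := hp.partialCondEntropy_expansion (s := s) (n := 3 * m) (by omega) (by omega)
  have hF : condF S s p (3 * m) = fCoeff (2 * m) p := by
    rw [hp.fCoeff_eq hS, ← hp.condF_eq_two_mul hS (show 2 * m ≤ 3 * m by omega)]
    exact hp.condF_eq_condF_zero hS (by omega)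
  have hG : condG S s p (3 * m) = gCoeff (3 * m) p := by
    rw [hp.gCoeff_eq hS]
    rcases hs with rfl | rfl
    · rfl
    · exact hp.condG_eq_condG_zero hS
  rwa [hF, hG, ← hp.capacity_eq] at h

lemma condEntropy_output_eq_partial (hp : IsParry S m t ρ p) {ε : ℝ} (h0 : 0 ≤ ε) (h1 : ε ≤ 1)
    (n : ℕ) : condEntropy (output ε p) n = partialCondEntropy 0 ε p n := by
  rw [(hp.stationary.output h0 h1 (n + 1)).condEntropy_eq_sub (Nat.lt_succ_self n),
    partialCondEntropy]
  simp only [partialOutput_zero]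

/-- Any quantity between the two bounds, up to `O(ε² log² ε)`, has the asserted expansion. -/
lemma isBigO_of_le_of_le (hp : IsParry S m t ρ p) (hS : IsLanguage S m) {H : ℝ → ℝ} {C : ℝ}
    (hlow : ∀ᶠ ε : ℝ in 𝓝[>] 0, partialCondEntropy m ε p (3 * m) ≤ H ε)
    (hup : ∀ᶠ ε : ℝ in 𝓝[>] 0, H ε ≤ condEntropy (output ε p) (3 * m)
      + C * (ε ^ 2 * Real.log ε ^ 2)) :
    (fun ε : ℝ => H ε - (capacity S
      + fCoeff (2 * m) p * (ε * Real.log (1 / ε)) + gCoeff (3 * m) p * ε))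
      =O[𝓝[>] 0] fun ε : ℝ => ε ^ 2 * Real.log ε ^ 2 := by
  obtain ⟨A, hA⟩ := (hp.partialCondEntropy_isBigO hS (s := m) (Or.inr rfl)).bound
  obtain ⟨B, hB⟩ := (hp.partialCondEntropy_isBigO hS (s := 0) (Or.inl rfl)).bound
  refine IsBigO.of_bound (|A| + (|B| + |C|)) ?_
  filter_upwards [hlow, hup, hA, hB, Ioo_mem_nhdsGT (show (0 : ℝ) < 1 by norm_num)]
    with ε h1 h2 h3 h4 hε
  rw [hp.condEntropy_output_eq_partial hε.1.le hε.2.le] at h2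
  have hr0 : 0 ≤ ε ^ 2 * Real.log ε ^ 2 := by positivity
  rw [Real.norm_eq_abs, Real.norm_eq_abs, abs_of_nonneg hr0] at h3 h4 ⊢
  set r := ε ^ 2 * Real.log ε ^ 2
  have hA' := mul_le_mul_of_nonneg_right (le_abs_self A) hr0
  have hB' := mul_le_mul_of_nonneg_right (le_abs_self B) hr0
  have hC' := mul_le_mul_of_nonneg_right (le_abs_self C) hr0
  have pA := mul_nonneg (abs_nonneg A) hr0
  have pB := mul_nonneg (abs_nonneg B) hr0
  have pC := mul_nonneg (abs_nonneg C) hr0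
  have h3' := abs_le.1 h3
  have h4' := abs_le.1 h4
  rw [abs_le, add_mul, add_mul]
  constructor <;> linarith

lemma supCondEntropy_isBigO (hp : IsParry S m t ρ p) (hS : IsLanguage S m) {n : ℕ}
    (hn : 3 * m ≤ n) :
    (fun ε : ℝ => supCondEntropy S n ε - (capacity S
      + fCoeff (2 * m) p * (ε * Real.log (1 / ε)) + gCoeff (3 * m) p * ε))
      =O[𝓝[>] 0] fun ε : ℝ => ε ^ 2 * Real.log ε ^ 2 := by
  obtain ⟨C, -, hC⟩ := hp.exists_condEntropy_output_le hS (n := n) (by omega)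
  have hmem : ∀ ε : ℝ, condEntropy (output ε p) n ∈ {H : ℝ | ∃ q : List Bool → ℝ,
      IsStationaryOfLength (n + 1) q ∧ allowedOfLength (n + 1) q ⊆ S ∧
      H = condEntropy (output ε q) n} := fun ε =>
    ⟨p, hp.stationary _, fun w hw => (hp.pos_iff w).1 hw.2, rfl⟩
  refine hp.isBigO_of_le_of_le hS (C := C) ?_ ?_
  · filter_upwards [hC, Ioo_mem_nhdsGT (show (0 : ℝ) < 1 by norm_num)] with ε h hε
    refine (hp.partialCondEntropy_le_condEntropy hS hε.1.le hε.2.le hn).trans ?_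
    exact le_csSup ⟨_, by rintro _ ⟨q, hq, hqS, rfl⟩; exact h q hq hqS⟩ (hmem ε)
  · filter_upwards [hC, Ioo_mem_nhdsGT (show (0 : ℝ) < 1 by norm_num)] with ε h hε
    refine csSup_le ⟨_, hmem ε⟩ ?_
    rintro _ ⟨q, hq, hqS, rfl⟩
    refine (h q hq hqS).trans (add_le_add ?_ le_rfl)
    exact (hp.stationary.output hε.1.le hε.2.le).condEntropy_antitone hn

lemma supEntropyRate_isBigO (hp : IsParry S m t ρ p) (hS : IsLanguage S m) {M : ℕ}
    (hM : m ≤ M) :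
    (fun ε : ℝ => supEntropyRate S M ε - (capacity S
      + fCoeff (2 * m) p * (ε * Real.log (1 / ε)) + gCoeff (3 * m) p * ε))
      =O[𝓝[>] 0] fun ε : ℝ => ε ^ 2 * Real.log ε ^ 2 := by
  obtain ⟨C, -, hC⟩ := hp.exists_condEntropy_output_le hS (n := 3 * m) (by omega)
  have hmem : ∀ ε : ℝ, entropyRate (output ε p) ∈ {H : ℝ | ∃ q : List Bool → ℝ,
      IsMarkovChain M q ∧ allowed q ⊆ S ∧ H = entropyRate (output ε q)} := fun ε =>
    ⟨p, hp.isMarkovChain hS hM, hp.allowed_eq.le, rfl⟩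
  have hub : ∀ᶠ ε : ℝ in 𝓝[>] 0, ∀ q : List Bool → ℝ, IsMarkovChain M q → allowed q ⊆ S →
      entropyRate (output ε q) ≤
        condEntropy (output ε p) (3 * m) + C * (ε ^ 2 * Real.log ε ^ 2) := by
    filter_upwards [hC, Ioo_mem_nhdsGT (show (0 : ℝ) < 1 by norm_num)] with ε h hε q hq hqS
    exact ((hq.stationary.output hε.1.le hε.2.le).entropyRate_le_condEntropy (3 * m)).trans
      (h q (hq.stationary _) fun w hw => hqS hw.2)
  refine hp.isBigO_of_le_of_le hS (C := C) ?_ ?_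
  · filter_upwards [hub, Ioo_mem_nhdsGT (show (0 : ℝ) < 1 by norm_num)] with ε h hε
    refine le_trans ?_ (le_csSup ⟨_, by rintro _ ⟨q, hq, hqS, rfl⟩; exact h q hq hqS⟩ (hmem ε))
    exact (hp.stationary.output hε.1.le hε.2.le).le_entropyRate fun n hn =>
      hp.partialCondEntropy_le_condEntropy hS hε.1.le hε.2.le hn
  · filter_upwards [hub] with ε h
    refine csSup_le ⟨_, hmem ε⟩ ?_
    rintro _ ⟨q, hq, hqS, rfl⟩
    exact h q hq hqS

end IsParry

end BSC

theorem theorem3p2 (S : Set (List Bool)) (hfin : BSC.IsFiniteType S)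
    (hirr : BSC.IsIrreducible S) (hne : ∃ w ∈ S, w ≠ []) :
    ∃ pmax : List Bool → ℝ,
      (∀ m : ℕ, BSC.topOrder S ≤ m →
        ∀ q : List Bool → ℝ, BSC.IsMaxEntropyChain S m q ↔ q = pmax) ∧
      (∀ n : ℕ, 3 * BSC.topOrder S ≤ n →
        (fun ε : ℝ => BSC.supCondEntropy S n ε -
            (BSC.capacity S
              + BSC.fCoeff (2 * BSC.topOrder S) pmax * (ε * Real.log (1 / ε))
              + BSC.gCoeff (3 * BSC.topOrder S) pmax * ε))
          =O[𝓝[>] 0] fun ε : ℝ => ε ^ 2 * Real.log ε ^ 2) ∧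
      (∀ m : ℕ, BSC.topOrder S ≤ m →
        (fun ε : ℝ => BSC.supEntropyRate S m ε -
            (BSC.capacity S
              + BSC.fCoeff (2 * BSC.topOrder S) pmax * (ε * Real.log (1 / ε))
              + BSC.gCoeff (3 * BSC.topOrder S) pmax * ε))
          =O[𝓝[>] 0] fun ε : ℝ => ε ^ 2 * Real.log ε ^ 2) := by
  have hS := BSC.isLanguage hfin hirr hne
  obtain ⟨t, ρ, p, hp⟩ := hS.exists_isParry
  exact ⟨p, fun m hm q => hp.isMaxEntropyChain_iff hS hm q,
    fun n hn => hp.supCondEntropy_isBigO hS hn, fun m hm => hp.supEntropyRate_isBigO hS hm⟩
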